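/- Let $S$ be a $d$-dimensional ($d\ge 0$) Hausdorff manifold of class $C^2$, let $T\subset\mathbb R$ be a connected open set, and let $\tilde a_t$, $b_t$, $\mathcal U(t,\cdot)$ be a positive definite metric, a 1-form and a function on $S$, depending on $t\in T$ and of class $C^1$ jointly in $(t,q)\in T\times S$. For $t_0<t_1$ in $T$, a curve $q:[t_0,t_1]\to S$ of class $C^2$ is called a $C^2$ stationary point of the classical action $$\mathcal S[q]=\int_{t_0}^{t_1}\Big[\tfrac12\tilde a_t(\dot q,\dot q)+b_t(\dot q)-\mathcal U(t,q)\Big]dt$$ if $\frac{d}{dr}\big|_{r=0}\mathcal S[q_r]=0$ for every variation $q_r$ of $q=q_0$ through $C^1$ curves with the same end points that is continuously differentiable in $r$ in the $C^1$ topology. Let $\psi:T\times S\to(0,\infty)$ be any $C^1$ function, let $\mu\in(0,\infty]$ (with $1/\infty=0$), and let $M=T\times S\times\mathbb R$, with points $(t,q,y)$, carry $$g_{1/\mu,\psi}=\psi\Big[\pi_S^*\tilde a_t-dt\otimes(dy-\pi_S^*b_t)-(dy-\pi_S^*b_t)\otimes dt-\Big(2\,\mathcal U-\frac{\psi}{\mu^2}\Big)dt^2\Big],$$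 where $\pi_S:M\to S$ is the projection, and the time orientation for which the lightlike field $n=\partial/\partial y$ is future directed. The $1/\mu$-lift of $(t,q(t))$, $t\in[t_0,t_1]$, starting at $y_0\in\mathbb R$ is the curve $(t,q(t),y(t))$ with $$y(t)=y_0+\int_{t_0}^{t}\Big[\tfrac12\tilde a_{t'}(\dot q,\dot q)+b_{t'}(\dot q)+\frac{\psi}{\mu^2}-\mathcal U\Big]dt'.$$ Then the following hold. 1. The metric $g_{1/\mu,\psi}$ is Lorentzian. If $q:[t_0,t_1]\to S$ is a $C^2$ stationary point of the classical action, then every $1/\mu$-lift of $(t,q(t))$ is, up to reparametrization, a future-directed causal geodesic of $(M,g_{1/\mu,\psi})$, and its projection to $T\times S$ is $(t,q(t))$. If $\mu<\infty$ the geodesic is timelike, and its proper time is given by $d\tau=\frac{\psi}{\mu}\,dt$. If $\mu=\infty$ the geodesic is lightlike, and an affine parameter is given by $d\lambda=\psi\,dt$. 2. Conversely, if a future-directed causal geodesic segment of $(M,g_{1/\mu,\psi})$ is, up to reparametrization, a $1/\mu$-lift of its own projection $(t,q(t))$, $t\in[t_0,t_1]$, $t_0<t_1$, then $q$ is a $C^2$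 stationary point of the classical action on $[t_0,t_1]$. 3. In particular, every lightlike geodesic segment of $(M,g_{0,\psi})$ (of either time orientation) that is not contained in a flow line of $n=\partial/\partial y$ projects, once parametrized by $t$, to a $C^2$ stationary point of the classical action, and every $C^2$ stationary point is the projection of such a geodesic (which can be chosen future directed). -/

import Mathlib

open Set MeasureTheory
open scoped Manifold ENNReal Topology

noncomputable section

namespace Eisenhart

/-! ### Semi-Riemannian geodesics on a manifold without boundary -/

section Geodesics

variable {E : Type*} [NormedAddCommGroup E] [NormedSpace ℝ E]
  {H : Type*} [TopologicalSpace H] (I : ModelWithCorners ℝ E H)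
  {M : Type*} [TopologicalSpace M] [ChartedSpace H M]

/-- Velocity `γ'(s)` of a curve `γ : J → M` (one-sided at the end points of an interval `J`). -/
def velocity (γ : ℝ → M) (J : Set ℝ) (s : ℝ) : TangentSpace I (γ s) :=
  mfderivWithin 𝓘(ℝ, ℝ) I γ J s (1 : ℝ)

/-- The components of a field `g` of bilinear forms in the chart `φ` around `x₀`: the pullback of
`g` by `φ⁻¹`, at the point `z` of the model space, evaluated on the vectors `u, v`. -/
def chartMetric (g : ∀ m : M, TangentSpace I m →L[ℝ] TangentSpace I m →L[ℝ] ℝ)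
    (x₀ : M) (z u v : E) : ℝ :=
  g ((extChartAt I x₀).symm z)
    (mfderiv 𝓘(ℝ, E) I (extChartAt I x₀).symm z u)
    (mfderiv 𝓘(ℝ, E) I (extChartAt I x₀).symm z v)

/-- Christoffel symbols of the first kind in the chart around `x₀`:
`Γ(u,v;w) = ½ (∂_u g(v,w) + ∂_v g(u,w) - ∂_w g(u,v))`, that is `g(∇_u v, w)` for the Levi-Civita
connection and constant coordinate fields `u, v, w`. -/
def christoffel (g : ∀ m : M, TangentSpace I m →L[ℝ] TangentSpace I m →L[ℝ] ℝ)
    (x₀ : M) (z u v w : E) : ℝ :=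
  (1 / 2) * (fderiv ℝ (fun z' => chartMetric I g x₀ z' v w) z u
    + fderiv ℝ (fun z' => chartMetric I g x₀ z' u w) z v
    - fderiv ℝ (fun z' => chartMetric I g x₀ z' u v) z w)

/-- The expression of the curve `γ` in the chart around `x₀`. -/
def chartCurve (γ : ℝ → M) (x₀ : M) (s : ℝ) : E := extChartAt I x₀ (γ s)

/-- `γ` is an (affinely parametrized) geodesic of the metric `g` on the interval `J`: it is `C²`
and in every chart its coordinate expression `c` satisfies the geodesic equation
`g_{ij} c''^j + Γ_{i,jk} c'^j c'^k = 0`, which is the equation `c''^i + Γ^i_{jk} c'^j c'^k = 0`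
with the free index lowered by the nondegenerate metric. -/
def IsGeodesicOn (g : ∀ m : M, TangentSpace I m →L[ℝ] TangentSpace I m →L[ℝ] ℝ)
    (γ : ℝ → M) (J : Set ℝ) : Prop :=
  ContMDiffOn 𝓘(ℝ, ℝ) I 2 γ J ∧
  ∀ (x₀ : M), ∀ s ∈ J, γ s ∈ (extChartAt I x₀).source →
    ∀ w : E, chartMetric I g x₀ (chartCurve I γ x₀ s)
        (derivWithin (derivWithin (chartCurve I γ x₀) J) J s) w
      + christoffel I g x₀ (chartCurve I γ x₀ s) (derivWithin (chartCurve I γ x₀) J s)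
        (derivWithin (chartCurve I γ x₀) J s) w = 0

end Geodesics

/-! ### Linear algebra of Lorentzian forms -/

section Lorentz

variable {V : Type*} [TopologicalSpace V] [AddCommGroup V] [Module ℝ V]

/-- A symmetric bilinear form of signature `(-,+,…,+)`: there is a negative vector on whose
orthogonal complement the form is positive definite. -/
def IsLorentzian (B : V →L[ℝ] V →L[ℝ] ℝ) : Prop :=
  (∀ v w, B v w = B w v) ∧ ∃ v, B v v < 0 ∧ ∀ w, B v w = 0 → w ≠ 0 → 0 < B w w

def IsTimelike (B : V →L[ℝ] V →L[ℝ] ℝ) (v : V) : Prop := B v v < 0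

def IsLightlike (B : V →L[ℝ] V →L[ℝ] ℝ) (v : V) : Prop := v ≠ 0 ∧ B v v = 0

/-- `v` is causal and future directed, the time orientation being the one for which the lightlike
vector `n` is future directed. -/
def IsFutureCausal (B : V →L[ℝ] V →L[ℝ] ℝ) (n v : V) : Prop :=
  v ≠ 0 ∧ B v v ≤ 0 ∧ (B n v < 0 ∨ ∃ r : ℝ, 0 < r ∧ v = r • n)

/-- The tensor product `α ⊗ β` of two covectors, `(α ⊗ β)(u, v) = α u * β v`. -/
def tensor {F : Type*} [NormedAddCommGroup F] [NormedSpace ℝ F] (α β : F →L[ℝ] ℝ) :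
    F →L[ℝ] F →L[ℝ] ℝ := α.smulRight β

end Lorentz

/-! ### The classical system -/

variable {d : ℕ} {S : Type*} [TopologicalSpace S]
  [ChartedSpace (EuclideanSpace ℝ (Fin d)) S] [IsManifold (𝓡 d) 2 S]

/-- The data of a classical Lagrangian system on the configuration space `S`, for times in the open
interval `T`: a time dependent positive definite metric `a`, a time dependent 1-form `b` and a time
dependent potential `U`, all of class `C¹` jointly in `(t, q) ∈ T × S`. -/
structure ClassicalSystem (d : ℕ) (S : Type*) [TopologicalSpace S]
    [ChartedSpace (EuclideanSpace ℝ (Fin d)) S] [IsManifold (𝓡 d) 2 S] (T : Set ℝ) where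
  a : ℝ → ∀ q : S, TangentSpace (𝓡 d) q →L[ℝ] TangentSpace (𝓡 d) q →L[ℝ] ℝ
  b : ℝ → ∀ q : S, TangentSpace (𝓡 d) q →L[ℝ] ℝ
  U : ℝ → S → ℝ
  a_symm : ∀ t ∈ T, ∀ (q : S) (v w : TangentSpace (𝓡 d) q), a t q v w = a t q w v
  a_pos : ∀ t ∈ T, ∀ (q : S) (v : TangentSpace (𝓡 d) q), v ≠ 0 → 0 < a t q v v
  contMDiffOn_a : ContMDiffOn (𝓘(ℝ, ℝ).prod (𝓡 d))
    ((𝓡 d).prod 𝓘(ℝ, EuclideanSpace ℝ (Fin d) →L[ℝ] EuclideanSpace ℝ (Fin d) →L[ℝ] ℝ)) 1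
    (fun p : ℝ × S => Bundle.TotalSpace.mk'
      (EuclideanSpace ℝ (Fin d) →L[ℝ] EuclideanSpace ℝ (Fin d) →L[ℝ] ℝ)
      (E := fun q : S => TangentSpace (𝓡 d) q →L[ℝ] TangentSpace (𝓡 d) q →L[ℝ] ℝ)
      p.2 (a p.1 p.2)) (T ×ˢ univ)
  contMDiffOn_b : ContMDiffOn (𝓘(ℝ, ℝ).prod (𝓡 d))
    ((𝓡 d).prod 𝓘(ℝ, EuclideanSpace ℝ (Fin d) →L[ℝ] ℝ)) 1
    (fun p : ℝ × S => Bundle.TotalSpace.mk' (EuclideanSpace ℝ (Fin d) →L[ℝ] ℝ)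
      (E := fun q : S => TangentSpace (𝓡 d) q →L[ℝ] Bundle.Trivial S ℝ q)
      p.2 (b p.1 p.2)) (T ×ˢ univ)
  contMDiffOn_U : ContMDiffOn (𝓘(ℝ, ℝ).prod (𝓡 d)) 𝓘(ℝ, ℝ) 1
    (fun p : ℝ × S => U p.1 p.2) (T ×ˢ univ)

namespace ClassicalSystem

variable {T : Set ℝ} (sys : ClassicalSystem d S T)

/-- The Lagrangian `½ a_t(v,v) + b_t(v) - U(t,q)`. -/
def lagrangian (t : ℝ) (q : S) (v : TangentSpace (𝓡 d) q) : ℝ :=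
  (1 / 2) * sys.a t q v v + sys.b t q v - sys.U t q

/-- The classical action of a curve `q : [t₀, t₁] → S`. -/
def action (t₀ t₁ : ℝ) (q : ℝ → S) : ℝ :=
  ∫ t in t₀..t₁, sys.lagrangian t (q t) (velocity (𝓡 d) q (Icc t₀ t₁) t)

end ClassicalSystem

/-- A variation `Q r`, `|r| < ε`, of the curve `q : [t₀, t₁] → S` with fixed end points through `C¹`
curves, continuously differentiable with respect to `r` in the `C¹` topology of curves: `Q` is
jointly `C¹` and, in every chart, the coordinate velocity `∂_t Q` is differentiable in `r` with
derivative `∂_r ∂_t Q` continuous in `(r, t)`. -/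
structure IsVariation (q : ℝ → S) (t₀ t₁ ε : ℝ) (Q : ℝ → ℝ → S) : Prop where
  zero : ∀ t ∈ Icc t₀ t₁, Q 0 t = q t
  left : ∀ r ∈ Ioo (-ε) ε, Q r t₀ = q t₀
  right : ∀ r ∈ Ioo (-ε) ε, Q r t₁ = q t₁
  contMDiffOn : ContMDiffOn 𝓘(ℝ, ℝ × ℝ) (𝓡 d) 1 (fun p : ℝ × ℝ => Q p.1 p.2)
    (Ioo (-ε) ε ×ˢ Icc t₀ t₁)
  mixed : ∀ (x₀ : S), ∀ r ∈ Ioo (-ε) ε, ∀ t ∈ Icc t₀ t₁, Q r t ∈ (extChartAt (𝓡 d) x₀).source →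
    DifferentiableAt ℝ
        (fun r' => derivWithin (chartCurve (𝓡 d) (Q r') x₀) (Icc t₀ t₁) t) r ∧
      ContinuousWithinAt (fun p : ℝ × ℝ =>
          deriv (fun r' => derivWithin (chartCurve (𝓡 d) (Q r') x₀) (Icc t₀ t₁) p.2) p.1)
        (Ioo (-ε) ε ×ˢ Icc t₀ t₁) (r, t)

/-- `q : [t₀, t₁] → S` is a `C²` stationary point of the classical action on the set of `C¹` curves
with the same end points. -/
def ClassicalSystem.IsStationary {T : Set ℝ} (sys : ClassicalSystem d S T)
    (q : ℝ → S) (t₀ t₁ : ℝ) : Prop :=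
  ContMDiffOn 𝓘(ℝ, ℝ) (𝓡 d) 2 q (Icc t₀ t₁) ∧
  ∀ (ε : ℝ) (Q : ℝ → ℝ → S), 0 < ε → IsVariation (d := d) q t₀ t₁ ε Q →
    HasDerivAt (fun r => sys.action t₀ t₁ (Q r)) 0 0

/-! ### The Eisenhart spacetime

The spacetime `T × S × ℝ`, with points `(t, q, y)`, is the open subset `{t ∈ T}` of `ℝ × S × ℝ`. -/

/-- The model (with the product charts) of the manifold `ℝ × S × ℝ`. -/
abbrev modelM (d : ℕ) := 𝓘(ℝ, ℝ).prod ((𝓡 d).prod 𝓘(ℝ, ℝ))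

/-- The model vector space `ℝ × ℝᵈ × ℝ`, equal to each tangent space of `ℝ × S × ℝ`. -/
abbrev modelE (d : ℕ) := ℝ × EuclideanSpace ℝ (Fin d) × ℝ

/-- The 1-form `dt`. -/
def dt (d : ℕ) : modelE d →L[ℝ] ℝ := ContinuousLinearMap.fst ℝ _ _

/-- The differential of the projection `π_S : ℝ × S × ℝ → S`. -/
def dq (d : ℕ) : modelE d →L[ℝ] EuclideanSpace ℝ (Fin d) :=
  (ContinuousLinearMap.fst ℝ _ _).comp (ContinuousLinearMap.snd ℝ _ _)

/-- The 1-form `dy`. -/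
def dy (d : ℕ) : modelE d →L[ℝ] ℝ :=
  (ContinuousLinearMap.snd ℝ _ _).comp (ContinuousLinearMap.snd ℝ _ _)

/-- The vector field `n = ∂/∂y`. -/
def n (m : ℝ × S × ℝ) : TangentSpace (modelM d) m :=
  (((0 : ℝ), (0 : EuclideanSpace ℝ (Fin d)), (1 : ℝ)) : modelE d)

/-- The number `1/μ ∈ [0, ∞)` for `μ ∈ (0, ∞]`. -/
def recip (μ : ℝ≥0∞) : ℝ := (μ⁻¹).toReal

/-- The parameter `t ↦ ∫_{t₀}^t c ψ(t', q(t')) dt'` along `t ↦ (t, q(t))`, that is `c ψ dt`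
integrated from `t₀`. -/
def parameter (c : ℝ) (ψ : ℝ → S → ℝ) (q : ℝ → S) (t₀ t : ℝ) : ℝ :=
  ∫ t' in t₀..t, c * ψ t' (q t')

namespace ClassicalSystem

variable {T : Set ℝ} (sys : ClassicalSystem d S T)

/-- The Eisenhart metric
`ψ [π_S^* a_t - dt ⊗ (dy - π_S^* b_t) - (dy - π_S^* b_t) ⊗ dt - (2U - ψ/μ²) dt ⊗ dt]`. -/
def metric (μ : ℝ≥0∞) (ψ : ℝ → S → ℝ) (m : ℝ × S × ℝ) :
    TangentSpace (modelM d) m →L[ℝ] TangentSpace (modelM d) m →L[ℝ] ℝ :=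
  let t := m.1
  let q := m.2.1
  let a : EuclideanSpace ℝ (Fin d) →L[ℝ] EuclideanSpace ℝ (Fin d) →L[ℝ] ℝ := sys.a t q
  let b : EuclideanSpace ℝ (Fin d) →L[ℝ] ℝ := sys.b t q
  let β : modelE d →L[ℝ] ℝ := dy d - b.comp (dq d)
  let g : modelE d →L[ℝ] modelE d →L[ℝ] ℝ :=
    ψ t q • (a.bilinearComp (dq d) (dq d) - tensor (dt d) β - tensor β (dt d)
      - (2 * sys.U t q - ψ t q * recip μ ^ 2) • tensor (dt d) (dt d))
  g

/-- The `1/μ`-lift, starting at height `y₀` over `(t₀, q(t₀))`, of the curve `t ↦ (t, q(t))`,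
`t ∈ [t₀, t₁]`. -/
def lift (μ : ℝ≥0∞) (ψ : ℝ → S → ℝ) (q : ℝ → S) (t₀ t₁ y₀ : ℝ) (t : ℝ) : ℝ × S × ℝ :=
  (t, q t, y₀ + ∫ t' in t₀..t,
    ((1 / 2) * sys.a t' (q t') (velocity (𝓡 d) q (Icc t₀ t₁) t')
        (velocity (𝓡 d) q (Icc t₀ t₁) t')
      + sys.b t' (q t') (velocity (𝓡 d) q (Icc t₀ t₁) t')
      + (ψ t' (q t') * recip μ ^ 2 - sys.U t' (q t'))))

/-- `x` is a geodesic segment of the Eisenhart spacetime `(T × S × ℝ, g_{1/μ,ψ})`, affinely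
parametrized by `[l₀, l₁]`. -/
def IsGeodesic (μ : ℝ≥0∞) (ψ : ℝ → S → ℝ) (x : ℝ → ℝ × S × ℝ) (l₀ l₁ : ℝ) : Prop :=
  (∀ l ∈ Icc l₀ l₁, (x l).1 ∈ T) ∧ IsGeodesicOn (modelM d) (sys.metric μ ψ) x (Icc l₀ l₁)

end ClassicalSystem

/-- The projection to `T × S` of the curve `x`, defined on `[l₀, l₁]`, is, once parametrized with
`t`, the curve `(t, q(t))`, `t ∈ [t₀, t₁]`. -/
def ProjectsTo (x : ℝ → ℝ × S × ℝ) (l₀ l₁ : ℝ) (q : ℝ → S) (t₀ t₁ : ℝ) : Prop :=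
  (fun l => (x l).1) '' Icc l₀ l₁ = Icc t₀ t₁ ∧ ∀ l ∈ Icc l₀ l₁, (x l).2.1 = q (x l).1

/-- The curve `x`, defined on `[l₀, l₁]`, is contained in a flow line of `∂/∂y`. -/
def InFlowLine (x : ℝ → ℝ × S × ℝ) (l₀ l₁ : ℝ) : Prop :=
  ∃ (t : ℝ) (q : S), ∀ l ∈ Icc l₀ l₁, (x l).1 = t ∧ (x l).2.1 = q

end Eisenhart

end

noncomputable section

namespace Eisenhart

/-! ### Curves in charts -/

section Curves

variable {E : Type*} [NormedAddCommGroup E] [NormedSpace ℝ E]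
  {H : Type*} [TopologicalSpace H] {I : ModelWithCorners ℝ E H}
  {M : Type*} [TopologicalSpace M] [ChartedSpace H M]

/-! The proof rests on one identity. Let a curve x over q be run so that ψ dt/ds = k and dy/dt is
the rate of the 1/μ-lift. Then g(x', w) = k (p(w_q) - w_y - E w_t) for each constant coordinate
vector w, where p = a(q̇, ·) + b is the momentum and E = ½ a(q̇, q̇) + U the energy: both ψ and μ
have cancelled. The geodesic equation with lowered index reads d/ds g(x', w) - ½ (∂_w g)(x', x') =
0. In its second term the derivative of the prefactor ψ cancels against the derivative of the mass
term ψ/μ², and the left side becomes (k²/ψ) EL(w_q - w_t q̇), with EL the Euler-Lagrange expression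
of q (`geodesicExpr_eq`). Thus for k ≠ 0 the geodesic equation of the lift is the Euler-Lagrange
equation of q; its time component is the energy law, a consequence of the others. The inverse metric
never enters.

Stationarity is equivalent to the Euler-Lagrange equation by d/dt p(h) = ∂_r L + EL(h), where h is
the variation field (`hasDerivAt_momentumAlong`). The pairing p(h) is independent of charts and
vanishes at the end points, so integrating over the whole interval shows that solutions are
stationary (`IsEL.isStationary`). Variations by bumps inside a chart, with the fundamental lemma of
the calculus of variations, give the converse (`IsStationary.isEL`).

For a geodesic given in advance, the metric does not depend on y, so k = ψ dt/ds = -g(n, x') is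
constant (`IsGeodesic.exists_deriv_time`). If k = 0, then t is constant, and a null curve has a(q',
q') = 0, hence stays on a flow line of n. If k ≠ 0, then t is a C² parameter of either orientation;
on a null geodesic the equation g(x', x') = 0, solved for dy/dt, yields exactly the rate of the
lift, and the identity applies. -/

theorem contDiffWithinAt_chartCurve {n : WithTop ℕ∞} [IsManifold I n M] {γ : ℝ → M} {J : Set ℝ}
    {x₀ : M} {s : ℝ} (h : ContMDiffWithinAt 𝓘(ℝ, ℝ) I n γ J s)
    (hs : γ s ∈ (extChartAt I x₀).source) :
    ContDiffWithinAt ℝ n (chartCurve I γ x₀) J s := by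
  rw [← contMDiffWithinAt_iff_contDiffWithinAt]
  have h1 := contMDiffAt_extChartAt' (I := I) (n := n) (x := x₀) (x' := γ s)
    (by rwa [extChartAt_source] at hs)
  exact h1.comp_contMDiffWithinAt s h

theorem eventually_mem_source {X : Type*} [TopologicalSpace X] {γ : X → M} {J : Set X} {x₀ : M}
    {s : X} (h : ContinuousWithinAt γ J s) (hs : γ s ∈ (extChartAt I x₀).source) :
    ∀ᶠ s' in 𝓝[J] s, γ s' ∈ (extChartAt I x₀).source :=
  h.eventually ((isOpen_extChartAt_source x₀).mem_nhds hs)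

theorem mdifferentiableAt_extChartAt_symm [I.Boundaryless] [IsManifold I 1 M] {x₀ : M} {z : E}
    (hz : z ∈ (extChartAt I x₀).target) :
    MDifferentiableAt 𝓘(ℝ, E) I (extChartAt I x₀).symm z := by
  have := (contMDiffOn_extChartAt_symm (I := I) (n := 1) x₀ z hz).contMDiffAt
    ((isOpen_extChartAt_target x₀).mem_nhds hz)
  exact this.mdifferentiableAt one_ne_zero

variable (I) in
/-- The derivative of the inverse of the chart around `x₀`. -/
def symmDeriv (x₀ : M) (z : E) : E →L[ℝ] E :=
  mfderiv 𝓘(ℝ, E) I (extChartAt I x₀).symm z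

/-- The velocity of a curve in terms of its coordinate velocity. -/
theorem velocity_eq [I.Boundaryless] [IsManifold I 1 M] {γ : ℝ → M} {J : Set ℝ} {x₀ : M} {s : ℝ}
    (hJ : UniqueDiffWithinAt ℝ J s) (hsJ : s ∈ J)
    (h : MDifferentiableWithinAt 𝓘(ℝ, ℝ) I γ J s)
    (hs : γ s ∈ (extChartAt I x₀).source) :
    velocity I γ J s = symmDeriv I x₀ (chartCurve I γ x₀ s)
      (derivWithin (chartCurve I γ x₀) J s) := by
  have hz : chartCurve I γ x₀ s ∈ (extChartAt I x₀).target := (extChartAt I x₀).map_source hs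
  have h1 : MDifferentiableWithinAt 𝓘(ℝ, ℝ) 𝓘(ℝ, E) (chartCurve I γ x₀) J s :=
    (mdifferentiableAt_extChartAt (by rwa [extChartAt_source] at hs)).comp_mdifferentiableWithinAt
      s h
  have h2 := mdifferentiableAt_extChartAt_symm (I := I) hz
  have h3 : γ =ᶠ[𝓝[J] s] (extChartAt I x₀).symm ∘ chartCurve I γ x₀ := by
    filter_upwards [eventually_mem_source h.continuousWithinAt hs] with s' hs'
    exact ((extChartAt I x₀).left_inv hs').symm
  have h4 := (h2.hasMFDerivAt.comp_hasMFDerivWithinAt s h1.hasMFDerivWithinAt).congr_of_eventuallyEq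
    h3 (h3.self_of_nhdsWithin hsJ)
  have h5 := h4.mfderivWithin hJ.uniqueMDiffWithinAt
  unfold velocity
  rw [h5, mfderivWithin_eq_fderivWithin]
  rfl

end Curves

/-! ### The classical system in charts -/

variable {d : ℕ} {S : Type*} [TopologicalSpace S]
  [ChartedSpace (EuclideanSpace ℝ (Fin d)) S] [IsManifold (𝓡 d) 2 S]

/-- The field is the tangent map of the C² inverse chart applied to the constant section z ↦ (z, u).
One derivative is lost, so C¹ is the best available regularity for tensors in charts of S. -/
theorem contMDiffOn_symmDeriv (x₀ : S) (u : EuclideanSpace ℝ (Fin d)) :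
    ContMDiffOn 𝓘(ℝ, EuclideanSpace ℝ (Fin d)) ((𝓡 d).prod 𝓘(ℝ, EuclideanSpace ℝ (Fin d))) 1
      (fun z => Bundle.TotalSpace.mk' (EuclideanSpace ℝ (Fin d))
        (E := fun q : S => TangentSpace (𝓡 d) q)
        ((extChartAt (𝓡 d) x₀).symm z) (symmDeriv (𝓡 d) x₀ z u)) (extChartAt (𝓡 d) x₀).target := by
  have h := (contMDiffOn_extChartAt_symm (I := 𝓡 d) (n := 2) x₀).contMDiffOn_tangentMapWithin
    (m := 1) (by norm_num) (isOpen_extChartAt_target x₀).uniqueMDiffOn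
  have h2 : ContMDiff 𝓘(ℝ, EuclideanSpace ℝ (Fin d)) 𝓘(ℝ, EuclideanSpace ℝ (Fin d)).tangent 1
      (fun z : EuclideanSpace ℝ (Fin d) => (⟨z, u⟩ : TangentBundle 𝓘(ℝ, EuclideanSpace ℝ (Fin d)) (EuclideanSpace ℝ (Fin d)))) := by
    exact contMDiff_vectorSpace_iff_contDiff.2 contDiff_const
  refine (h.comp h2.contMDiffOn (fun z hz => hz)).congr fun z hz => ?_
  simp only [Function.comp, tangentMapWithin]
  rw [mfderivWithin_of_isOpen (isOpen_extChartAt_target x₀) hz]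
  rfl

namespace ClassicalSystem

variable {T : Set ℝ} (sys : ClassicalSystem d S T)

/-- The metric `a` in the chart around `x₀`. -/
def locA (x₀ : S) (p : ℝ × EuclideanSpace ℝ (Fin d)) :
    EuclideanSpace ℝ (Fin d) →L[ℝ] EuclideanSpace ℝ (Fin d) →L[ℝ] ℝ :=
  let a : EuclideanSpace ℝ (Fin d) →L[ℝ] EuclideanSpace ℝ (Fin d) →L[ℝ] ℝ :=
    sys.a p.1 ((extChartAt (𝓡 d) x₀).symm p.2)
  a.bilinearComp (symmDeriv (𝓡 d) x₀ p.2) (symmDeriv (𝓡 d) x₀ p.2)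

/-- The 1-form `b` in the chart around `x₀`. -/
def locB (x₀ : S) (p : ℝ × EuclideanSpace ℝ (Fin d)) : EuclideanSpace ℝ (Fin d) →L[ℝ] ℝ :=
  let b : EuclideanSpace ℝ (Fin d) →L[ℝ] ℝ := sys.b p.1 ((extChartAt (𝓡 d) x₀).symm p.2)
  b.comp (symmDeriv (𝓡 d) x₀ p.2)

end ClassicalSystem

/-- A function of `(t, q)` in the chart around `x₀`. -/
def locF (f : ℝ → S → ℝ) (x₀ : S) (p : ℝ × EuclideanSpace ℝ (Fin d)) : ℝ :=
  f p.1 ((extChartAt (𝓡 d) x₀).symm p.2)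

theorem contMDiffOn_prod_symm (T : Set ℝ) (x₀ : S) :
    ContMDiffOn 𝓘(ℝ, ℝ × EuclideanSpace ℝ (Fin d)) (𝓘(ℝ, ℝ).prod (𝓡 d)) 1
      (fun p : ℝ × EuclideanSpace ℝ (Fin d) => (p.1, (extChartAt (𝓡 d) x₀).symm p.2))
      (T ×ˢ (extChartAt (𝓡 d) x₀).target) := by
  refine ContMDiffOn.prodMk contDiff_fst.contMDiff.contMDiffOn ?_
  have : IsManifold (𝓡 d) 1 S := .of_le (n := 2) (by norm_num)
  exact (contMDiffOn_extChartAt_symm x₀).comp contDiff_snd.contMDiff.contMDiffOn (fun p hp => hp.2)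

theorem contDiffOn_locF {T : Set ℝ} {f : ℝ → S → ℝ}
    (hf : ContMDiffOn (𝓘(ℝ, ℝ).prod (𝓡 d)) 𝓘(ℝ, ℝ) 1 (fun p : ℝ × S => f p.1 p.2) (T ×ˢ univ))
    (x₀ : S) : ContDiffOn ℝ 1 (locF f x₀) (T ×ˢ (extChartAt (𝓡 d) x₀).target) := by
  rw [← contMDiffOn_iff_contDiffOn]
  exact hf.comp (contMDiffOn_prod_symm T x₀) (fun p hp => ⟨hp.1, mem_univ _⟩)

namespace ClassicalSystem

variable {T : Set ℝ} (sys : ClassicalSystem d S T)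

/-- In finite dimension it suffices to evaluate on fixed vectors u. Pairing the C¹ section b with
the C¹ field `symmDeriv` u gives a C¹ section of a trivial bundle, that is, a C¹ function. -/
theorem contDiffOn_locB (x₀ : S) :
    ContDiffOn ℝ 1 (sys.locB x₀) (T ×ˢ (extChartAt (𝓡 d) x₀).target) := by
  rw [contDiffOn_clm_apply]
  intro u
  have h1 := sys.contMDiffOn_b.comp (contMDiffOn_prod_symm T x₀) (fun p hp => ⟨hp.1, mem_univ _⟩)
  have h2 := (contMDiffOn_symmDeriv x₀ u).comp
    (contDiff_snd (𝕜 := ℝ) (E := ℝ) (F := EuclideanSpace ℝ (Fin d)) (n := 1)).contMDiff.contMDiffOn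
    (s := T ×ˢ (extChartAt (𝓡 d) x₀).target) (fun p hp => hp.2)
  have h3 := ContMDiffOn.clm_bundle_apply (F₁ := EuclideanSpace ℝ (Fin d)) (F₂ := ℝ)
    (E₁ := fun q : S => TangentSpace (𝓡 d) q) (E₂ := Bundle.Trivial S ℝ)
    (b := fun p : ℝ × EuclideanSpace ℝ (Fin d) => (extChartAt (𝓡 d) x₀).symm p.2)
    (ϕ := fun p => sys.b p.1 ((extChartAt (𝓡 d) x₀).symm p.2))
    (v := fun p => symmDeriv (𝓡 d) x₀ p.2 u) h1 h2
  rw [← contMDiffOn_iff_contDiffOn]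
  intro p hp
  have h4 := h3 p hp
  rw [Bundle.contMDiffWithinAt_totalSpace] at h4
  exact h4.2

theorem contDiffOn_locA (x₀ : S) :
    ContDiffOn ℝ 1 (sys.locA x₀) (T ×ˢ (extChartAt (𝓡 d) x₀).target) := by
  rw [contDiffOn_clm_apply]
  intro u
  rw [contDiffOn_clm_apply]
  intro v
  have h1 := sys.contMDiffOn_a.comp (contMDiffOn_prod_symm T x₀) (fun p hp => ⟨hp.1, mem_univ _⟩)
  have h2 (u) := (contMDiffOn_symmDeriv x₀ u).comp
    (contDiff_snd (𝕜 := ℝ) (E := ℝ) (F := EuclideanSpace ℝ (Fin d)) (n := 1)).contMDiff.contMDiffOn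
    (s := T ×ˢ (extChartAt (𝓡 d) x₀).target) (fun p hp => hp.2)
  have h3 := ContMDiffOn.clm_bundle_apply₂ (F₁ := EuclideanSpace ℝ (Fin d))
    (F₂ := EuclideanSpace ℝ (Fin d)) (F₃ := ℝ)
    (E₁ := fun q : S => TangentSpace (𝓡 d) q) (E₂ := fun q : S => TangentSpace (𝓡 d) q)
    (E₃ := Bundle.Trivial S ℝ)
    (b := fun p : ℝ × EuclideanSpace ℝ (Fin d) => (extChartAt (𝓡 d) x₀).symm p.2)
    (ψ := fun p => sys.a p.1 ((extChartAt (𝓡 d) x₀).symm p.2))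
    (v := fun p => symmDeriv (𝓡 d) x₀ p.2 u) (w := fun p => symmDeriv (𝓡 d) x₀ p.2 v)
    h1 (h2 u) (h2 v)
  rw [← contMDiffOn_iff_contDiffOn]
  intro p hp
  have h4 := h3 p hp
  rw [Bundle.contMDiffWithinAt_totalSpace] at h4
  exact h4.2

theorem locA_chart (t : ℝ) {x₀ q : S} (hq : q ∈ (extChartAt (𝓡 d) x₀).source)
    (u v : EuclideanSpace ℝ (Fin d)) :
    sys.locA x₀ (t, extChartAt (𝓡 d) x₀ q) u v =
      sys.a t q (symmDeriv (𝓡 d) x₀ (extChartAt (𝓡 d) x₀ q) u)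
        (symmDeriv (𝓡 d) x₀ (extChartAt (𝓡 d) x₀ q) v) := by
  -- The type of `sys.a t q` depends on q, so the base point cannot simply be rewritten. All tangent
  -- spaces are the same model space, and the equality is transported there.
  have key : ∀ q', q' = q → ∀ u v : EuclideanSpace ℝ (Fin d), sys.a t q' u v = sys.a t q u v := by
    rintro q' rfl u v; rfl
  exact key _ ((extChartAt (𝓡 d) x₀).left_inv hq) _ _

theorem locB_chart (t : ℝ) {x₀ q : S} (hq : q ∈ (extChartAt (𝓡 d) x₀).source)
    (u : EuclideanSpace ℝ (Fin d)) :
    sys.locB x₀ (t, extChartAt (𝓡 d) x₀ q) u =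
      sys.b t q (symmDeriv (𝓡 d) x₀ (extChartAt (𝓡 d) x₀ q) u) := by
  have key : ∀ q', q' = q → ∀ u : EuclideanSpace ℝ (Fin d), sys.b t q' u = sys.b t q u := by
    rintro q' rfl u; rfl
  exact key _ ((extChartAt (𝓡 d) x₀).left_inv hq) _

theorem lagrangian_eq {γ : ℝ → S} {J : Set ℝ} {x₀ : S} {s : ℝ} (t : ℝ)
    (hJ : UniqueDiffWithinAt ℝ J s) (hsJ : s ∈ J)
    (h : MDifferentiableWithinAt 𝓘(ℝ, ℝ) (𝓡 d) γ J s)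
    (hs : γ s ∈ (extChartAt (𝓡 d) x₀).source) :
    sys.lagrangian t (γ s) (velocity (𝓡 d) γ J s) =
      (1 / 2) * sys.locA x₀ (t, chartCurve (𝓡 d) γ x₀ s) (derivWithin (chartCurve (𝓡 d) γ x₀) J s)
        (derivWithin (chartCurve (𝓡 d) γ x₀) J s)
      + sys.locB x₀ (t, chartCurve (𝓡 d) γ x₀ s) (derivWithin (chartCurve (𝓡 d) γ x₀) J s)
      - locF sys.U x₀ (t, chartCurve (𝓡 d) γ x₀ s) := by
  have : IsManifold (𝓡 d) 1 S := .of_le (n := 2) (by norm_num)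
  rw [velocity_eq hJ hsJ h hs]
  simp only [chartCurve, locF, (extChartAt (𝓡 d) x₀).left_inv hs, sys.locA_chart t hs,
    sys.locB_chart t hs]
  rfl

end ClassicalSystem

end Eisenhart

end

noncomputable section

namespace Eisenhart

/-! ### Euler-Lagrange and geodesic equations in a coordinate domain -/

section Coordinates

variable {d : ℕ}
  (A : ℝ × EuclideanSpace ℝ (Fin d) →
    EuclideanSpace ℝ (Fin d) →L[ℝ] EuclideanSpace ℝ (Fin d) →L[ℝ] ℝ)
  (B : ℝ × EuclideanSpace ℝ (Fin d) → EuclideanSpace ℝ (Fin d) →L[ℝ] ℝ)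
  (U P : ℝ × EuclideanSpace ℝ (Fin d) → ℝ) (m : ℝ)

/-- The time derivative of the momentum `A v + B` along a curve through `p` with velocity `v` and
acceleration `a`. -/
def momentumDeriv (p : ℝ × EuclideanSpace ℝ (Fin d)) (v a : EuclideanSpace ℝ (Fin d)) :
    EuclideanSpace ℝ (Fin d) →L[ℝ] ℝ :=
  fderiv ℝ A p (1, v) v + A p a + fderiv ℝ B p (1, v)

/-- The derivative of the Lagrangian `½ A v v + B v - U` with respect to the position. -/
def lagrangianForce (p : ℝ × EuclideanSpace ℝ (Fin d)) (v w : EuclideanSpace ℝ (Fin d)) : ℝ :=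
  (1 / 2) * fderiv ℝ A p (0, w) v v + fderiv ℝ B p (0, w) v - fderiv ℝ U p (0, w)

/-- The Euler-Lagrange expression of the Lagrangian `½ A v v + B v - U`. -/
def elExpr (p : ℝ × EuclideanSpace ℝ (Fin d)) (v a w : EuclideanSpace ℝ (Fin d)) : ℝ :=
  momentumDeriv A B p v a w - lagrangianForce A B U p v w

/-- The projection `(t, z, y) ↦ (t, z)`. -/
def projTZ (d : ℕ) : modelE d →L[ℝ] ℝ × EuclideanSpace ℝ (Fin d) := (dt d).prod (dq d)

/-- The Eisenhart form
`P [a - dt ⊗ (dy - b) - (dy - b) ⊗ dt - (2U - P m²) dt ⊗ dt]` on `ℝ × ℝᵈ × ℝ`. -/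
def eisenhartForm (a : EuclideanSpace ℝ (Fin d) →L[ℝ] EuclideanSpace ℝ (Fin d) →L[ℝ] ℝ)
    (b : EuclideanSpace ℝ (Fin d) →L[ℝ] ℝ) (U P m : ℝ) : modelE d →L[ℝ] modelE d →L[ℝ] ℝ :=
  let β : modelE d →L[ℝ] ℝ := dy d - b.comp (dq d)
  P • (a.bilinearComp (dq d) (dq d) - tensor (dt d) β - tensor β (dt d)
      - (2 * U - P * m ^ 2) • tensor (dt d) (dt d))

theorem eisenhartForm_apply
    (a : EuclideanSpace ℝ (Fin d) →L[ℝ] EuclideanSpace ℝ (Fin d) →L[ℝ] ℝ)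
    (b : EuclideanSpace ℝ (Fin d) →L[ℝ] ℝ) (U P m : ℝ) (u w : modelE d) :
    eisenhartForm a b U P m u w = P * (a u.2.1 w.2.1
      - u.1 * (w.2.2 - b w.2.1) - (u.2.2 - b u.2.1) * w.1
      - (2 * U - P * m ^ 2) * (u.1 * w.1)) := by
  simp [eisenhartForm, tensor, dt, dq, dy]

theorem isLorentzian_eisenhartForm
    {a : EuclideanSpace ℝ (Fin d) →L[ℝ] EuclideanSpace ℝ (Fin d) →L[ℝ] ℝ}
    (ha : ∀ v w, a v w = a w v) (hpos : ∀ v, v ≠ 0 → 0 < a v v)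
    (b : EuclideanSpace ℝ (Fin d) →L[ℝ] ℝ) (U : ℝ) {P : ℝ} (hP : 0 < P) (m : ℝ) :
    IsLorentzian (eisenhartForm a b U P m) := by
  -- With D = 2U - P m², the vector (1, 0, c) has square -P(2c + D), and on its orthogonal
  -- complement the form is P (a(w, w) + (2c + D) w_t²). The choice 2c + D = 1 makes the first equal
  -- to -P and the second positive.
  set c : ℝ := (1 - (2 * U - P * m ^ 2)) / 2 with hc
  refine ⟨fun v w => ?_, (1, 0, c), ?_, fun w hw hw0 => ?_⟩
  · rw [eisenhartForm_apply, eisenhartForm_apply, ha v.2.1 w.2.1]; ring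
  · rw [eisenhartForm_apply]
    simp only [map_zero]
    have : P * (0 - 1 * (c - 0) - (c - 0) * 1 - (2 * U - P * m ^ 2) * (1 * 1)) = -P := by
      rw [hc]; ring
    rw [this]; linarith
  · rw [eisenhartForm_apply] at hw ⊢
    have h1 := (mul_eq_zero.1 hw).resolve_left hP.ne'
    simp only [map_zero, zero_apply] at h1
    have h2 : w.2.2 - b w.2.1 = -(c + (2 * U - P * m ^ 2)) * w.1 := by linarith
    rw [h2]
    have h3 : a w.2.1 w.2.1 - w.1 * (-(c + (2 * U - P * m ^ 2)) * w.1)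
        - -(c + (2 * U - P * m ^ 2)) * w.1 * w.1 - (2 * U - P * m ^ 2) * (w.1 * w.1) =
        a w.2.1 w.2.1 + w.1 ^ 2 := by
      rw [hc]; ring
    rw [h3]
    refine mul_pos hP ?_
    by_cases hw2 : w.2.1 = 0
    · have hw1 : w.1 ≠ 0 := by
        intro hw1
        rw [hw2, hw1, map_zero, mul_zero, sub_zero] at h2
        exact hw0 (Prod.ext hw1 (Prod.ext hw2 h2))
      rw [hw2, map_zero, zero_add]
      positivity
    · have := hpos _ hw2
      positivity

/-- The Eisenhart metric in coordinates. -/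
def coordMetric (z : modelE d) : modelE d →L[ℝ] modelE d →L[ℝ] ℝ :=
  eisenhartForm (A (projTZ d z)) (B (projTZ d z)) (U (projTZ d z)) (P (projTZ d z)) m

theorem coordMetric_apply (z u w : modelE d) :
    coordMetric A B U P m z u w = P (z.1, z.2.1) * (A (z.1, z.2.1) u.2.1 w.2.1
      - u.1 * (w.2.2 - B (z.1, z.2.1) w.2.1) - (u.2.2 - B (z.1, z.2.1) u.2.1) * w.1
      - (2 * U (z.1, z.2.1) - P (z.1, z.2.1) * m ^ 2) * (u.1 * w.1)) :=
  eisenhartForm_apply ..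

variable {A B U P} {Ω : Set (ℝ × EuclideanSpace ℝ (Fin d))}

theorem contDiffOn_coordMetric (hA : ContDiffOn ℝ 1 A Ω) (hB : ContDiffOn ℝ 1 B Ω)
    (hU : ContDiffOn ℝ 1 U Ω) (hP : ContDiffOn ℝ 1 P Ω) :
    ContDiffOn ℝ 1 (coordMetric A B U P m) (projTZ d ⁻¹' Ω) := by
  have h0 : ContDiffOn ℝ 1 (projTZ d) (projTZ d ⁻¹' Ω) := (projTZ d).contDiff.contDiffOn
  have hm : MapsTo (projTZ d) (projTZ d ⁻¹' Ω) Ω := fun z hz => hz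
  have hA' := hA.comp h0 hm
  have hB' := hB.comp h0 hm
  have hU' := hU.comp h0 hm
  have hP' := hP.comp h0 hm
  rw [contDiffOn_clm_apply]
  intro u
  rw [contDiffOn_clm_apply]
  intro w
  simp only [coordMetric_apply]
  have hAu : ContDiffOn ℝ 1 (fun z : modelE d => A (z.1, z.2.1) u.2.1 w.2.1) (projTZ d ⁻¹' Ω) :=
    (hA'.clm_apply contDiffOn_const).clm_apply contDiffOn_const
  have hBu (u : modelE d) :
      ContDiffOn ℝ 1 (fun z : modelE d => B (z.1, z.2.1) u.2.1) (projTZ d ⁻¹' Ω) :=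
    hB'.clm_apply contDiffOn_const
  have hU2 : ContDiffOn ℝ 1 (fun z : modelE d => U (z.1, z.2.1)) (projTZ d ⁻¹' Ω) := hU'
  have hP2 : ContDiffOn ℝ 1 (fun z : modelE d => P (z.1, z.2.1)) (projTZ d ⁻¹' Ω) := hP'
  have hBu1 := hBu u
  have hBu2 := hBu w
  exact hP2.mul (((hAu.sub (contDiffOn_const.mul (contDiffOn_const.sub hBu2))).sub
    ((contDiffOn_const.sub hBu1).mul contDiffOn_const)).sub
    (((contDiffOn_const.mul hU2).sub (hP2.mul contDiffOn_const)).mul contDiffOn_const))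

/-- Product rule, carried out on scalar functions of r along a line to avoid derivatives of
operator-valued expressions. The component of δ along y is absent from the result: ∂/∂y is a Killing
field. -/
theorem fderiv_coordMetric (hΩ : IsOpen Ω) (hA : ContDiffOn ℝ 1 A Ω) (hB : ContDiffOn ℝ 1 B Ω)
    (hU : ContDiffOn ℝ 1 U Ω) (hP : ContDiffOn ℝ 1 P Ω) {z : modelE d} (hz : (z.1, z.2.1) ∈ Ω)
    (δ u w : modelE d) :
    fderiv ℝ (coordMetric A B U P m) z δ u w =
      fderiv ℝ P (z.1, z.2.1) (δ.1, δ.2.1) * (A (z.1, z.2.1) u.2.1 w.2.1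
      - u.1 * (w.2.2 - B (z.1, z.2.1) w.2.1) - (u.2.2 - B (z.1, z.2.1) u.2.1) * w.1
      - (2 * U (z.1, z.2.1) - P (z.1, z.2.1) * m ^ 2) * (u.1 * w.1))
      + P (z.1, z.2.1) * (fderiv ℝ A (z.1, z.2.1) (δ.1, δ.2.1) u.2.1 w.2.1
      + u.1 * fderiv ℝ B (z.1, z.2.1) (δ.1, δ.2.1) w.2.1
      + fderiv ℝ B (z.1, z.2.1) (δ.1, δ.2.1) u.2.1 * w.1
      - (2 * fderiv ℝ U (z.1, z.2.1) (δ.1, δ.2.1)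
        - fderiv ℝ P (z.1, z.2.1) (δ.1, δ.2.1) * m ^ 2) * (u.1 * w.1)) := by
  have hn := hΩ.mem_nhds hz
  have hn' : projTZ d ⁻¹' Ω ∈ 𝓝 z := (hΩ.preimage (projTZ d).continuous).mem_nhds hz
  have hG := ((contDiffOn_coordMetric m hA hB hU hP).contDiffAt hn').differentiableAt one_ne_zero
  -- differentiate along the line through `z` in the direction `δ`
  have hl : HasDerivAt (fun r : ℝ => z + r • δ) δ 0 := by
    simpa using ((hasDerivAt_id (0 : ℝ)).smul_const δ).const_add z
  have hl' : HasDerivAt (fun r : ℝ => ((z + r • δ).1, (z + r • δ).2.1)) (δ.1, δ.2.1) 0 :=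
    (projTZ d).hasFDerivAt.comp_hasDerivAt (0 : ℝ) hl
  have e0 : z + (0 : ℝ) • δ = z := by simp
  have h1 : HasDerivAt (fun r : ℝ => coordMetric A B U P m (z + r • δ) u w)
      (fderiv ℝ (coordMetric A B U P m) z δ u w) 0 := by
    have := HasFDerivAt.comp_hasDerivAt (0 : ℝ) (l := coordMetric A B U P m)
      (f := fun r : ℝ => z + r • δ) (by rw [e0]; exact hG.hasFDerivAt) hl
    simpa using (this.clm_apply (hasDerivAt_const 0 u)).clm_apply (hasDerivAt_const 0 w)
  have aux {F : Type} [NormedAddCommGroup F] [NormedSpace ℝ F]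
      {f : ℝ × EuclideanSpace ℝ (Fin d) → F} (hf : ContDiffOn ℝ 1 f Ω) :
      HasDerivAt (fun r : ℝ => f ((z + r • δ).1, (z + r • δ).2.1))
        (fderiv ℝ f (z.1, z.2.1) (δ.1, δ.2.1)) 0 := by
    have hd := ((hf.contDiffAt hn).differentiableAt one_ne_zero).hasFDerivAt
    exact HasFDerivAt.comp_hasDerivAt (0 : ℝ) (l := f)
      (f := fun r : ℝ => ((z + r • δ).1, (z + r • δ).2.1)) (by rw [e0]; exact hd) hl'
  have hA1 := ((aux hA).clm_apply (hasDerivAt_const 0 u.2.1)).clm_apply (hasDerivAt_const 0 w.2.1)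
  have hB1 (u : modelE d) := (aux hB).clm_apply (hasDerivAt_const 0 u.2.1)
  have h2 := (aux hP).mul ((((hA1.sub (((hB1 w).const_sub w.2.2).const_mul u.1)).sub
    (((hB1 u).const_sub u.2.2).mul_const w.1))).sub
    ((((aux hU).const_mul 2).sub ((aux hP).mul_const (m ^ 2))).mul_const (u.1 * w.1)))
  simp only [coordMetric_apply] at h1
  have h3 := h1.unique h2
  rw [h3]
  simp

/-- The derivative of the momentum along a curve. -/
theorem hasDerivWithinAt_momentum (hΩ : IsOpen Ω) (hA : ContDiffOn ℝ 1 A Ω)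
    (hB : ContDiffOn ℝ 1 B Ω) {c v : ℝ → EuclideanSpace ℝ (Fin d)} {a : EuclideanSpace ℝ (Fin d)}
    {J : Set ℝ} {t : ℝ} (hc : HasDerivWithinAt c (v t) J t) (hv : HasDerivWithinAt v a J t)
    (ht : (t, c t) ∈ Ω) :
    HasDerivWithinAt (fun s => A (s, c s) (v s) + B (s, c s))
      (momentumDeriv A B (t, c t) (v t) a) J t := by
  have hn := hΩ.mem_nhds ht
  have hl : HasDerivWithinAt (fun s => (s, c s)) (1, v t) J t := (hasDerivWithinAt_id t J).prodMk hc
  have hA1 := ((hA.contDiffAt hn).differentiableAt one_ne_zero).hasFDerivAt.comp_hasDerivWithinAt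
    t hl
  have hB1 := ((hB.contDiffAt hn).differentiableAt one_ne_zero).hasFDerivAt.comp_hasDerivWithinAt
    t hl
  exact (hA1.clm_apply hv).add hB1

/-- The derivative of the energy `½ A v v + U` along a curve. -/
theorem hasDerivWithinAt_energy (hΩ : IsOpen Ω) (hA : ContDiffOn ℝ 1 A Ω)
    (hU : ContDiffOn ℝ 1 U Ω) (hsymm : ∀ p ∈ Ω, ∀ u w, A p u w = A p w u)
    {c v : ℝ → EuclideanSpace ℝ (Fin d)} {a : EuclideanSpace ℝ (Fin d)}
    {J : Set ℝ} {t : ℝ} (hc : HasDerivWithinAt c (v t) J t) (hv : HasDerivWithinAt v a J t)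
    (ht : (t, c t) ∈ Ω) :
    HasDerivWithinAt (fun s => (1 / 2) * A (s, c s) (v s) (v s) + U (s, c s))
      (elExpr A B U (t, c t) (v t) a (v t) - ((1 / 2) * fderiv ℝ A (t, c t) (1, 0) (v t) (v t)
        + fderiv ℝ B (t, c t) (1, 0) (v t) - fderiv ℝ U (t, c t) (1, 0))) J t := by
  have hn := hΩ.mem_nhds ht
  have hl : HasDerivWithinAt (fun s => (s, c s)) (1, v t) J t := (hasDerivWithinAt_id t J).prodMk hc
  have hA1 := ((hA.contDiffAt hn).differentiableAt one_ne_zero).hasFDerivAt.comp_hasDerivWithinAt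
    t hl
  have hU1 := ((hU.contDiffAt hn).differentiableAt one_ne_zero).hasFDerivAt.comp_hasDerivWithinAt
    t hl
  have h := (((hA1.clm_apply hv).clm_apply hv).const_mul (1 / 2)).add hU1
  refine h.congr_deriv ?_
  -- Separates the explicit time dependence from transport along the curve, giving dE/dt = EL(v) -
  -- ∂_t L. The terms in B cancel: magnetic forces do no work.
  have hs : ((1, v t) : ℝ × EuclideanSpace ℝ (Fin d)) = (1, 0) + (0, v t) := by simp
  simp only [elExpr, momentumDeriv, lagrangianForce, hs, map_add, add_apply,
    Function.comp, hsymm _ ht (v t) a]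
  ring

/-- Identifies the acceleration term together with ∂_v g(v, w) as the derivative of g(x', w) for
constant w, so the acceleration of a lift need not be computed. -/
theorem hasDerivWithinAt_coordMetric (hΩ : IsOpen Ω) (hA : ContDiffOn ℝ 1 A Ω)
    (hB : ContDiffOn ℝ 1 B Ω) (hU : ContDiffOn ℝ 1 U Ω) (hP : ContDiffOn ℝ 1 P Ω)
    {x v : ℝ → modelE d} {a : modelE d} {J : Set ℝ} {s : ℝ}
    (hx : HasDerivWithinAt x (v s) J s) (hv : HasDerivWithinAt v a J s)
    (hxs : ((x s).1, (x s).2.1) ∈ Ω) (w : modelE d) :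
    HasDerivWithinAt (fun s' => coordMetric A B U P m (x s') (v s') w)
      (coordMetric A B U P m (x s) a w + fderiv ℝ (coordMetric A B U P m) (x s) (v s) (v s) w)
      J s := by
  have hn' : projTZ d ⁻¹' Ω ∈ 𝓝 (x s) := (hΩ.preimage (projTZ d).continuous).mem_nhds hxs
  have hG := ((contDiffOn_coordMetric m hA hB hU hP).contDiffAt hn').differentiableAt one_ne_zero
  have := ((hG.hasFDerivAt.comp_hasDerivWithinAt s hx).clm_apply hv).clm_apply
    (hasDerivWithinAt_const s J w)
  refine this.congr_deriv ?_
  simp [add_comm]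

/-- The geodesic expression of the Eisenhart metric along a lifted curve is, up to a factor, the
Euler-Lagrange expression of the curve. -/
theorem geodesicExpr_eq (hΩ : IsOpen Ω) (hA : ContDiffOn ℝ 1 A Ω) (hB : ContDiffOn ℝ 1 B Ω)
    (hU : ContDiffOn ℝ 1 U Ω) (hP : ContDiffOn ℝ 1 P Ω)
    (hsymm : ∀ p ∈ Ω, ∀ u w, A p u w = A p w u) (hPpos : ∀ p ∈ Ω, P p ≠ 0)
    {x v : ℝ → modelE d} {a : modelE d} {J J' : Set ℝ} {s : ℝ} (hsJ : s ∈ J)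
    (hJ : UniqueDiffWithinAt ℝ J s)
    (hx : HasDerivWithinAt x (v s) J s) (hv : HasDerivWithinAt v a J s)
    {c c' : ℝ → EuclideanSpace ℝ (Fin d)} {c'' : EuclideanSpace ℝ (Fin d)} {k : ℝ}
    (hJJ' : MapsTo (fun s => (x s).1) J J')
    (hc : HasDerivWithinAt c (c' (x s).1) J' (x s).1)
    (hc' : HasDerivWithinAt c' c'' J' (x s).1)
    (hxc : ∀ᶠ s' in 𝓝[J] s, (x s').2.1 = c (x s').1 ∧ ((x s').1, (x s').2.1) ∈ Ω ∧
      v s' = (k / P ((x s').1, (x s').2.1)) • ((1, c' (x s').1,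
        (1 / 2) * A ((x s').1, (x s').2.1) (c' (x s').1) (c' (x s').1)
          + B ((x s').1, (x s').2.1) (c' (x s').1)
          + (P ((x s').1, (x s').2.1) * m ^ 2 - U ((x s').1, (x s').2.1))) : modelE d))
    (w : modelE d) :
    coordMetric A B U P m (x s) a w + fderiv ℝ (coordMetric A B U P m) (x s) (v s) (v s) w
      - (1 / 2) * fderiv ℝ (coordMetric A B U P m) (x s) w (v s) (v s) =
    k ^ 2 / P ((x s).1, (x s).2.1) *
      elExpr A B U ((x s).1, (x s).2.1) (c' (x s).1) c'' (w.2.1 - w.1 • c' (x s).1) := by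
  obtain ⟨h1, h2, h3⟩ := hxc.self_of_nhdsWithin hsJ
  have hP0 := hPpos _ h2
  have hd1 := hasDerivWithinAt_coordMetric m hΩ hA hB hU hP hx hv h2 w
  have hθ : HasDerivWithinAt (fun s' => (x s').1) (k / P ((x s).1, (x s).2.1)) J s := by
    have := (ContinuousLinearMap.fst ℝ ℝ
      (EuclideanSpace ℝ (Fin d) × ℝ)).hasFDerivAt.comp_hasDerivWithinAt s hx
    refine this.congr_deriv ?_
    rw [h3]; simp
  have ht : ((x s).1, c (x s).1) ∈ Ω := by rw [← h1]; exact h2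
  -- Momentum and energy are functions of t; composing with s ↦ t(s) multiplies their derivatives by
  -- k / P.
  have hp := (hasDerivWithinAt_momentum hΩ hA hB hc hc' ht).scomp s hθ hJJ'
  have hE := (hasDerivWithinAt_energy (B := B) hΩ hA hU hsymm hc hc' ht).scomp s hθ hJJ'
  -- Along the lift g(x', w) = k (p(w_q) - w_y - E w_t): the k / P in the velocity absorbs the
  -- conformal factor, and the term P m² in the rate cancels the one in the metric.
  have hd2 := (((hp.clm_apply (hasDerivWithinAt_const s J w.2.1)).sub_const w.2.2).sub
    (hE.mul_const w.1)).const_mul k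
  have hd3 := hd2.congr_of_eventuallyEq (f₁ := fun s' => coordMetric A B U P m (x s') (v s') w) (by
    filter_upwards [hxc] with s' ⟨g1, g2, g3⟩
    have hP' := hPpos _ g2
    rw [g1] at g2 g3 hP'
    simp only [coordMetric_apply, Function.comp, Pi.sub_apply, g1]
    rw [g3]
    generalize ((x s').1, c (x s').1) = p at *
    simp
    field_simp
    ring) (by
    simp only [coordMetric_apply, Function.comp, Pi.sub_apply, h1]
    rw [h3, h1]
    rw [h1] at hP0
    generalize ((x s).1, c (x s).1) = p at *
    simp
    field_simp
    ring)
  -- Two expressions for the derivative of g(x', w) are equated. In the remaining term ∂_w g(v, v),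
  -- the derivative of P enters as -(k² / P) m² ∂_w P from the prefactor and with the opposite sign
  -- from the mass term.
  rw [hJ.eq_deriv _ hd1 hd3, fderiv_coordMetric m hΩ hA hB hU hP h2, h3, h1]
  rw [h1] at hP0
  have hs1 : ((w.1, w.2.1) : ℝ × EuclideanSpace ℝ (Fin d)) = w.1 • (1, 0) + (0, w.2.1) := by simp
  generalize ((x s).1, c (x s).1) = p at *
  generalize c' (x s).1 = v' at *
  have hs2 : ((0, w.2.1 - w.1 • v') : ℝ × EuclideanSpace ℝ (Fin d)) =
      (0, w.2.1) - w.1 • (0, v') := by simp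
  have hs3 : ((1, v') : ℝ × EuclideanSpace ℝ (Fin d)) = (1, 0) + (0, v') := by simp
  simp only [Prod.smul_mk, elExpr, momentumDeriv, lagrangianForce]
  simp only [hs1, hs2, hs3, map_add, map_smul, add_apply, smul_apply, smul_eq_mul,
    map_sub, sub_apply, map_zero]
  field_simp
  ring

end Coordinates

end Eisenhart

end

noncomputable section

namespace Eisenhart

/-! ### Calculus of the first variation -/

section Calculus

variable {F : Type*} [NormedAddCommGroup F] [NormedSpace ℝ F]

/-- Differentiation under the integral sign. -/
theorem hasDerivAt_integral_of_continuousOn {g g' : ℝ → ℝ → F} {ε a b : ℝ} (hε : 0 < ε)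
    (hab : a ≤ b) (hg : ∀ r ∈ Ioo (-ε) ε, ContinuousOn (g r) (Icc a b))
    (hd : ∀ r ∈ Ioo (-ε) ε, ∀ t ∈ Icc a b, HasDerivAt (fun r => g r t) (g' r t) r)
    (hg' : ContinuousOn (fun p : ℝ × ℝ => g' p.1 p.2) (Ioo (-ε) ε ×ˢ Icc a b)) :
    HasDerivAt (fun r => ∫ t in a..b, g r t) (∫ t in a..b, g' 0 t) 0 := by
  have hK : IsCompact (Icc (-(ε / 2)) (ε / 2) ×ˢ Icc a b) := isCompact_Icc.prod isCompact_Icc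
  have hsub : Icc (-(ε / 2)) (ε / 2) ⊆ Ioo (-ε) ε :=
    fun r hr => ⟨by linarith [hr.1], by linarith [hr.2]⟩
  -- Halving ε makes the parameter range compact, and a constant dominates the derivative.
  obtain ⟨C, hC⟩ := hK.exists_bound_of_continuousOn (hg'.mono (prod_mono_left hsub))
  have h0 : (0 : ℝ) ∈ Ioo (-ε) ε := ⟨by linarith, hε⟩
  have huI : uIoc a b = Ioc a b := uIoc_of_le hab
  have hcont : ContinuousOn (g' 0) (Icc a b) :=
    hg'.comp (f := fun t => ((0 : ℝ), t)) (by fun_prop) (fun t ht => ⟨h0, ht⟩)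
  have hs : Ioo (-(ε / 2)) (ε / 2) ∈ 𝓝 (0 : ℝ) := Ioo_mem_nhds (by linarith) (by linarith)
  refine (intervalIntegral.hasDerivAt_integral_of_dominated_loc_of_deriv_le (F := g) (F' := g')
    (bound := fun _ => C) hs ?_ ?_ ?_ ?_ ?_ ?_).2
  · filter_upwards [hs] with r hr
    rw [huI]
    exact ((hg r (hsub (Ioo_subset_Icc_self hr))).mono Ioc_subset_Icc_self).aestronglyMeasurable
      measurableSet_Ioc
  · exact (hg 0 h0).intervalIntegrable_of_Icc hab
  · rw [huI]
    exact (hcont.mono Ioc_subset_Icc_self).aestronglyMeasurable measurableSet_Ioc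
  · refine Filter.Eventually.of_forall fun t ht r hr => ?_
    rw [huI] at ht
    exact hC (r, t) ⟨Ioo_subset_Icc_self hr, Ioc_subset_Icc_self ht⟩
  · exact intervalIntegrable_const
  · refine Filter.Eventually.of_forall fun t ht r hr => ?_
    rw [huI] at ht
    exact hd r (hsub (Ioo_subset_Icc_self hr)) t (Ioc_subset_Icc_self ht)

/-- Interchange of the two partial derivatives, when `∂_r ∂_t f` exists and is continuous. -/
theorem hasDerivAt_deriv_swap [CompleteSpace F] {f V V' h : ℝ → ℝ → F} {ε a b : ℝ} (hε : 0 < ε)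
    (hf : ∀ r ∈ Ioo (-ε) ε, ∀ t ∈ Icc a b, HasDerivWithinAt (f r) (V r t) (Icc a b) t)
    (hV : ∀ r ∈ Ioo (-ε) ε, ContinuousOn (V r) (Icc a b))
    (hV' : ∀ r ∈ Ioo (-ε) ε, ∀ t ∈ Icc a b, HasDerivAt (fun r => V r t) (V' r t) r)
    (hV'c : ContinuousOn (fun p : ℝ × ℝ => V' p.1 p.2) (Ioo (-ε) ε ×ˢ Icc a b))
    (hh : ∀ t ∈ Icc a b, HasDerivAt (fun r => f r t) (h 0 t) 0) {t : ℝ} (ht : t ∈ Ioo a b) :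
    HasDerivAt (h 0) (V' 0 t) t := by
  have h0 : (0 : ℝ) ∈ Ioo (-ε) ε := ⟨by linarith, hε⟩
  have hc0 : ContinuousOn (V' 0) (Icc a b) :=
    hV'c.comp (f := fun t => ((0 : ℝ), t)) (by fun_prop) (fun t ht => ⟨h0, ht⟩)
  have hab : a ≤ b := ht.1.le.trans ht.2.le
  -- Symmetry of second derivatives is not available, since f need not be C². Instead f r t' - f r a
  -- = ∫ V r is differentiated under the integral sign, which exhibits h 0 as a primitive of the
  -- continuous function V' 0.
  have key : ∀ t' ∈ Icc a b, h 0 t' = h 0 a + ∫ s in a..t', V' 0 s := by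
    intro t' ht'
    have hsub : Icc a t' ⊆ Icc a b := Icc_subset_Icc_right ht'.2
    have h1 := hasDerivAt_integral_of_continuousOn hε ht'.1 (fun r hr => (hV r hr).mono hsub)
      (fun r hr s hs => hV' r hr s (hsub hs)) (hV'c.mono (prod_mono_right hsub))
    have h2 := (hh a (left_mem_Icc.2 hab)).add h1
    refine (hh t' ht').unique (h2.congr_of_eventuallyEq ?_)
    filter_upwards [Ioo_mem_nhds h0.1 h0.2] with r hr
    have := intervalIntegral.integral_eq_sub_of_hasDeriv_right_of_le ht'.1
      (f := f r) (f' := V r) (fun s hs => ((hf r hr s (hsub hs)).continuousWithinAt).mono hsub)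
      (fun s hs => ((hf r hr s (hsub (Ioo_subset_Icc_self hs))).hasDerivAt
        (Icc_mem_nhds hs.1 (hs.2.trans_le ht'.2))).hasDerivWithinAt)
      (((hV r hr).mono hsub).intervalIntegrable_of_Icc ht'.1)
    simp [this]
  have hcont : ContinuousAt (V' 0) t := hc0.continuousAt (Icc_mem_nhds ht.1 ht.2)
  have h3 := intervalIntegral.integral_hasDerivAt_right
    ((hc0.mono (Icc_subset_Icc_right ht.2.le)).intervalIntegrable_of_Icc ht.1.le)
    (hc0.stronglyMeasurableAtFilter_nhdsWithin measurableSet_Icc t |>.filter_mono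
      (by rw [nhdsWithin_eq_nhds.2 (Icc_mem_nhds ht.1 ht.2)])) hcont
  refine (h3.const_add (h 0 a)).congr_of_eventuallyEq ?_
  filter_upwards [Icc_mem_nhds ht.1 ht.2] with t' ht' using key t' ht'

/-- A function on a product is differentiable in the first variable. -/
theorem hasDerivAt_fst {f : ℝ × ℝ → F} {I K : Set ℝ} (hI : IsOpen I) {p : ℝ × ℝ}
    (hp : p ∈ I ×ˢ K) (hf : DifferentiableWithinAt ℝ f (I ×ˢ K) p) :
    HasDerivAt (fun r => f (r, p.2)) (fderivWithin ℝ f (I ×ˢ K) p (1, 0)) p.1 := by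
  have h1 : HasDerivWithinAt (fun r : ℝ => (r, p.2)) ((1 : ℝ), (0 : ℝ)) I p.1 :=
    (hasDerivWithinAt_id _ _).prodMk (hasDerivWithinAt_const _ _ _)
  exact (HasFDerivWithinAt.comp_hasDerivWithinAt (f := fun r : ℝ => (r, p.2)) p.1
    hf.hasFDerivWithinAt h1 (fun r hr => ⟨hr, hp.2⟩)).hasDerivAt (hI.mem_nhds hp.1)

/-- A function on a product is differentiable in the second variable. -/
theorem hasDerivWithinAt_snd {f : ℝ × ℝ → F} {I K : Set ℝ} {p : ℝ × ℝ}
    (hp : p ∈ I ×ˢ K) (hf : DifferentiableWithinAt ℝ f (I ×ˢ K) p) :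
    HasDerivWithinAt (fun t => f (p.1, t)) (fderivWithin ℝ f (I ×ˢ K) p (0, 1)) K p.2 := by
  have h1 : HasDerivWithinAt (fun t : ℝ => (p.1, t)) ((0 : ℝ), (1 : ℝ)) K p.2 :=
    (hasDerivWithinAt_const _ _ _).prodMk (hasDerivWithinAt_id _ _)
  exact HasFDerivWithinAt.comp_hasDerivWithinAt (f := fun t : ℝ => (p.1, t)) p.2
    hf.hasFDerivWithinAt h1 (fun t ht => ⟨hp.1, ht⟩)

theorem continuousWithinAt_fderivWithin_apply {f : ℝ × ℝ → F} {D : Set (ℝ × ℝ)} {p : ℝ × ℝ}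
    (hD : UniqueDiffOn ℝ D) (hp : p ∈ D) (hf : ContDiffWithinAt ℝ 1 f D p) (u : ℝ × ℝ) :
    ContinuousWithinAt (fun p => fderivWithin ℝ f D p u) D p :=
  ((hf.fderivWithin_right (m := 0) hD (by norm_num) hp).continuousWithinAt).clm_apply
    continuousWithinAt_const

/-- A `C²` function on a product has a continuous mixed second derivative. -/
theorem mixed_of_contDiffWithinAt {f : ℝ × ℝ → F} {I K : Set ℝ} (hI : IsOpen I)
    (hK : UniqueDiffOn ℝ K) {p : ℝ × ℝ} (hp : p ∈ I ×ˢ K)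
    (hf : ContDiffWithinAt ℝ 2 f (I ×ˢ K) p) :
    DifferentiableAt ℝ (fun r => derivWithin (fun t => f (r, t)) K p.2) p.1 ∧
      ContinuousWithinAt (fun p : ℝ × ℝ =>
        deriv (fun r => derivWithin (fun t => f (r, t)) K p.2) p.1) (I ×ˢ K) p := by
  have hD : UniqueDiffOn ℝ (I ×ˢ K) := hI.uniqueDiffOn.prod hK
  set G : ℝ × ℝ → F := fun p => fderivWithin ℝ f (I ×ˢ K) p (0, 1) with hG
  have hev : ∀ᶠ p' in 𝓝[I ×ˢ K] p, p' ∈ I ×ˢ K ∧ ContDiffWithinAt ℝ 2 f (I ×ˢ K) p' := by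
    have := hf.eventually (by decide)
    rw [insert_eq_of_mem hp] at this
    exact (eventually_mem_nhdsWithin).and this
  have hG1 : ∀ p' ∈ I ×ˢ K, ContDiffWithinAt ℝ 2 f (I ×ˢ K) p' →
      ContDiffWithinAt ℝ 1 G (I ×ˢ K) p' := fun p' hp' h =>
    (h.fderivWithin_right hD (by norm_num) hp').clm_apply contDiffWithinAt_const
  -- The formula is needed at all points near p, not only at p, because continuity of the mixed
  -- derivative is deduced from that of `fderivWithin ℝ G`.
  have hd : ∀ p' ∈ I ×ˢ K, (∀ᶠ p'' in 𝓝[I ×ˢ K] p', p'' ∈ I ×ˢ K ∧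
      ContDiffWithinAt ℝ 2 f (I ×ˢ K) p'') →
      HasDerivAt (fun r => derivWithin (fun t => f (r, t)) K p'.2)
        (fderivWithin ℝ G (I ×ˢ K) p' (1, 0)) p'.1 := by
    intro p' hp' h
    have h1 := hasDerivAt_fst hI hp'
      ((hG1 p' hp' (h.self_of_nhdsWithin hp').2).differentiableWithinAt one_ne_zero)
    refine h1.congr_of_eventuallyEq ?_
    have ht : Filter.Tendsto (fun r : ℝ => (r, p'.2)) (𝓝[I] p'.1) (𝓝[I ×ˢ K] p') :=
      ContinuousWithinAt.tendsto_nhdsWithin (f := fun r : ℝ => (r, p'.2)) (by fun_prop)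
        (fun r hr => ⟨hr, hp'.2⟩)
    rw [hI.nhdsWithin_eq hp'.1] at ht
    filter_upwards [ht.eventually h] with r ⟨hr, hr2⟩
    exact (hasDerivWithinAt_snd hr (hr2.differentiableWithinAt two_ne_zero)).derivWithin
      (hK _ hp'.2)
  refine ⟨(hd p hp hev).differentiableAt, ?_⟩
  have hc := continuousWithinAt_fderivWithin_apply hD hp (hG1 p hp (hev.self_of_nhdsWithin hp).2)
    (1, 0)
  refine hc.congr_of_eventuallyEq ?_ (hd p hp hev).deriv
  filter_upwards [eventually_eventually_nhdsWithin.2 hev, eventually_mem_nhdsWithin] with p' h hp'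
  exact (hd p' hp' h).deriv

end Calculus

end Eisenhart

end

noncomputable section

namespace Eisenhart

/-! ### The first variation of the action -/

variable {d : ℕ} {S : Type*} [TopologicalSpace S]
  [ChartedSpace (EuclideanSpace ℝ (Fin d)) S] [IsManifold (𝓡 d) 2 S]

theorem contDiffWithinAt_chartMap {n : WithTop ℕ∞} (hn : n ≤ 2) {Q : ℝ → ℝ → S} {D : Set (ℝ × ℝ)}
    {x₀ : S} {p : ℝ × ℝ}
    (h : ContMDiffWithinAt 𝓘(ℝ, ℝ × ℝ) (𝓡 d) n (fun p : ℝ × ℝ => Q p.1 p.2) D p)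
    (hs : Q p.1 p.2 ∈ (extChartAt (𝓡 d) x₀).source) :
    ContDiffWithinAt ℝ n (fun p : ℝ × ℝ => chartCurve (𝓡 d) (Q p.1) x₀ p.2) D p := by
  have : IsManifold (𝓡 d) n S := .of_le hn
  rw [← contMDiffWithinAt_iff_contDiffWithinAt]
  have h1 := contMDiffAt_extChartAt' (I := 𝓡 d) (n := n) (x := x₀) (x' := Q p.1 p.2)
    (by rwa [extChartAt_source] at hs)
  exact h1.comp_contMDiffWithinAt (f := fun p : ℝ × ℝ => Q p.1 p.2) p h

namespace IsVariation

variable {q : ℝ → S} {t₀ t₁ ε : ℝ} {Q : ℝ → ℝ → S}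

theorem contDiffWithinAt (hQ : IsVariation (d := d) q t₀ t₁ ε Q) {x₀ : S} {p : ℝ × ℝ}
    (hp : p ∈ Ioo (-ε) ε ×ˢ Icc t₀ t₁) (hs : Q p.1 p.2 ∈ (extChartAt (𝓡 d) x₀).source) :
    ContDiffWithinAt ℝ 1 (fun p : ℝ × ℝ => chartCurve (𝓡 d) (Q p.1) x₀ p.2)
      (Ioo (-ε) ε ×ˢ Icc t₀ t₁) p :=
  contDiffWithinAt_chartMap (by norm_num) (hQ.contMDiffOn p hp) hs

theorem eventually_mem (hQ : IsVariation (d := d) q t₀ t₁ ε Q) {x₀ : S} {p : ℝ × ℝ}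
    (hp : p ∈ Ioo (-ε) ε ×ˢ Icc t₀ t₁) (hs : Q p.1 p.2 ∈ (extChartAt (𝓡 d) x₀).source) :
    ∀ᶠ p' in 𝓝[Ioo (-ε) ε ×ˢ Icc t₀ t₁] p, p' ∈ Ioo (-ε) ε ×ˢ Icc t₀ t₁ ∧
      Q p'.1 p'.2 ∈ (extChartAt (𝓡 d) x₀).source :=
  eventually_mem_nhdsWithin.and (eventually_mem_source (γ := fun p : ℝ × ℝ => Q p.1 p.2)
    (hQ.contMDiffOn.continuousOn p hp) hs)

/-- The coordinate position, its two partial derivatives, and the mixed derivative. -/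
theorem hasDerivAt_chart (hQ : IsVariation (d := d) q t₀ t₁ ε Q) (ht : t₀ < t₁) {x₀ : S}
    {p : ℝ × ℝ} (hp : p ∈ Ioo (-ε) ε ×ˢ Icc t₀ t₁)
    (hs : Q p.1 p.2 ∈ (extChartAt (𝓡 d) x₀).source) :
    HasDerivAt (fun r => chartCurve (𝓡 d) (Q r) x₀ p.2)
        (deriv (fun r => chartCurve (𝓡 d) (Q r) x₀ p.2) p.1) p.1 ∧
      HasDerivWithinAt (chartCurve (𝓡 d) (Q p.1) x₀)
        (derivWithin (chartCurve (𝓡 d) (Q p.1) x₀) (Icc t₀ t₁) p.2) (Icc t₀ t₁) p.2 ∧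
      ContinuousWithinAt (fun p : ℝ × ℝ => deriv (fun r => chartCurve (𝓡 d) (Q r) x₀ p.2) p.1)
        (Ioo (-ε) ε ×ˢ Icc t₀ t₁) p ∧
      ContinuousWithinAt (fun p : ℝ × ℝ =>
        derivWithin (chartCurve (𝓡 d) (Q p.1) x₀) (Icc t₀ t₁) p.2)
        (Ioo (-ε) ε ×ˢ Icc t₀ t₁) p := by
  have hD : UniqueDiffOn ℝ (Ioo (-ε) ε ×ˢ Icc t₀ t₁) :=
    isOpen_Ioo.uniqueDiffOn.prod (uniqueDiffOn_Icc ht)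
  have h1 (p' : ℝ × ℝ) (hp' : p' ∈ Ioo (-ε) ε ×ˢ Icc t₀ t₁)
      (hs' : Q p'.1 p'.2 ∈ (extChartAt (𝓡 d) x₀).source) :=
    hasDerivAt_fst isOpen_Ioo hp'
      ((hQ.contDiffWithinAt hp' hs').differentiableWithinAt one_ne_zero)
  have h2 (p' : ℝ × ℝ) (hp' : p' ∈ Ioo (-ε) ε ×ˢ Icc t₀ t₁)
      (hs' : Q p'.1 p'.2 ∈ (extChartAt (𝓡 d) x₀).source) :=
    hasDerivWithinAt_snd hp' ((hQ.contDiffWithinAt hp' hs').differentiableWithinAt one_ne_zero)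
  refine ⟨(h1 p hp hs).differentiableAt.hasDerivAt,
    (h2 p hp hs).differentiableWithinAt.hasDerivWithinAt, ?_, ?_⟩
  · refine (continuousWithinAt_fderivWithin_apply hD hp (hQ.contDiffWithinAt hp hs)
      (1, 0)).congr_of_eventuallyEq ?_ (h1 p hp hs).deriv
    filter_upwards [hQ.eventually_mem hp hs] with p' hp' using (h1 p' hp'.1 hp'.2).deriv
  · refine (continuousWithinAt_fderivWithin_apply hD hp (hQ.contDiffWithinAt hp hs)
      (0, 1)).congr_of_eventuallyEq ?_
      ((h2 p hp hs).derivWithin (uniqueDiffOn_Icc ht _ hp.2))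
    filter_upwards [hQ.eventually_mem hp hs] with p' hp' using
      (h2 p' hp'.1 hp'.2).derivWithin (uniqueDiffOn_Icc ht _ hp'.1.2)

theorem mdifferentiableWithinAt (hQ : IsVariation (d := d) q t₀ t₁ ε Q) {r t : ℝ}
    (hr : r ∈ Ioo (-ε) ε) (ht : t ∈ Icc t₀ t₁) :
    MDifferentiableWithinAt 𝓘(ℝ, ℝ) (𝓡 d) (Q r) (Icc t₀ t₁) t := by
  have h := (hQ.contMDiffOn (r, t) ⟨hr, ht⟩).mdifferentiableWithinAt one_ne_zero
  have h2 : MDifferentiableWithinAt 𝓘(ℝ, ℝ) 𝓘(ℝ, ℝ × ℝ) (fun t : ℝ => (r, t)) (Icc t₀ t₁) t :=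
    (DifferentiableAt.mdifferentiableAt (by fun_prop)).mdifferentiableWithinAt
  exact MDifferentiableWithinAt.comp (g := fun p : ℝ × ℝ => Q p.1 p.2) t h h2
    (fun t ht => ⟨hr, ht⟩)

theorem mdifferentiableAt (hQ : IsVariation (d := d) q t₀ t₁ ε Q) {r t : ℝ}
    (hr : r ∈ Ioo (-ε) ε) (ht : t ∈ Icc t₀ t₁) :
    MDifferentiableAt 𝓘(ℝ, ℝ) (𝓡 d) (fun r => Q r t) r := by
  have h := (hQ.contMDiffOn (r, t) ⟨hr, ht⟩).mdifferentiableWithinAt one_ne_zero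
  have h2 : MDifferentiableWithinAt 𝓘(ℝ, ℝ) 𝓘(ℝ, ℝ × ℝ) (fun r : ℝ => (r, t)) (Ioo (-ε) ε) r :=
    (DifferentiableAt.mdifferentiableAt (by fun_prop)).mdifferentiableWithinAt
  have h3 := MDifferentiableWithinAt.comp (g := fun p : ℝ × ℝ => Q p.1 p.2)
    (f := fun r : ℝ => (r, t)) (s := Ioo (-ε) ε) r h h2 (fun r hr => ⟨hr, ht⟩)
  exact h3.mdifferentiableAt (Ioo_mem_nhds hr.1 hr.2)

/-- Interchange of the partial derivatives in a chart. -/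
theorem hasDerivAt_deriv_chart (hQ : IsVariation (d := d) q t₀ t₁ ε Q) (hε : 0 < ε) {x₀ : S} {t : ℝ}
    (ht : t ∈ Ioo t₀ t₁) (hs : Q 0 t ∈ (extChartAt (𝓡 d) x₀).source) :
    HasDerivAt (fun t => deriv (fun r => chartCurve (𝓡 d) (Q r) x₀ t) 0)
      (deriv (fun r => derivWithin (chartCurve (𝓡 d) (Q r) x₀) (Icc t₀ t₁) t) 0) t := by
  have h01 : t₀ < t₁ := ht.1.trans ht.2
  have hp : ((0 : ℝ), t) ∈ Ioo (-ε) ε ×ˢ Icc t₀ t₁ :=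
    ⟨⟨by linarith, hε⟩, Ioo_subset_Icc_self ht⟩
  have hev := hQ.eventually_mem (p := (0, t)) hp hs
  rw [nhdsWithin_eq_nhds.2 (prod_mem_nhds (Ioo_mem_nhds hp.1.1 hp.1.2)
    (Icc_mem_nhds ht.1 ht.2)), Metric.eventually_nhds_iff] at hev
  obtain ⟨δ, hδ, hball⟩ := hev
  -- A rectangle around (0, t) that the variation maps into one chart; `hasDerivAt_deriv_swap` is
  -- applied on it.
  have hmem : ∀ r ∈ Ioo (-(δ / 2)) (δ / 2), ∀ s ∈ Icc (t - δ / 2) (t + δ / 2),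
      (r, s) ∈ Ioo (-ε) ε ×ˢ Icc t₀ t₁ ∧ Q r s ∈ (extChartAt (𝓡 d) x₀).source := by
    intro r hr s hs
    refine hball (y := (r, s)) ?_
    rw [Prod.dist_eq, max_lt_iff, Real.dist_eq, Real.dist_eq, abs_lt, abs_lt]
    exact ⟨⟨by linarith [hr.1], by linarith [hr.2]⟩, by linarith [hs.1], by linarith [hs.2]⟩
  have hsub : Icc (t - δ / 2) (t + δ / 2) ⊆ Icc t₀ t₁ := fun s hs =>
    (hmem 0 ⟨by linarith, by linarith⟩ s hs).1.2
  refine hasDerivAt_deriv_swap (ε := δ / 2) (a := t - δ / 2) (b := t + δ / 2)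
    (f := fun r => chartCurve (𝓡 d) (Q r) x₀)
    (V := fun r => derivWithin (chartCurve (𝓡 d) (Q r) x₀) (Icc t₀ t₁))
    (V' := fun r t => deriv (fun r => derivWithin (chartCurve (𝓡 d) (Q r) x₀) (Icc t₀ t₁) t) r)
    (h := fun r t => deriv (fun r => chartCurve (𝓡 d) (Q r) x₀ t) r)
    (by linarith) ?_ ?_ ?_ ?_ ?_ ⟨by linarith, by linarith⟩
  · intro r hr s hs'
    obtain ⟨h1, h2⟩ := hmem r hr s hs'
    exact (hQ.hasDerivAt_chart h01 h1 h2).2.1.mono hsub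
  · intro r hr s hs'
    obtain ⟨h1, h2⟩ := hmem r hr s hs'
    exact ContinuousWithinAt.comp (f := fun s : ℝ => (r, s)) (x := s)
      (hQ.hasDerivAt_chart h01 h1 h2).2.2.2 (by fun_prop) (fun s hs => ⟨h1.1, hsub hs⟩)
  · intro r hr s hs'
    obtain ⟨h1, h2⟩ := hmem r hr s hs'
    exact (hQ.mixed x₀ r h1.1 s h1.2 h2).1.hasDerivAt
  · intro p hp'
    obtain ⟨h1, h2⟩ := hmem p.1 hp'.1 p.2 hp'.2
    exact (hQ.mixed x₀ p.1 h1.1 p.2 h1.2 h2).2.mono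
      fun p'' hp'' => (hmem p''.1 hp''.1 p''.2 hp''.2).1
  · intro s hs'
    obtain ⟨h1, h2⟩ := hmem 0 ⟨by linarith, by linarith⟩ s hs'
    exact (hQ.hasDerivAt_chart h01 h1 h2).1

end IsVariation

variable {T : Set ℝ}

/-- The derivative of the Lagrangian along a curve of curves in a coordinate domain. -/
theorem hasDerivAt_coordLagrangian
    {A : ℝ × EuclideanSpace ℝ (Fin d) →
      EuclideanSpace ℝ (Fin d) →L[ℝ] EuclideanSpace ℝ (Fin d) →L[ℝ] ℝ}
    {B : ℝ × EuclideanSpace ℝ (Fin d) → EuclideanSpace ℝ (Fin d) →L[ℝ] ℝ}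
    {U : ℝ × EuclideanSpace ℝ (Fin d) → ℝ} {Ω : Set (ℝ × EuclideanSpace ℝ (Fin d))}
    (hΩ : IsOpen Ω) (hA : ContDiffOn ℝ 1 A Ω) (hB : ContDiffOn ℝ 1 B Ω) (hU : ContDiffOn ℝ 1 U Ω)
    (hsymm : ∀ p ∈ Ω, ∀ u w, A p u w = A p w u)
    {c v : ℝ → EuclideanSpace ℝ (Fin d)} {h v' : EuclideanSpace ℝ (Fin d)} {r t : ℝ}
    (hc : HasDerivAt c h r) (hv : HasDerivAt v v' r) (hm : (t, c r) ∈ Ω) :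
    HasDerivAt (fun r => (1 / 2) * A (t, c r) (v r) (v r) + B (t, c r) (v r) - U (t, c r))
      (lagrangianForce A B U (t, c r) (v r) h + (A (t, c r) (v r) + B (t, c r)) v') r := by
  have hn := hΩ.mem_nhds hm
  have hl : HasDerivAt (fun r => (t, c r)) (0, h) r := (hasDerivAt_const r t).prodMk hc
  have hA1 := ((hA.contDiffAt hn).differentiableAt one_ne_zero).hasFDerivAt.comp_hasDerivAt r hl
  have hB1 := ((hB.contDiffAt hn).differentiableAt one_ne_zero).hasFDerivAt.comp_hasDerivAt r hl
  have hU1 := ((hU.contDiffAt hn).differentiableAt one_ne_zero).hasFDerivAt.comp_hasDerivAt r hl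
  refine (((((hA1.clm_apply hv).clm_apply hv).const_mul (1 / 2)).add
    (hB1.clm_apply hv)).sub hU1).congr_deriv ?_
  simp only [lagrangianForce, add_apply, Function.comp, hsymm _ hm v' (v r)]
  ring

namespace ClassicalSystem

variable (sys : ClassicalSystem d S T)

theorem locA_symm {x₀ : S} (p : ℝ × EuclideanSpace ℝ (Fin d))
    (hp : p ∈ T ×ˢ (extChartAt (𝓡 d) x₀).target) (u w : EuclideanSpace ℝ (Fin d)) :
    sys.locA x₀ p u w = sys.locA x₀ p w u :=
  sys.a_symm _ hp.1 _ _ _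

/-- The Lagrangian along the variation `Q`. -/
def lagrangianAlong (Q : ℝ → ℝ → S) (t₀ t₁ r t : ℝ) : ℝ :=
  sys.lagrangian t (Q r t) (velocity (𝓡 d) (Q r) (Icc t₀ t₁) t)

variable {q : ℝ → S} {t₀ t₁ ε : ℝ} {Q : ℝ → ℝ → S}

theorem lagrangianAlong_chart (hQ : IsVariation (d := d) q t₀ t₁ ε Q) (ht : t₀ < t₁) {x₀ : S}
    {p : ℝ × ℝ} (hp : p ∈ Ioo (-ε) ε ×ˢ Icc t₀ t₁)
    (hs : Q p.1 p.2 ∈ (extChartAt (𝓡 d) x₀).source) :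
    sys.lagrangianAlong Q t₀ t₁ p.1 p.2 =
      (1 / 2) * sys.locA x₀ (p.2, chartCurve (𝓡 d) (Q p.1) x₀ p.2)
          (derivWithin (chartCurve (𝓡 d) (Q p.1) x₀) (Icc t₀ t₁) p.2)
          (derivWithin (chartCurve (𝓡 d) (Q p.1) x₀) (Icc t₀ t₁) p.2)
        + sys.locB x₀ (p.2, chartCurve (𝓡 d) (Q p.1) x₀ p.2)
          (derivWithin (chartCurve (𝓡 d) (Q p.1) x₀) (Icc t₀ t₁) p.2)
        - locF sys.U x₀ (p.2, chartCurve (𝓡 d) (Q p.1) x₀ p.2) :=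
  sys.lagrangian_eq _ (uniqueDiffOn_Icc ht _ hp.2) hp.2
    (hQ.mdifferentiableWithinAt hp.1 hp.2) hs

/-- The derivative of the Lagrangian along a variation, in a chart. -/
theorem hasDerivAt_lagrangianAlong (hT : IsOpen T) (hTt : Icc t₀ t₁ ⊆ T)
    (hQ : IsVariation (d := d) q t₀ t₁ ε Q) (ht : t₀ < t₁) {x₀ : S}
    {p : ℝ × ℝ} (hp : p ∈ Ioo (-ε) ε ×ˢ Icc t₀ t₁)
    (hs : Q p.1 p.2 ∈ (extChartAt (𝓡 d) x₀).source) :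
    HasDerivAt (fun r => sys.lagrangianAlong Q t₀ t₁ r p.2)
      (lagrangianForce (sys.locA x₀) (sys.locB x₀) (locF sys.U x₀)
          (p.2, chartCurve (𝓡 d) (Q p.1) x₀ p.2)
          (derivWithin (chartCurve (𝓡 d) (Q p.1) x₀) (Icc t₀ t₁) p.2)
          (deriv (fun r => chartCurve (𝓡 d) (Q r) x₀ p.2) p.1)
        + (sys.locA x₀ (p.2, chartCurve (𝓡 d) (Q p.1) x₀ p.2)
            (derivWithin (chartCurve (𝓡 d) (Q p.1) x₀) (Icc t₀ t₁) p.2)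
            + sys.locB x₀ (p.2, chartCurve (𝓡 d) (Q p.1) x₀ p.2))
          (deriv (fun r => derivWithin (chartCurve (𝓡 d) (Q r) x₀) (Icc t₀ t₁) p.2) p.1)) p.1 := by
  have hm : (p.2, chartCurve (𝓡 d) (Q p.1) x₀ p.2) ∈ T ×ˢ (extChartAt (𝓡 d) x₀).target :=
    ⟨hTt hp.2, (extChartAt (𝓡 d) x₀).map_source hs⟩
  have h := hasDerivAt_coordLagrangian (hT.prod (isOpen_extChartAt_target x₀))
    (sys.contDiffOn_locA x₀) (sys.contDiffOn_locB x₀) (contDiffOn_locF sys.contMDiffOn_U x₀)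
    sys.locA_symm (hQ.hasDerivAt_chart ht hp hs).1
    (hQ.mixed x₀ p.1 hp.1 p.2 hp.2 hs).1.hasDerivAt hm
  refine h.congr_of_eventuallyEq ?_
  have htend : Filter.Tendsto (fun r : ℝ => (r, p.2)) (𝓝 p.1) (𝓝[Ioo (-ε) ε ×ˢ Icc t₀ t₁] p) := by
    have := ContinuousWithinAt.tendsto_nhdsWithin (f := fun r : ℝ => (r, p.2)) (s := Ioo (-ε) ε)
      (t := Ioo (-ε) ε ×ˢ Icc t₀ t₁) (x := p.1) (by fun_prop) (fun r hr => ⟨hr, hp.2⟩)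
    rwa [isOpen_Ioo.nhdsWithin_eq hp.1] at this
  filter_upwards [htend.eventually (hQ.eventually_mem hp hs)] with r hr
  exact sys.lagrangianAlong_chart hQ ht hr.1 hr.2

/-- Continuity is local, so the chart around Q p may be used. Only first derivatives of the
coefficients and the mixed derivative of the variation occur, all continuous by assumption. This is
what differentiation under the action integral requires. -/
theorem continuousWithinAt_lagrangianAlong (hT : IsOpen T) (hTt : Icc t₀ t₁ ⊆ T)
    (hQ : IsVariation (d := d) q t₀ t₁ ε Q) (ht : t₀ < t₁)
    {p : ℝ × ℝ} (hp : p ∈ Ioo (-ε) ε ×ˢ Icc t₀ t₁) :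
    ContinuousWithinAt (fun p : ℝ × ℝ => sys.lagrangianAlong Q t₀ t₁ p.1 p.2)
        (Ioo (-ε) ε ×ˢ Icc t₀ t₁) p ∧
      ContinuousWithinAt (fun p : ℝ × ℝ =>
        deriv (fun r => sys.lagrangianAlong Q t₀ t₁ r p.2) p.1) (Ioo (-ε) ε ×ˢ Icc t₀ t₁) p := by
  set x₀ := Q p.1 p.2 with hx₀
  have hs : Q p.1 p.2 ∈ (extChartAt (𝓡 d) x₀).source := mem_extChartAt_source _
  have hm : (p.2, chartCurve (𝓡 d) (Q p.1) x₀ p.2) ∈ T ×ˢ (extChartAt (𝓡 d) x₀).target :=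
    ⟨hTt hp.2, (extChartAt (𝓡 d) x₀).map_source hs⟩
  have hΩ : IsOpen (T ×ˢ (extChartAt (𝓡 d) x₀).target) := hT.prod (isOpen_extChartAt_target x₀)
  obtain ⟨-, -, hch, hcV⟩ := hQ.hasDerivAt_chart ht hp hs
  have hcV' := (hQ.mixed x₀ p.1 hp.1 p.2 hp.2 hs).2
  have hcF : ContinuousWithinAt (fun p : ℝ × ℝ => (p.2, chartCurve (𝓡 d) (Q p.1) x₀ p.2))
      (Ioo (-ε) ε ×ˢ Icc t₀ t₁) p :=
    continuousWithinAt_snd.prodMk (hQ.contDiffWithinAt hp hs).continuousWithinAt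
  have aux {F : Type} [NormedAddCommGroup F] [NormedSpace ℝ F]
      {f : ℝ × EuclideanSpace ℝ (Fin d) → F}
      (hf : ContDiffOn ℝ 1 f (T ×ˢ (extChartAt (𝓡 d) x₀).target)) :
      ContinuousWithinAt (fun p : ℝ × ℝ => f (p.2, chartCurve (𝓡 d) (Q p.1) x₀ p.2))
        (Ioo (-ε) ε ×ˢ Icc t₀ t₁) p ∧
      ContinuousWithinAt (fun p : ℝ × ℝ => fderiv ℝ f (p.2, chartCurve (𝓡 d) (Q p.1) x₀ p.2))
        (Ioo (-ε) ε ×ˢ Icc t₀ t₁) p := by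
    have h1 := hf.continuousOn.continuousAt (hΩ.mem_nhds hm)
    have h2 := (hf.continuousOn_fderiv_of_isOpen hΩ le_rfl).continuousAt (hΩ.mem_nhds hm)
    exact ⟨ContinuousAt.comp_continuousWithinAt (f := fun p : ℝ × ℝ =>
        (p.2, chartCurve (𝓡 d) (Q p.1) x₀ p.2)) h1 hcF,
      ContinuousAt.comp_continuousWithinAt (f := fun p : ℝ × ℝ =>
        (p.2, chartCurve (𝓡 d) (Q p.1) x₀ p.2)) h2 hcF⟩
  obtain ⟨hA, hA'⟩ := aux (sys.contDiffOn_locA x₀)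
  obtain ⟨hB, hB'⟩ := aux (sys.contDiffOn_locB x₀)
  obtain ⟨hU, hU'⟩ := aux (contDiffOn_locF sys.contMDiffOn_U x₀)
  have h0h : ContinuousWithinAt (fun p : ℝ × ℝ =>
      ((0 : ℝ), deriv (fun r => chartCurve (𝓡 d) (Q r) x₀ p.2) p.1))
      (Ioo (-ε) ε ×ˢ Icc t₀ t₁) p := continuousWithinAt_const.prodMk hch
  constructor
  · refine ContinuousWithinAt.congr_of_eventuallyEq (f := fun p : ℝ × ℝ => _)
      ((((hA.clm_apply hcV).clm_apply hcV).const_smul (1 / 2 : ℝ)).add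
        (hB.clm_apply hcV) |>.sub hU) ?_ (sys.lagrangianAlong_chart hQ ht hp hs)
    filter_upwards [hQ.eventually_mem hp hs] with p' hp'
      using sys.lagrangianAlong_chart hQ ht hp'.1 hp'.2
  · refine ContinuousWithinAt.congr_of_eventuallyEq (f := fun p : ℝ × ℝ => _)
      (((((((hA'.clm_apply h0h).clm_apply hcV).clm_apply hcV).const_smul (1 / 2 : ℝ)).add
        ((hB'.clm_apply h0h).clm_apply hcV)).sub (hU'.clm_apply h0h)).add
        (((hA.clm_apply hcV).add hB).clm_apply hcV')) ?_
        (sys.hasDerivAt_lagrangianAlong hT hTt hQ ht hp hs).deriv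
    filter_upwards [hQ.eventually_mem hp hs] with p' hp'
      using (sys.hasDerivAt_lagrangianAlong hT hTt hQ ht hp'.1 hp'.2).deriv

/-- The first variation of the action. -/
theorem hasDerivAt_action (hT : IsOpen T) (hTt : Icc t₀ t₁ ⊆ T)
    (hQ : IsVariation (d := d) q t₀ t₁ ε Q) (ht : t₀ < t₁) (hε : 0 < ε) :
    HasDerivAt (fun r => sys.action t₀ t₁ (Q r))
      (∫ t in t₀..t₁, deriv (fun r => sys.lagrangianAlong Q t₀ t₁ r t) 0) 0 := by
  refine hasDerivAt_integral_of_continuousOn (g := sys.lagrangianAlong Q t₀ t₁)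
    (g' := fun r t => deriv (fun r => sys.lagrangianAlong Q t₀ t₁ r t) r) hε ht.le ?_ ?_ ?_
  · intro r hr t ht'
    exact ContinuousWithinAt.comp (f := fun s : ℝ => (r, s)) (x := t)
      (sys.continuousWithinAt_lagrangianAlong hT hTt hQ ht (p := (r, t)) ⟨hr, ht'⟩).1
      (by fun_prop) (fun s hs => ⟨hr, hs⟩)
  · intro r hr t ht'
    exact (sys.hasDerivAt_lagrangianAlong hT hTt hQ ht (p := (r, t)) (x₀ := Q r t) ⟨hr, ht'⟩
      (mem_extChartAt_source _)).differentiableAt.hasDerivAt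
  · intro p hp
    exact (sys.continuousWithinAt_lagrangianAlong hT hTt hQ ht hp).2

end ClassicalSystem

end Eisenhart

end

noncomputable section

namespace Eisenhart

/-! ### Solutions of the Euler-Lagrange equation are stationary -/

section Curve

variable {F : Type*} [NormedAddCommGroup F] [NormedSpace ℝ F] {c : ℝ → F} {J : Set ℝ} {t : ℝ}

theorem contDiffWithinAt_derivWithin {m n : WithTop ℕ∞} (hc : ContDiffWithinAt ℝ n c J t)
    (hJ : UniqueDiffOn ℝ J) (ht : t ∈ J) (hmn : m + 1 ≤ n) :
    ContDiffWithinAt ℝ m (derivWithin c J) J t :=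
  (hc.fderivWithin_right hJ hmn ht).clm_apply contDiffWithinAt_const

theorem hasDerivWithinAt_derivWithin (hc : ContDiffWithinAt ℝ 2 c J t)
    (hJ : UniqueDiffOn ℝ J) (ht : t ∈ J) :
    HasDerivWithinAt (derivWithin c J) (derivWithin (derivWithin c J) J t) J t :=
  ((contDiffWithinAt_derivWithin (m := 1) hc hJ ht (by norm_num)).differentiableWithinAt
    one_ne_zero).hasDerivWithinAt

end Curve

variable {d : ℕ} {S : Type*} [TopologicalSpace S]
  [ChartedSpace (EuclideanSpace ℝ (Fin d)) S] [IsManifold (𝓡 d) 2 S] {T : Set ℝ}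

namespace ClassicalSystem

variable (sys : ClassicalSystem d S T)

/-- The Euler-Lagrange expression of the curve `q` in the chart around `x₀`. -/
def chartEL (q : ℝ → S) (J : Set ℝ) (x₀ : S) (t : ℝ) (w : EuclideanSpace ℝ (Fin d)) : ℝ :=
  elExpr (sys.locA x₀) (sys.locB x₀) (locF sys.U x₀) (t, chartCurve (𝓡 d) q x₀ t)
    (derivWithin (chartCurve (𝓡 d) q x₀) J t)
    (derivWithin (derivWithin (chartCurve (𝓡 d) q x₀) J) J t) w

/-- `q` satisfies the Euler-Lagrange equation in every chart. -/
def IsEL (q : ℝ → S) (J : Set ℝ) : Prop :=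
  ∀ x₀ : S, ∀ t ∈ J, q t ∈ (extChartAt (𝓡 d) x₀).source → ∀ w, sys.chartEL q J x₀ t w = 0

theorem hasDerivWithinAt_chartMomentum (hT : IsOpen T) {q : ℝ → S} {J : Set ℝ} (hJT : J ⊆ T)
    (hJ : UniqueDiffOn ℝ J) {x₀ : S} {t : ℝ} (ht : t ∈ J)
    (hq : ContMDiffWithinAt 𝓘(ℝ, ℝ) (𝓡 d) 2 q J t) (hs : q t ∈ (extChartAt (𝓡 d) x₀).source) :
    HasDerivWithinAt (fun s => sys.locA x₀ (s, chartCurve (𝓡 d) q x₀ s)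
        (derivWithin (chartCurve (𝓡 d) q x₀) J s) + sys.locB x₀ (s, chartCurve (𝓡 d) q x₀ s))
      (momentumDeriv (sys.locA x₀) (sys.locB x₀) (t, chartCurve (𝓡 d) q x₀ t)
        (derivWithin (chartCurve (𝓡 d) q x₀) J t)
        (derivWithin (derivWithin (chartCurve (𝓡 d) q x₀) J) J t)) J t := by
  have hc := contDiffWithinAt_chartCurve hq hs
  exact hasDerivWithinAt_momentum (hT.prod (isOpen_extChartAt_target x₀)) (sys.contDiffOn_locA x₀)
    (sys.contDiffOn_locB x₀) (hc.differentiableWithinAt two_ne_zero).hasDerivWithinAt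
    (hasDerivWithinAt_derivWithin hc hJ ht) ⟨hJT ht, (extChartAt (𝓡 d) x₀).map_source hs⟩

/-- The momentum of the curve `Q 0` paired with the variation field. -/
def momentumAlong (Q : ℝ → ℝ → S) (t₀ t₁ t : ℝ) : ℝ :=
  sys.a t (Q 0 t) (velocity (𝓡 d) (Q 0) (Icc t₀ t₁) t) (velocity (𝓡 d) (fun r => Q r t) univ 0)
    + sys.b t (Q 0 t) (velocity (𝓡 d) (fun r => Q r t) univ 0)

variable {q : ℝ → S} {t₀ t₁ ε : ℝ} {Q : ℝ → ℝ → S}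

/-- The left side involves no chart, so this expression holds in every chart containing q t. Hence
the integration by parts needs no subdivision of the interval. -/
theorem momentumAlong_chart (hQ : IsVariation (d := d) q t₀ t₁ ε Q) (hε : 0 < ε) (h01 : t₀ < t₁)
    {x₀ : S} {t : ℝ} (ht : t ∈ Icc t₀ t₁) (hs : q t ∈ (extChartAt (𝓡 d) x₀).source) :
    sys.momentumAlong Q t₀ t₁ t = (sys.locA x₀ (t, chartCurve (𝓡 d) q x₀ t)
        (derivWithin (chartCurve (𝓡 d) q x₀) (Icc t₀ t₁) t)
        + sys.locB x₀ (t, chartCurve (𝓡 d) q x₀ t))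
      (deriv (fun r => chartCurve (𝓡 d) (Q r) x₀ t) 0) := by
  have : IsManifold (𝓡 d) 1 S := .of_le (n := 2) (by norm_num)
  have h0 : (0 : ℝ) ∈ Ioo (-ε) ε := ⟨by linarith, hε⟩
  have hs' : Q 0 t ∈ (extChartAt (𝓡 d) x₀).source := by rwa [hQ.zero t ht]
  have hc : EqOn (chartCurve (𝓡 d) q x₀) (chartCurve (𝓡 d) (Q 0) x₀) (Icc t₀ t₁) :=
    fun s hs => by simp [chartCurve, hQ.zero s hs]
  have h1 := velocity_eq (uniqueDiffOn_Icc h01 _ ht) ht (hQ.mdifferentiableWithinAt h0 ht) hs'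
  have h2 := velocity_eq (γ := fun r => Q r t) (J := univ) (s := 0) (x₀ := x₀)
    uniqueDiffWithinAt_univ (mem_univ _)
    (hQ.mdifferentiableAt h0 ht).mdifferentiableWithinAt hs'
  rw [derivWithin_univ] at h2
  rw [momentumAlong, h1, h2, derivWithin_congr hc (hc ht), hc ht, add_apply]
  exact (congrArg₂ (· + ·) (sys.locA_chart t hs' _ _) (sys.locB_chart t hs' _)).symm

/-- Where the variation does not depend on r, its field vanishes. At fixed end points this removes
the boundary terms. -/
theorem momentumAlong_eq_zero (hQ : IsVariation (d := d) q t₀ t₁ ε Q) (hε : 0 < ε) (h01 : t₀ < t₁)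
    {t : ℝ} (ht : t ∈ Icc t₀ t₁) (hfix : ∀ r ∈ Ioo (-ε) ε, Q r t = q t) :
    sys.momentumAlong Q t₀ t₁ t = 0 := by
  rw [sys.momentumAlong_chart hQ hε h01 ht (mem_extChartAt_source (q t))]
  have : (fun r => chartCurve (𝓡 d) (Q r) (q t) t) =ᶠ[𝓝 0]
      fun _ => chartCurve (𝓡 d) q (q t) t := by
    filter_upwards [Ioo_mem_nhds (neg_lt_zero.2 hε) hε] with r hr
    simp [chartCurve, hfix r hr]
  rw [this.deriv_eq, deriv_const, map_zero]

/-- The derivative of the momentum paired with the variation field. -/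
theorem hasDerivAt_momentumAlong (hT : IsOpen T) (hTt : Icc t₀ t₁ ⊆ T)
    (hq : ContMDiffOn 𝓘(ℝ, ℝ) (𝓡 d) 2 q (Icc t₀ t₁))
    (hQ : IsVariation (d := d) q t₀ t₁ ε Q) (hε : 0 < ε) (h01 : t₀ < t₁) {t : ℝ}
    (ht : t ∈ Ioo t₀ t₁) {x₀ : S} (hs : q t ∈ (extChartAt (𝓡 d) x₀).source) :
    HasDerivAt (sys.momentumAlong Q t₀ t₁)
      (deriv (fun r => sys.lagrangianAlong Q t₀ t₁ r t) 0 +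
        sys.chartEL q (Icc t₀ t₁) x₀ t (deriv (fun r => chartCurve (𝓡 d) (Q r) x₀ t) 0)) t := by
  have ht' := Ioo_subset_Icc_self ht
  have h0 : (0 : ℝ) ∈ Ioo (-ε) ε := ⟨by linarith, hε⟩
  have hs' : Q 0 t ∈ (extChartAt (𝓡 d) x₀).source := by rwa [hQ.zero t ht']
  have hnhds : Icc t₀ t₁ ∈ 𝓝 t := Icc_mem_nhds ht.1 ht.2
  have hc : EqOn (chartCurve (𝓡 d) q x₀) (chartCurve (𝓡 d) (Q 0) x₀) (Icc t₀ t₁) :=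
    fun s hs => by simp [chartCurve, hQ.zero s hs]
  have h1 := (sys.hasDerivWithinAt_chartMomentum hT hTt (uniqueDiffOn_Icc h01) ht' (hq t ht')
    hs).hasDerivAt hnhds
  -- Product rule for p(h), with h' replaced by ∂_r ∂_t Q. Then p(h') completes the force term to
  -- ∂_r L, and p' minus the force is the Euler-Lagrange expression.
  have h2 := h1.clm_apply (hQ.hasDerivAt_deriv_chart hε ht hs')
  have h3 := (sys.hasDerivAt_lagrangianAlong hT hTt hQ h01 (p := (0, t)) ⟨h0, ht'⟩ hs').deriv
  rw [h3]
  refine (h2.congr_of_eventuallyEq (f₁ := sys.momentumAlong Q t₀ t₁) ?_).congr_deriv ?_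
  · have := eventually_mem_source (hq.continuousOn t ht') hs
    rw [nhdsWithin_eq_nhds.2 hnhds] at this
    filter_upwards [this, hnhds] with s hs2 hs3 using sys.momentumAlong_chart hQ hε h01 hs3 hs2
  · rw [chartEL, elExpr, derivWithin_congr hc (hc ht'), hc ht']
    ring

/-- The derivative of the pairing is known only in the open interval; continuity up to the end
points lets the fundamental theorem of calculus be used on the closed one. -/
theorem continuousOn_momentumAlong (hT : IsOpen T) (hTt : Icc t₀ t₁ ⊆ T)
    (hq : ContMDiffOn 𝓘(ℝ, ℝ) (𝓡 d) 2 q (Icc t₀ t₁))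
    (hQ : IsVariation (d := d) q t₀ t₁ ε Q) (hε : 0 < ε) (h01 : t₀ < t₁) :
    ContinuousOn (sys.momentumAlong Q t₀ t₁) (Icc t₀ t₁) := by
  intro t ht
  have h0 : (0 : ℝ) ∈ Ioo (-ε) ε := ⟨by linarith, hε⟩
  have hs : q t ∈ (extChartAt (𝓡 d) (q t)).source := mem_extChartAt_source _
  have hs' : Q 0 t ∈ (extChartAt (𝓡 d) (q t)).source := by rwa [hQ.zero t ht]
  have h1 := (sys.hasDerivWithinAt_chartMomentum hT hTt (uniqueDiffOn_Icc h01) ht (hq t ht)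
    hs).continuousWithinAt
  have h2 := ContinuousWithinAt.comp (f := fun t : ℝ => ((0 : ℝ), t)) (x := t) (s := Icc t₀ t₁)
    (hQ.hasDerivAt_chart h01 (p := (0, t)) ⟨h0, ht⟩ hs').2.2.1 (by fun_prop)
    (fun s hs => ⟨h0, hs⟩)
  refine (h1.clm_apply h2).congr_of_eventuallyEq ?_
    (sys.momentumAlong_chart hQ hε h01 ht hs)
  filter_upwards [eventually_mem_source (hq.continuousOn t ht) hs, eventually_mem_nhdsWithin]
    with s hs2 hs3 using sys.momentumAlong_chart hQ hε h01 hs3 hs2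

theorem intervalIntegrable_deriv_lagrangianAlong (hT : IsOpen T) (hTt : Icc t₀ t₁ ⊆ T)
    (hQ : IsVariation (d := d) q t₀ t₁ ε Q) (h01 : t₀ < t₁) (hε : 0 < ε) :
    IntervalIntegrable (fun t => deriv (fun r => sys.lagrangianAlong Q t₀ t₁ r t) 0)
      volume t₀ t₁ := by
  have h0 : (0 : ℝ) ∈ Ioo (-ε) ε := ⟨by linarith, hε⟩
  refine ContinuousOn.intervalIntegrable_of_Icc h01.le fun t ht => ?_
  exact ContinuousWithinAt.comp (f := fun t : ℝ => ((0 : ℝ), t)) (x := t) (s := Icc t₀ t₁)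
    (sys.continuousWithinAt_lagrangianAlong hT hTt hQ h01 (p := (0, t)) ⟨h0, ht⟩).2
    (by fun_prop) (fun s hs => ⟨h0, hs⟩)

/-- A `C²` solution of the Euler-Lagrange equation is a stationary point of the action. -/
theorem IsEL.isStationary (hT : IsOpen T) (hTt : Icc t₀ t₁ ⊆ T) (h01 : t₀ < t₁)
    (hq : ContMDiffOn 𝓘(ℝ, ℝ) (𝓡 d) 2 q (Icc t₀ t₁)) (hEL : sys.IsEL q (Icc t₀ t₁)) :
    sys.IsStationary q t₀ t₁ := by
  refine ⟨hq, fun ε Q hε hQ => ?_⟩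
  have h := sys.hasDerivAt_action hT hTt hQ h01 hε
  have hint := sys.intervalIntegrable_deriv_lagrangianAlong hT hTt hQ h01 hε
  have hW (t : ℝ) (ht : t ∈ Ioo t₀ t₁) : HasDerivWithinAt (sys.momentumAlong Q t₀ t₁)
      (deriv (fun r => sys.lagrangianAlong Q t₀ t₁ r t) 0) (Ioi t) t := by
    have := sys.hasDerivAt_momentumAlong hT hTt hq hQ hε h01 ht (mem_extChartAt_source (q t))
    rw [hEL (q t) t (Ioo_subset_Icc_self ht) (mem_extChartAt_source (q t)), add_zero] at this
    exact this.hasDerivWithinAt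
  -- When the Euler-Lagrange term vanishes, ∂_r L is the derivative of p(h), so the first variation
  -- is a difference of boundary terms.
  rwa [intervalIntegral.integral_eq_sub_of_hasDeriv_right_of_le h01.le
    (sys.continuousOn_momentumAlong hT hTt hq hQ hε h01) hW hint,
    sys.momentumAlong_eq_zero hQ hε h01 (right_mem_Icc.2 h01.le) hQ.right,
    sys.momentumAlong_eq_zero hQ hε h01 (left_mem_Icc.2 h01.le) hQ.left, sub_zero] at h

end ClassicalSystem

end Eisenhart

end

noncomputable section

namespace Eisenhart

/-! ### Stationary points solve the Euler-Lagrange equation -/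

variable {d : ℕ} {S : Type*} [TopologicalSpace S]
  [ChartedSpace (EuclideanSpace ℝ (Fin d)) S] [IsManifold (𝓡 d) 2 S] {T : Set ℝ}

/-- The variation of `q` which in the chart around `x₀` is `q + r η w`, for a function `η` supported
in `(a, b)`. -/
def bumpVariation (q : ℝ → S) (x₀ : S) (a b : ℝ) (η : ℝ → ℝ) (w : EuclideanSpace ℝ (Fin d))
    (r t : ℝ) : S :=
  open scoped Classical in
  if t ∈ Ioo a b then
    (extChartAt (𝓡 d) x₀).symm (chartCurve (𝓡 d) q x₀ t + (r * η t) • w)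
  else q t

section Bump

variable {q : ℝ → S} {x₀ : S} {a b t₀ t₁ : ℝ} {η : ℝ → ℝ} {w : EuclideanSpace ℝ (Fin d)}

/-- Both branches of the definition agree wherever the perturbation vanishes. This covers r = 0 and
all t outside the support of η, so nothing happens at the cuts a and b. -/
theorem bumpVariation_of_eq_zero (hab : ∀ t ∈ Icc a b, q t ∈ (extChartAt (𝓡 d) x₀).source)
    {r t : ℝ} (h : r * η t = 0) : bumpVariation q x₀ a b η w r t = q t := by
  unfold bumpVariation
  split_ifs with ht
  · rw [h, zero_smul, add_zero]
    exact (extChartAt (𝓡 d) x₀).left_inv (hab t (Ioo_subset_Icc_self ht))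
  · rfl

/-- The chart target is open and [a, b] is compact, so one bound on r keeps the whole perturbed arc
in the chart. -/
theorem exists_forall_mem_target (hq : ContMDiffOn 𝓘(ℝ, ℝ) (𝓡 d) 2 q (Icc t₀ t₁))
    (hsub : Icc a b ⊆ Ioo t₀ t₁) (hab : ∀ t ∈ Icc a b, q t ∈ (extChartAt (𝓡 d) x₀).source)
    (hη : Continuous η) (w : EuclideanSpace ℝ (Fin d)) :
    ∃ ε > 0, ∀ r ∈ Ioo (-ε) ε, ∀ t ∈ Icc a b,
      chartCurve (𝓡 d) q x₀ t + (r * η t) • w ∈ (extChartAt (𝓡 d) x₀).target := by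
  have key : ∀ᶠ r in 𝓝 (0 : ℝ), ∀ t ∈ Icc a b,
      chartCurve (𝓡 d) q x₀ t + (r * η t) • w ∈ (extChartAt (𝓡 d) x₀).target := by
    refine isCompact_Icc.eventually_forall_of_forall_eventually fun t ht => ?_
    have hc : ContinuousAt (chartCurve (𝓡 d) q x₀) t :=
      (contDiffWithinAt_chartCurve (hq t (Ioo_subset_Icc_self (hsub ht))) (hab t ht)
        ).continuousWithinAt.continuousAt (Icc_mem_nhds (hsub ht).1 (hsub ht).2)
    have hc2 : ContinuousAt (fun p : ℝ × ℝ => chartCurve (𝓡 d) q x₀ p.2 + (p.1 * η p.2) • w)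
        (0, t) := by
      refine ContinuousAt.add (ContinuousAt.comp (g := chartCurve (𝓡 d) q x₀) hc continuousAt_snd) ?_
      exact Continuous.continuousAt (by fun_prop)
    refine hc2.eventually ((isOpen_extChartAt_target x₀).mem_nhds ?_)
    simpa [chartCurve] using (extChartAt (𝓡 d) x₀).map_source (hab t ht)
  obtain ⟨ε, hε, h⟩ := Metric.eventually_nhds_iff.1 key
  refine ⟨ε, hε, fun r hr => h ?_⟩
  rw [Real.dist_eq, sub_zero, abs_lt]
  exact hr

/-- The interval (a, b) and the complement of the support of η are open and cover the line; the
variation is a chart expression on the first and equals q on the second. It is therefore jointly C²,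
which yields the condition on mixed derivatives. -/
theorem isVariation_bumpVariation (hq : ContMDiffOn 𝓘(ℝ, ℝ) (𝓡 d) 2 q (Icc t₀ t₁))
    (h01 : t₀ < t₁)
    (hsub : Icc a b ⊆ Ioo t₀ t₁) (hab : ∀ t ∈ Icc a b, q t ∈ (extChartAt (𝓡 d) x₀).source)
    (hη : ContDiff ℝ 2 η) (hsupp : tsupport η ⊆ Ioo a b) {ε : ℝ}
    (hε : ∀ r ∈ Ioo (-ε) ε, ∀ t ∈ Icc a b,
      chartCurve (𝓡 d) q x₀ t + (r * η t) • w ∈ (extChartAt (𝓡 d) x₀).target) :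
    IsVariation (d := d) q t₀ t₁ ε (bumpVariation q x₀ a b η w) := by
  have hout : ∀ t ∉ tsupport η, ∀ r, bumpVariation q x₀ a b η w r t = q t := fun t ht r =>
    bumpVariation_of_eq_zero hab (by rw [image_eq_zero_of_notMem_tsupport ht, mul_zero])
  have hend : ∀ t ∉ Ioo t₀ t₁, ∀ r, bumpVariation q x₀ a b η w r t = q t := fun t ht r =>
    hout t (fun h => ht (hsub (Ioo_subset_Icc_self (hsupp h)))) r
  have hC2 : ContMDiffOn 𝓘(ℝ, ℝ × ℝ) (𝓡 d) 2
      (fun p : ℝ × ℝ => bumpVariation q x₀ a b η w p.1 p.2) (Ioo (-ε) ε ×ˢ Icc t₀ t₁) := by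
    rintro ⟨r, t⟩ ⟨hr, ht⟩
    by_cases hm : t ∈ Ioo a b
    · have hm' := Ioo_subset_Icc_self hm
      have hc : ContDiffAt ℝ 2 (chartCurve (𝓡 d) q x₀) t :=
        (contDiffWithinAt_chartCurve (hq t ht) (hab t hm')).contDiffAt
          (Icc_mem_nhds (hsub hm').1 (hsub hm').2)
      have h1 : ContDiffAt ℝ 2 (fun p : ℝ × ℝ => chartCurve (𝓡 d) q x₀ p.2 + (p.1 * η p.2) • w)
          (r, t) := by
        refine ContDiffAt.add (ContDiffAt.comp (g := chartCurve (𝓡 d) q x₀) (r, t) hc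
          contDiffAt_snd) ?_
        exact ContDiff.contDiffAt ((contDiff_fst.mul (hη.comp contDiff_snd)).smul contDiff_const)
      have h2 := (contMDiffOn_extChartAt_symm (I := 𝓡 d) (n := 2) x₀ _ (hε r hr t hm')).contMDiffAt
        ((isOpen_extChartAt_target x₀).mem_nhds (hε r hr t hm'))
      have h3 := ContMDiffAt.comp (g := (extChartAt (𝓡 d) x₀).symm)
        (f := fun p : ℝ × ℝ => chartCurve (𝓡 d) q x₀ p.2 + (p.1 * η p.2) • w) (r, t) h2
        h1.contMDiffAt
      refine (h3.congr_of_eventuallyEq ?_).contMDiffWithinAt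
      have : ∀ᶠ p : ℝ × ℝ in 𝓝 (r, t), p.2 ∈ Ioo a b :=
        continuousAt_snd.eventually (isOpen_Ioo.mem_nhds hm)
      filter_upwards [this] with p hp
      simp only [bumpVariation, if_pos hp, Function.comp]
    · have hm' : t ∉ tsupport η := fun h => hm (hsupp h)
      have h1 : ContMDiffWithinAt 𝓘(ℝ, ℝ × ℝ) (𝓡 d) 2 (fun p : ℝ × ℝ => q p.2)
          (Ioo (-ε) ε ×ˢ Icc t₀ t₁) (r, t) :=
        ContMDiffWithinAt.comp (g := q) (f := fun p : ℝ × ℝ => p.2) (t := Icc t₀ t₁) (r, t)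
          (hq t ht) contDiff_snd.contMDiff.contMDiffAt.contMDiffWithinAt (fun p hp => hp.2)
      refine h1.congr_of_eventuallyEq ?_ (hout t hm' r)
      have : ∀ᶠ p : ℝ × ℝ in 𝓝 (r, t), p.2 ∈ (tsupport η)ᶜ :=
        continuousAt_snd.eventually ((isClosed_tsupport η).isOpen_compl.mem_nhds hm')
      filter_upwards [nhdsWithin_le_nhds this] with p hp using hout p.2 hp p.1
  refine ⟨fun t _ => bumpVariation_of_eq_zero hab (zero_mul _), fun r _ => hend _ (by simp) _,
    fun r _ => hend _ (by simp) _, hC2.of_le (by norm_num), fun x₁ r hr t ht hs => ?_⟩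
  exact mixed_of_contDiffWithinAt (p := (r, t)) isOpen_Ioo (uniqueDiffOn_Icc h01) ⟨hr, ht⟩
    (contDiffWithinAt_chartMap le_rfl (hC2 (r, t) ⟨hr, ht⟩) hs)

theorem deriv_chartCurve_bumpVariation {t : ℝ} (ht : t ∈ Ioo a b) {ε : ℝ} (hε0 : 0 < ε)
    (hε : ∀ r ∈ Ioo (-ε) ε, ∀ t ∈ Icc a b,
      chartCurve (𝓡 d) q x₀ t + (r * η t) • w ∈ (extChartAt (𝓡 d) x₀).target) :
    deriv (fun r => chartCurve (𝓡 d) (bumpVariation q x₀ a b η w r) x₀ t) 0 = η t • w := by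
  have h1 : HasDerivAt (fun r : ℝ => chartCurve (𝓡 d) q x₀ t + (r * η t) • w) (η t • w) 0 := by
    simpa using (((hasDerivAt_id (0 : ℝ)).mul_const (η t)).smul_const w).const_add
      (chartCurve (𝓡 d) q x₀ t)
  refine (h1.congr_of_eventuallyEq ?_).deriv
  filter_upwards [Ioo_mem_nhds (neg_lt_zero.2 hε0) hε0] with r hr
  simp only [chartCurve, bumpVariation, if_pos ht]
  exact (extChartAt (𝓡 d) x₀).right_inv (hε r hr t (Ioo_subset_Icc_self ht))

end Bump

namespace ClassicalSystem

variable (sys : ClassicalSystem d S T) {q : ℝ → S} {t₀ t₁ : ℝ}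

/-- Holds because q is C² and the coefficients are C¹. It serves to pass from almost every time to
every interior time, and from there to the end points. -/
theorem continuousWithinAt_chartEL (hT : IsOpen T) {J : Set ℝ} (hJT : J ⊆ T)
    (hJ : UniqueDiffOn ℝ J) {x₀ : S} {t : ℝ} (ht : t ∈ J)
    (hq : ContMDiffWithinAt 𝓘(ℝ, ℝ) (𝓡 d) 2 q J t) (hs : q t ∈ (extChartAt (𝓡 d) x₀).source)
    (w : EuclideanSpace ℝ (Fin d)) :
    ContinuousWithinAt (fun t => sys.chartEL q J x₀ t w) J t := by
  have hc := contDiffWithinAt_chartCurve hq hs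
  have hv := contDiffWithinAt_derivWithin (m := 1) hc hJ ht (by norm_num)
  have ha := contDiffWithinAt_derivWithin (m := 0) hv hJ ht (by norm_num)
  have hΩ : IsOpen (T ×ˢ (extChartAt (𝓡 d) x₀).target) := hT.prod (isOpen_extChartAt_target x₀)
  have hm : (t, chartCurve (𝓡 d) q x₀ t) ∈ T ×ˢ (extChartAt (𝓡 d) x₀).target :=
    ⟨hJT ht, (extChartAt (𝓡 d) x₀).map_source hs⟩
  have hcF : ContinuousWithinAt (fun t => (t, chartCurve (𝓡 d) q x₀ t)) J t :=
    continuousWithinAt_id.prodMk hc.continuousWithinAt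
  have aux {F : Type} [NormedAddCommGroup F] [NormedSpace ℝ F]
      {f : ℝ × EuclideanSpace ℝ (Fin d) → F}
      (hf : ContDiffOn ℝ 1 f (T ×ˢ (extChartAt (𝓡 d) x₀).target)) :
      ContinuousWithinAt (fun t => f (t, chartCurve (𝓡 d) q x₀ t)) J t ∧
      ContinuousWithinAt (fun t => fderiv ℝ f (t, chartCurve (𝓡 d) q x₀ t)) J t :=
    ⟨ContinuousAt.comp_continuousWithinAt (f := fun t => (t, chartCurve (𝓡 d) q x₀ t))
        (hf.continuousOn.continuousAt (hΩ.mem_nhds hm)) hcF,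
      ContinuousAt.comp_continuousWithinAt (f := fun t => (t, chartCurve (𝓡 d) q x₀ t))
        ((hf.continuousOn_fderiv_of_isOpen hΩ le_rfl).continuousAt (hΩ.mem_nhds hm)) hcF⟩
  obtain ⟨hA, hA'⟩ := aux (sys.contDiffOn_locA x₀)
  obtain ⟨-, hB'⟩ := aux (sys.contDiffOn_locB x₀)
  obtain ⟨-, hU'⟩ := aux (contDiffOn_locF sys.contMDiffOn_U x₀)
  have hvc := hv.continuousWithinAt
  have h1v : ContinuousWithinAt (fun t => ((1 : ℝ), derivWithin (chartCurve (𝓡 d) q x₀) J t)) J t :=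
    continuousWithinAt_const.prodMk hvc
  exact ((((hA'.clm_apply h1v).clm_apply hvc).add (hA.clm_apply ha.continuousWithinAt)).add
    (hB'.clm_apply h1v)).clm_apply continuousWithinAt_const |>.sub
    ((((((hA'.clm_apply continuousWithinAt_const).clm_apply hvc).clm_apply hvc).const_smul
      (1 / 2 : ℝ)).add ((hB'.clm_apply continuousWithinAt_const).clm_apply hvc)).sub
      (hU'.clm_apply continuousWithinAt_const))

/-- The weak form of the Euler-Lagrange equation. -/
theorem integral_smul_chartEL (hT : IsOpen T) (hTt : Icc t₀ t₁ ⊆ T) (h01 : t₀ < t₁)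
    (hst : sys.IsStationary q t₀ t₁) {x₀ : S} {a b : ℝ} (hsub : Icc a b ⊆ Ioo t₀ t₁)
    (hab : ∀ t ∈ Icc a b, q t ∈ (extChartAt (𝓡 d) x₀).source)
    {η : ℝ → ℝ} (hη : ContDiff ℝ 2 η) (hsupp : tsupport η ⊆ Ioo a b)
    (w : EuclideanSpace ℝ (Fin d)) :
    ∫ t, η t • sys.chartEL q (Icc t₀ t₁) x₀ t w = 0 := by
  obtain ⟨hq, hst⟩ := hst
  obtain ⟨ε, hε0, hε⟩ := exists_forall_mem_target hq hsub hab hη.continuous w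
  have hQ := isVariation_bumpVariation hq h01 hsub hab hη hsupp hε
  set Q := bumpVariation q x₀ a b η w with hQdef
  have h1 := (sys.hasDerivAt_action hT hTt hQ h01 hε0).unique (hst ε Q hε0 hQ)
  -- One formula on the whole interval, although the chart around x₀ need not contain q t outside
  -- (a, b). There η = 0, and the chart centred at q t shows that the Euler-Lagrange term is absent.
  have hW : ∀ t ∈ Ioo t₀ t₁, HasDerivAt (sys.momentumAlong Q t₀ t₁)
      (deriv (fun r => sys.lagrangianAlong Q t₀ t₁ r t) 0 +
        η t • sys.chartEL q (Icc t₀ t₁) x₀ t w) t := by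
    intro t ht
    by_cases hm : t ∈ Ioo a b
    · have h := sys.hasDerivAt_momentumAlong hT hTt hq hQ hε0 h01 ht (hab t (Ioo_subset_Icc_self hm))
      rw [deriv_chartCurve_bumpVariation hm hε0 hε] at h
      refine h.congr_deriv ?_
      -- `lagrangianForce` is linear in its last argument, but is not bundled as a linear map.
      have hf : lagrangianForce (sys.locA x₀) (sys.locB x₀) (locF sys.U x₀)
          (t, chartCurve (𝓡 d) q x₀ t) (derivWithin (chartCurve (𝓡 d) q x₀) (Icc t₀ t₁) t)
          (η t • w) = η t * lagrangianForce (sys.locA x₀) (sys.locB x₀) (locF sys.U x₀)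
          (t, chartCurve (𝓡 d) q x₀ t) (derivWithin (chartCurve (𝓡 d) q x₀) (Icc t₀ t₁) t) w := by
        have : ((0, η t • w) : ℝ × EuclideanSpace ℝ (Fin d)) = η t • (0, w) := by simp
        simp only [lagrangianForce, this, map_smul, smul_apply, smul_eq_mul]
        ring
      rw [chartEL, chartEL, elExpr, elExpr, hf, map_smul, smul_eq_mul, smul_eq_mul]
      ring
    · have h := sys.hasDerivAt_momentumAlong hT hTt hq hQ hε0 h01 ht (mem_extChartAt_source (q t))
      have hη0 : η t = 0 := image_eq_zero_of_notMem_tsupport fun h => hm (hsupp h)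
      have hQt : ∀ r, Q r t = q t := fun r => bumpVariation_of_eq_zero hab (by rw [hη0, mul_zero])
      have h0 : ((0 : ℝ), (0 : EuclideanSpace ℝ (Fin d))) = 0 := rfl
      simpa [chartCurve, hQt, hη0, chartEL, elExpr, lagrangianForce, h0] using h
  have hcont : ContinuousOn (fun t => η t • sys.chartEL q (Icc t₀ t₁) x₀ t w) (Icc t₀ t₁) := by
    intro t ht
    by_cases hm : t ∈ tsupport η
    · exact hη.continuous.continuousWithinAt.smul (sys.continuousWithinAt_chartEL hT hTt
        (uniqueDiffOn_Icc h01) ht (hq t ht) (hab t (Ioo_subset_Icc_self (hsupp hm))) w)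
    · refine (continuousWithinAt_const (b := (0 : ℝ))).congr_of_eventuallyEq ?_
        (by simp [image_eq_zero_of_notMem_tsupport hm])
      filter_upwards [nhdsWithin_le_nhds ((isClosed_tsupport η).isOpen_compl.mem_nhds hm)]
        with s hs
      simp [image_eq_zero_of_notMem_tsupport hs]
  have hint := sys.intervalIntegrable_deriv_lagrangianAlong hT hTt hQ h01 hε0
  have hint2 := hcont.intervalIntegrable_of_Icc (μ := volume) h01.le
  have h2 := intervalIntegral.integral_eq_sub_of_hasDeriv_right_of_le h01.le
    (sys.continuousOn_momentumAlong hT hTt hq hQ hε0 h01) (fun t ht => (hW t ht).hasDerivWithinAt)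
    (hint.add hint2)
  rw [intervalIntegral.integral_add hint hint2, h1, zero_add,
    sys.momentumAlong_eq_zero hQ hε0 h01 (right_mem_Icc.2 h01.le) hQ.right,
    sys.momentumAlong_eq_zero hQ hε0 h01 (left_mem_Icc.2 h01.le) hQ.left, sub_zero] at h2
  rw [← h2]
  refine (intervalIntegral.integral_eq_integral_of_support_subset fun t ht => ?_).symm
  have ht2 : t ∈ Function.support η := fun h => ht (by simp [h])
  exact Ioo_subset_Ioc_self (hsub (Ioo_subset_Icc_self (hsupp (subset_tsupport η ht2))))

/-- A `C²` stationary point of the action solves the Euler-Lagrange equation. -/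
theorem IsStationary.isEL (hT : IsOpen T) (hTt : Icc t₀ t₁ ⊆ T) (h01 : t₀ < t₁)
    (hst : sys.IsStationary q t₀ t₁) : sys.IsEL q (Icc t₀ t₁) := by
  have hq := hst.1
  have hint : ∀ x₀ : S, ∀ t ∈ Ioo t₀ t₁, q t ∈ (extChartAt (𝓡 d) x₀).source →
      ∀ w, sys.chartEL q (Icc t₀ t₁) x₀ t w = 0 := by
    intro x₀ t ht hs w
    have hev := eventually_mem_source (hq.continuousOn t (Ioo_subset_Icc_self ht)) hs
    rw [nhdsWithin_eq_nhds.2 (Icc_mem_nhds ht.1 ht.2)] at hev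
    obtain ⟨⟨a, b⟩, hab, hsub⟩ := (nhds_basis_Ioo t).mem_iff.1
      (hev.and (isOpen_Ioo.mem_nhds ht))
    -- The bump construction needs a closed interval inside the region, so (a, b) is shrunk on both
    -- sides of t.
    obtain ⟨a', ha', ha''⟩ := exists_between hab.1
    obtain ⟨b', hb', hb''⟩ := exists_between hab.2
    have hsub' : Icc a' b' ⊆ Ioo a b := Icc_subset_Ioo ha' hb''
    have hcont : ContinuousOn (fun t => sys.chartEL q (Icc t₀ t₁) x₀ t w) (Ioo a' b') := by
      intro s hs'
      have h1 := hsub (hsub' (Ioo_subset_Icc_self hs'))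
      exact ((sys.continuousWithinAt_chartEL hT hTt (uniqueDiffOn_Icc h01)
        (Ioo_subset_Icc_self h1.2) (hq s (Ioo_subset_Icc_self h1.2)) h1.1 w).continuousAt
        (Icc_mem_nhds h1.2.1 h1.2.2)).continuousWithinAt
    -- The fundamental lemma gives vanishing almost everywhere; continuity then gives it everywhere
    -- on (a', b').
    have hae := isOpen_Ioo.ae_eq_zero_of_integral_contDiff_smul_eq_zero (μ := volume)
      (hcont.locallyIntegrableOn measurableSet_Ioo) fun g hg _ hg2 =>
      sys.integral_smul_chartEL hT hTt h01 hst (fun s hs => (hsub (hsub' hs)).2)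
        (fun s hs => (hsub (hsub' hs)).1) (hg.of_le (WithTop.coe_le_coe.2 (le_top (a := (2 : ℕ∞))))) hg2 w
    have := Measure.eqOn_Ioo_of_ae_eq volume (g := fun _ => (0 : ℝ))
      ((ae_restrict_iff' measurableSet_Ioo).2 hae) hcont continuousOn_const
    exact this ⟨ha'', hb'⟩
  intro x₀ t ht hs w
  have hc := sys.continuousWithinAt_chartEL hT hTt (uniqueDiffOn_Icc h01) ht (hq t ht) hs w
  -- Bumps do not reach the end points, where the equation follows as a limit from the interior.
  have hne : (𝓝[Ioo t₀ t₁] t).NeBot := by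
    rw [← mem_closure_iff_nhdsWithin_neBot, closure_Ioo h01.ne]; exact ht
  have h1 := hc.tendsto.mono_left (nhdsWithin_mono t Ioo_subset_Icc_self)
  refine tendsto_nhds_unique h1 (tendsto_const_nhds.congr' ?_)
  filter_upwards [nhdsWithin_mono t Ioo_subset_Icc_self
    (eventually_mem_source (hq.continuousOn t ht) hs), eventually_mem_nhdsWithin] with s hs1 hs2
  exact (hint x₀ s hs2 hs1 w).symm

end ClassicalSystem

end Eisenhart

end

noncomputable section

namespace Eisenhart

/-! ### Inverses and higher regularity of functions of one variable -/

section OneVariable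

variable {f g θ σ : ℝ → ℝ} {J : Set ℝ} {a b : ℝ}

/-- By Rolle's theorem a nonvanishing derivative forces injectivity, whatever its sign, so both time
orientations are covered. The inverse is continuous by compactness, and its one-sided derivatives at
the ends are included. -/
theorem exists_inverse (hθ : ∀ l ∈ Icc a b, HasDerivWithinAt θ (f l) (Icc a b) l)
    (hf : ∀ l ∈ Icc a b, f l ≠ 0) :
    InjOn θ (Icc a b) ∧ ∃ σ : ℝ → ℝ, (∀ l ∈ Icc a b, σ (θ l) = l) ∧
      ∀ t ∈ θ '' Icc a b, σ t ∈ Icc a b ∧ θ (σ t) = t ∧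
        HasDerivWithinAt σ (f (σ t))⁻¹ (θ '' Icc a b) t := by
  have hcont : ContinuousOn θ (Icc a b) := fun l hl => (hθ l hl).continuousWithinAt
  have hlt : ∀ l ∈ Icc a b, ∀ l' ∈ Icc a b, l < l' → θ l ≠ θ l' := by
    intro l hl l' hl' hll' heq
    have hsub : Icc l l' ⊆ Icc a b := Icc_subset_Icc hl.1 hl'.2
    obtain ⟨c, hc, hc0⟩ := exists_hasDerivAt_eq_zero hll' (hcont.mono hsub) heq fun x hx =>
      (hθ x (hsub (Ioo_subset_Icc_self hx))).hasDerivAt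
        (Icc_mem_nhds (hl.1.trans_lt hx.1) (hx.2.trans_le hl'.2))
    exact hf c (hsub (Ioo_subset_Icc_self hc)) hc0
  have hinj : InjOn θ (Icc a b) := by
    intro l hl l' hl' heq
    rcases lt_trichotomy l l' with h | h | h
    · exact absurd heq (hlt l hl l' hl' h)
    · exact h
    · exact absurd heq.symm (hlt l' hl' l hl h)
  refine ⟨hinj, Function.invFunOn θ (Icc a b), fun l hl => hinj.leftInvOn_invFunOn hl, ?_⟩
  set σ := Function.invFunOn θ (Icc a b) with hσ
  have hmem : ∀ t ∈ θ '' Icc a b, σ t ∈ Icc a b := fun t ht => Function.invFunOn_mem ht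
  have hright : ∀ t ∈ θ '' Icc a b, θ (σ t) = t := fun t ht => Function.invFunOn_eq ht
  have hσc : ContinuousOn σ (θ '' Icc a b) := by
    -- A continuous injection of a compact set is closed, since closed subsets have compact images;
    -- hence preimages under σ are relatively closed.
    rw [continuousOn_iff_isClosed]
    intro C hC
    refine ⟨θ '' (C ∩ Icc a b), ((isCompact_Icc.inter_left hC).image_of_continuousOn
      (hcont.mono inter_subset_right)).isClosed, ?_⟩
    ext t
    constructor
    · rintro ⟨h1, h2⟩
      exact ⟨⟨σ t, ⟨h1, hmem t h2⟩, hright t h2⟩, h2⟩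
    · rintro ⟨⟨l, ⟨hl1, hl2⟩, rfl⟩, h2⟩
      refine ⟨?_, h2⟩
      have e : σ (θ l) = l := hinj.leftInvOn_invFunOn hl2
      rwa [mem_preimage, e]
  intro t ht
  refine ⟨hmem t ht, hright t ht, ?_⟩
  have hne := hf _ (hmem t ht)
  have h1 : HasFDerivWithinAt θ
      ((ContinuousLinearEquiv.unitsEquivAut ℝ (Units.mk0 _ hne) : ℝ ≃L[ℝ] ℝ) : ℝ →L[ℝ] ℝ)
      (Icc a b) (σ t) := by
    refine (hθ _ (hmem t ht)).hasFDerivWithinAt.congr_fderiv ?_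
    ext; simp
  have h2 := HasFDerivWithinAt.of_local_left_inverse
    ((hσc t ht).tendsto_nhdsWithin hmem) h1 ht
    (eventually_mem_nhdsWithin.mono fun t ht => hright t ht)
  exact h2.hasDerivWithinAt.congr_deriv (by simp)

theorem contDiffOn_succ_of_hasDerivWithinAt {n : ℕ} (hJ : UniqueDiffOn ℝ J)
    (hσ : ∀ t ∈ J, HasDerivWithinAt σ (g t) J t) (hg : ContDiffOn ℝ n g J) :
    ContDiffOn ℝ (n + 1) σ J := by
  rw [contDiffOn_succ_iff_derivWithin hJ]
  refine ⟨fun t ht => (hσ t ht).differentiableWithinAt, fun h => ?_, hg.congr fun t ht =>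
    (hσ t ht).derivWithin (hJ t ht)⟩
  simp at h

/-- Regularity of a solution of `σ' = 1 / f(σ)`. -/
theorem contDiffOn_two_of_hasDerivWithinAt_inv {K : Set ℝ} (hJ : UniqueDiffOn ℝ J)
    (hσ : ∀ t ∈ J, HasDerivWithinAt σ (f (σ t))⁻¹ J t) (hm : MapsTo σ J K)
    (hf : ContDiffOn ℝ 1 f K) (hf0 : ∀ l ∈ K, f l ≠ 0) : ContDiffOn ℝ 2 σ J := by
  -- Bootstrap: each degree of regularity of σ passes to 1 / f(σ) = σ', up to the C¹ regularity of
  -- f, and so raises that of σ by one.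
  have h0 : ContinuousOn σ J := fun t ht => (hσ t ht).continuousWithinAt
  have h1 : ContDiffOn ℝ 1 σ J := by
    have := contDiffOn_succ_of_hasDerivWithinAt (n := 0) hJ hσ
      (contDiffOn_zero.2 ((hf.continuousOn.comp h0 hm).inv₀ fun t ht => hf0 _ (hm ht)))
    simpa using this
  have := contDiffOn_succ_of_hasDerivWithinAt (n := 1) hJ hσ
    ((hf.comp h1 hm).inv fun t ht => hf0 _ (hm ht))
  norm_num at this
  exact this

end OneVariable

/-! ### The Eisenhart metric -/

variable {d : ℕ} {S : Type*} [TopologicalSpace S]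
  [ChartedSpace (EuclideanSpace ℝ (Fin d)) S] [IsManifold (𝓡 d) 2 S] {T : Set ℝ}

namespace ClassicalSystem

variable (sys : ClassicalSystem d S T) {μ : ℝ≥0∞} {ψ : ℝ → S → ℝ}

theorem isLorentzian_metric (hψ_pos : ∀ t ∈ T, ∀ q : S, 0 < ψ t q) {m : ℝ × S × ℝ}
    (hm : m.1 ∈ T) : IsLorentzian (sys.metric μ ψ m) :=
  isLorentzian_eisenhartForm (sys.a_symm m.1 hm m.2.1) (sys.a_pos m.1 hm m.2.1) _ _
    (hψ_pos m.1 hm m.2.1) _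

end ClassicalSystem

theorem extChartAt_modelM (x₀ x : ℝ × S × ℝ) :
    extChartAt (modelM d) x₀ x = (x.1, extChartAt (𝓡 d) x₀.2.1 x.2.1, x.2.2) :=
  rfl

theorem mem_extChartAt_modelM_source (x₀ x : ℝ × S × ℝ) :
    x ∈ (extChartAt (modelM d) x₀).source ↔ x.2.1 ∈ (extChartAt (𝓡 d) x₀.2.1).source := by
  simp only [extChartAt_source, prodChartedSpace_chartAt, OpenPartialHomeomorph.prod_source,
    chartAt_self_eq, OpenPartialHomeomorph.refl_source, mem_prod, mem_univ, true_and, and_true]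

theorem symmDeriv_modelM (x₀ : ℝ × S × ℝ) {z : modelE d}
    (hz : z.2.1 ∈ (extChartAt (𝓡 d) x₀.2.1).target) (u : modelE d) :
    symmDeriv (modelM d) x₀ z u = ((u.1, symmDeriv (𝓡 d) x₀.2.1 z.2.1 u.2.1, u.2.2) : modelE d) := by
  have : IsManifold (𝓡 d) 1 S := .of_le (n := 2) (by norm_num)
  have h1 := (mdifferentiableAt_extChartAt_symm (I := 𝓡 d) hz).hasMFDerivAt
  have h2 : HasMFDerivAt 𝓘(ℝ, modelE d) 𝓘(ℝ, ℝ) (fun z : modelE d => z.1) z (dt d) :=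
    (dt d).hasFDerivAt.hasMFDerivAt
  have h3 : HasMFDerivAt 𝓘(ℝ, modelE d) 𝓘(ℝ, ℝ) (fun z : modelE d => z.2.2) z (dy d) :=
    (dy d).hasFDerivAt.hasMFDerivAt
  have h4 : HasMFDerivAt 𝓘(ℝ, modelE d) 𝓘(ℝ, EuclideanSpace ℝ (Fin d))
      (fun z : modelE d => z.2.1) z (dq d) := (dq d).hasFDerivAt.hasMFDerivAt
  have h5 := h2.prodMk ((HasMFDerivAt.comp (f := fun z : modelE d => z.2.1) z h1 h4).prodMk h3)
  have h6 : symmDeriv (modelM d) x₀ z = _ := h5.mfderiv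
  rw [h6]
  rfl

end Eisenhart

end

noncomputable section

namespace Eisenhart

/-! ### Geodesics of the Eisenhart metric -/

variable {d : ℕ} {S : Type*} [TopologicalSpace S]
  [ChartedSpace (EuclideanSpace ℝ (Fin d)) S] [IsManifold (𝓡 d) 2 S] {T : Set ℝ}

namespace ClassicalSystem

variable (sys : ClassicalSystem d S T) (μ : ℝ≥0∞) (ψ : ℝ → S → ℝ)

/-- The Eisenhart metric in the chart of `S` around `q₀`. -/
def locMetric (q₀ : S) (z : modelE d) : modelE d →L[ℝ] modelE d →L[ℝ] ℝ :=
  coordMetric (sys.locA q₀) (sys.locB q₀) (locF sys.U q₀) (locF ψ q₀) (recip μ) z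

theorem chartMetric_eq (x₀ : ℝ × S × ℝ) {z : modelE d}
    (hz : z.2.1 ∈ (extChartAt (𝓡 d) x₀.2.1).target) (u w : modelE d) :
    chartMetric (modelM d) (sys.metric μ ψ) x₀ z u w = sys.locMetric μ ψ x₀.2.1 z u w := by
  -- Holds by definition, all tangent spaces being the model space; only the derivative of the
  -- inverse product chart remains to be computed.
  have h : chartMetric (modelM d) (sys.metric μ ψ) x₀ z u w =
      eisenhartForm (sys.a z.1 ((extChartAt (𝓡 d) x₀.2.1).symm z.2.1))
        (sys.b z.1 ((extChartAt (𝓡 d) x₀.2.1).symm z.2.1))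
        (sys.U z.1 ((extChartAt (𝓡 d) x₀.2.1).symm z.2.1))
        (ψ z.1 ((extChartAt (𝓡 d) x₀.2.1).symm z.2.1)) (recip μ)
        (symmDeriv (modelM d) x₀ z u) (symmDeriv (modelM d) x₀ z w) := rfl
  rw [h, symmDeriv_modelM x₀ hz, symmDeriv_modelM x₀ hz]
  refine (eisenhartForm_apply ..).trans ?_
  rw [locMetric, coordMetric_apply]
  rfl

theorem metric_chart {q₀ : S} {x : ℝ × S × ℝ} (hx : x.2.1 ∈ (extChartAt (𝓡 d) q₀).source)
    (u w : modelE d) :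
    eisenhartForm (sys.a x.1 x.2.1) (sys.b x.1 x.2.1) (sys.U x.1 x.2.1) (ψ x.1 x.2.1) (recip μ)
      (u.1, symmDeriv (𝓡 d) q₀ (extChartAt (𝓡 d) q₀ x.2.1) u.2.1, u.2.2)
      (w.1, symmDeriv (𝓡 d) q₀ (extChartAt (𝓡 d) q₀ x.2.1) w.2.1, w.2.2) =
    sys.locMetric μ ψ q₀ (x.1, extChartAt (𝓡 d) q₀ x.2.1, x.2.2) u w := by
  refine (eisenhartForm_apply ..).trans ?_
  rw [locMetric, coordMetric_apply]
  simp only [locF, (extChartAt (𝓡 d) q₀).left_inv hx, sys.locA_chart _ hx, sys.locB_chart _ hx]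
  rfl

variable {sys μ ψ}

/-- For equal arguments the first two terms of the Christoffel symbol coincide: Γ(v, v; w) = ∂_v
g(v, w) - ½ ∂_w g(v, v). This is the shape of the left side in `geodesicExpr_eq`. -/
theorem geodesicExpr_chart (hT : IsOpen T)
    (hψ : ContMDiffOn (𝓘(ℝ, ℝ).prod (𝓡 d)) 𝓘(ℝ, ℝ) 1 (fun p : ℝ × S => ψ p.1 p.2) (T ×ˢ univ))
    (x₀ : ℝ × S × ℝ) {z : modelE d} (hz1 : z.1 ∈ T)
    (hz : z.2.1 ∈ (extChartAt (𝓡 d) x₀.2.1).target) (a v w : modelE d) :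
    chartMetric (modelM d) (sys.metric μ ψ) x₀ z a w
      + christoffel (modelM d) (sys.metric μ ψ) x₀ z v v w =
    sys.locMetric μ ψ x₀.2.1 z a w + fderiv ℝ (sys.locMetric μ ψ x₀.2.1) z v v w
      - (1 / 2) * fderiv ℝ (sys.locMetric μ ψ x₀.2.1) z w v v := by
  have hΩ : IsOpen (T ×ˢ (extChartAt (𝓡 d) x₀.2.1).target) :=
    hT.prod (isOpen_extChartAt_target x₀.2.1)
  have hn' : projTZ d ⁻¹' (T ×ˢ (extChartAt (𝓡 d) x₀.2.1).target) ∈ 𝓝 z :=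
    (hΩ.preimage (projTZ d).continuous).mem_nhds ⟨hz1, hz⟩
  have hG := ((contDiffOn_coordMetric (recip μ) (sys.contDiffOn_locA x₀.2.1)
    (sys.contDiffOn_locB x₀.2.1) (contDiffOn_locF sys.contMDiffOn_U x₀.2.1)
    (contDiffOn_locF hψ x₀.2.1)).contDiffAt hn').differentiableAt one_ne_zero
  have key (u u' δ : modelE d) :
      fderiv ℝ (fun z' => chartMetric (modelM d) (sys.metric μ ψ) x₀ z' u u') z δ =
        fderiv ℝ (sys.locMetric μ ψ x₀.2.1) z δ u u' := by
    have h1 : (fun z' => chartMetric (modelM d) (sys.metric μ ψ) x₀ z' u u') =ᶠ[𝓝 z]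
        fun z' => sys.locMetric μ ψ x₀.2.1 z' u u' := by
      filter_upwards [hn'] with z' hz' using sys.chartMetric_eq μ ψ x₀ hz'.2 u u'
    have h2 := (hG.hasFDerivAt.clm_apply (hasFDerivAt_const u z)).clm_apply
      (hasFDerivAt_const u' z)
    rw [h1.fderiv_eq]
    have h3 : fderiv ℝ (fun z' => sys.locMetric μ ψ x₀.2.1 z' u u') z = _ := h2.fderiv
    rw [h3]
    simp
    rfl
  rw [christoffel, key, key, sys.chartMetric_eq μ ψ x₀ hz]
  ring

theorem locF_eq {f : ℝ → S → ℝ} {q₀ q : S} (t : ℝ) (hq : q ∈ (extChartAt (𝓡 d) q₀).source) :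
    locF f q₀ (t, extChartAt (𝓡 d) q₀ q) = f t q := by
  simp only [locF, (extChartAt (𝓡 d) q₀).left_inv hq]

variable (sys μ ψ)

/-- The rate `dy/dt` of the `1/μ`-lift of `q`. -/
def liftRate (q : ℝ → S) (t₀ t₁ t : ℝ) : ℝ :=
  (1 / 2) * sys.a t (q t) (velocity (𝓡 d) q (Icc t₀ t₁) t) (velocity (𝓡 d) q (Icc t₀ t₁) t)
    + sys.b t (q t) (velocity (𝓡 d) q (Icc t₀ t₁) t) + (ψ t (q t) * recip μ ^ 2 - sys.U t (q t))

theorem liftRate_chart {q : ℝ → S} {t₀ t₁ : ℝ} (h01 : t₀ < t₁)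
    (hq : ContMDiffOn 𝓘(ℝ, ℝ) (𝓡 d) 2 q (Icc t₀ t₁)) {q₀ : S} {t : ℝ} (ht : t ∈ Icc t₀ t₁)
    (hs : q t ∈ (extChartAt (𝓡 d) q₀).source) :
    sys.liftRate μ ψ q t₀ t₁ t =
      (1 / 2) * sys.locA q₀ (t, chartCurve (𝓡 d) q q₀ t)
          (derivWithin (chartCurve (𝓡 d) q q₀) (Icc t₀ t₁) t)
          (derivWithin (chartCurve (𝓡 d) q q₀) (Icc t₀ t₁) t)
        + sys.locB q₀ (t, chartCurve (𝓡 d) q q₀ t)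
          (derivWithin (chartCurve (𝓡 d) q q₀) (Icc t₀ t₁) t)
        + (locF ψ q₀ (t, chartCurve (𝓡 d) q q₀ t) * recip μ ^ 2
          - locF sys.U q₀ (t, chartCurve (𝓡 d) q q₀ t)) := by
  -- The rate of the lift is the Lagrangian plus ψ/μ², so the chart formula of the Lagrangian can be
  -- reused.
  have h := sys.lagrangian_eq t (uniqueDiffOn_Icc h01 t ht) ht
    ((hq t ht).mdifferentiableWithinAt two_ne_zero) hs
  have h2 : locF ψ q₀ (t, chartCurve (𝓡 d) q q₀ t) = ψ t (q t) := by
    simp only [locF, chartCurve, (extChartAt (𝓡 d) q₀).left_inv hs]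
  rw [lagrangian] at h
  rw [liftRate, h2]
  linarith

/-- A C¹ rate makes the height of the lift C², as the definition of a geodesic demands. -/
theorem contDiffOn_liftRate (hT : IsOpen T)
    (hψ : ContMDiffOn (𝓘(ℝ, ℝ).prod (𝓡 d)) 𝓘(ℝ, ℝ) 1 (fun p : ℝ × S => ψ p.1 p.2) (T ×ˢ univ))
    {q : ℝ → S} {t₀ t₁ : ℝ} (hTt : Icc t₀ t₁ ⊆ T) (h01 : t₀ < t₁)
    (hq : ContMDiffOn 𝓘(ℝ, ℝ) (𝓡 d) 2 q (Icc t₀ t₁)) :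
    ContDiffOn ℝ 1 (sys.liftRate μ ψ q t₀ t₁) (Icc t₀ t₁) := by
  intro t ht
  have hs : q t ∈ (extChartAt (𝓡 d) (q t)).source := mem_extChartAt_source _
  have hc := contDiffWithinAt_chartCurve (hq t ht) hs
  have hv := contDiffWithinAt_derivWithin (m := 1) hc (uniqueDiffOn_Icc h01) ht (by norm_num)
  have hcF : ContDiffWithinAt ℝ 1 (fun s => (s, chartCurve (𝓡 d) q (q t) s)) (Icc t₀ t₁) t :=
    contDiffWithinAt_id.prodMk (hc.of_le (by norm_num))
  have hn : T ×ˢ (extChartAt (𝓡 d) (q t)).target ∈ 𝓝 (t, chartCurve (𝓡 d) q (q t) t) :=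
    (hT.prod (isOpen_extChartAt_target _)).mem_nhds
      ⟨hTt ht, (extChartAt (𝓡 d) (q t)).map_source hs⟩
  have aux {F : Type} [NormedAddCommGroup F] [NormedSpace ℝ F]
      {f : ℝ × EuclideanSpace ℝ (Fin d) → F}
      (hf : ContDiffOn ℝ 1 f (T ×ˢ (extChartAt (𝓡 d) (q t)).target)) :
      ContDiffWithinAt ℝ 1 (fun s => f (s, chartCurve (𝓡 d) q (q t) s)) (Icc t₀ t₁) t :=
    (hf.contDiffAt hn).comp_contDiffWithinAt t hcF
  have hA := aux (sys.contDiffOn_locA (q t))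
  have hB := aux (sys.contDiffOn_locB (q t))
  have hU := aux (contDiffOn_locF sys.contMDiffOn_U (q t))
  have hψ' := aux (contDiffOn_locF hψ (q t))
  refine ContDiffWithinAt.congr_of_eventuallyEq
    (((contDiffWithinAt_const (c := (1 / 2 : ℝ))).mul ((hA.clm_apply hv).clm_apply hv)).add
      (hB.clm_apply hv) |>.add ((hψ'.mul (contDiffWithinAt_const (c := recip μ ^ 2))).sub hU))
    ?_ (sys.liftRate_chart μ ψ h01 hq ht hs)
  filter_upwards [eventually_mem_source (hq.continuousOn t ht) hs, eventually_mem_nhdsWithin]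
    with s hs hs2 using sys.liftRate_chart μ ψ h01 hq hs2 hs

/-- The curve `x` is a reparametrization of `t ↦ (t, q t, Y t)`, where `Y` grows at the rate of the
`1/μ`-lift, with `ψ dt/ds = k`. -/
structure IsReparamLift (x : ℝ → ℝ × S × ℝ) (l₀ l₁ : ℝ) (q : ℝ → S) (t₀ t₁ : ℝ) (Y : ℝ → ℝ)
    (k : ℝ) : Prop where
  contMDiffOn_x : ContMDiffOn 𝓘(ℝ, ℝ) (modelM d) 2 x (Icc l₀ l₁)
  contMDiffOn_q : ContMDiffOn 𝓘(ℝ, ℝ) (𝓡 d) 2 q (Icc t₀ t₁)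
  maps : ∀ l ∈ Icc l₀ l₁, (x l).1 ∈ Icc t₀ t₁
  proj : ∀ l ∈ Icc l₀ l₁, (x l).2.1 = q (x l).1
  height : ∀ l ∈ Icc l₀ l₁, (x l).2.2 = Y (x l).1
  deriv_time : ∀ l ∈ Icc l₀ l₁,
    HasDerivWithinAt (fun l => (x l).1) (k / ψ (x l).1 (x l).2.1) (Icc l₀ l₁) l
  deriv_height : ∀ t ∈ Icc t₀ t₁,
    HasDerivWithinAt Y (sys.liftRate μ ψ q t₀ t₁ t) (Icc t₀ t₁) t

namespace IsReparamLift

variable {sys μ ψ} {x : ℝ → ℝ × S × ℝ} {l₀ l₁ t₀ t₁ k : ℝ} {q : ℝ → S} {Y : ℝ → ℝ}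

theorem derivWithin_chartCurve (h : sys.IsReparamLift μ ψ x l₀ l₁ q t₀ t₁ Y k) (hl : l₀ < l₁)
    (x₀ : ℝ × S × ℝ) {l : ℝ} (hlJ : l ∈ Icc l₀ l₁)
    (hs : (x l).2.1 ∈ (extChartAt (𝓡 d) x₀.2.1).source) :
    derivWithin (chartCurve (modelM d) x x₀) (Icc l₀ l₁) l =
      (k / locF ψ x₀.2.1 ((x l).1, extChartAt (𝓡 d) x₀.2.1 (x l).2.1)) •
        ((1, derivWithin (chartCurve (𝓡 d) q x₀.2.1) (Icc t₀ t₁) (x l).1,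
          sys.liftRate μ ψ q t₀ t₁ (x l).1) : modelE d) := by
  have ht := h.maps l hlJ
  have hsq : q (x l).1 ∈ (extChartAt (𝓡 d) x₀.2.1).source := h.proj l hlJ ▸ hs
  have hc := ((contDiffWithinAt_chartCurve (h.contMDiffOn_q _ ht) hsq).differentiableWithinAt
    two_ne_zero).hasDerivWithinAt
  have hθ := h.deriv_time l hlJ
  have h2 := (hθ.prodMk ((hc.scomp l hθ h.maps).prodMk
    ((h.deriv_height _ ht).scomp l hθ h.maps)))
  have h3 := h2.congr_of_mem (f₁ := chartCurve (modelM d) x x₀) (fun l' hl' => by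
    simp only [chartCurve, extChartAt_modelM, Function.comp, h.proj l' hl', h.height l' hl']) hlJ
  rw [h3.derivWithin (uniqueDiffOn_Icc hl l hlJ), locF_eq _ hs]
  simp [Prod.smul_mk]

/-- `geodesicExpr_eq` read in the charts of the manifolds. Both directions of the correspondence
follow from this equation, since the factor k²/ψ is nonzero when k is. -/
theorem geodesicExpr (h : sys.IsReparamLift μ ψ x l₀ l₁ q t₀ t₁ Y k) (hT : IsOpen T)
    (hTt : Icc t₀ t₁ ⊆ T)
    (hψ : ContMDiffOn (𝓘(ℝ, ℝ).prod (𝓡 d)) 𝓘(ℝ, ℝ) 1 (fun p : ℝ × S => ψ p.1 p.2) (T ×ˢ univ))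
    (hψ_pos : ∀ t ∈ T, ∀ q : S, 0 < ψ t q) (hl : l₀ < l₁)
    (h01 : t₀ < t₁) (x₀ : ℝ × S × ℝ) {l : ℝ} (hlJ : l ∈ Icc l₀ l₁)
    (hs : x l ∈ (extChartAt (modelM d) x₀).source) (w : modelE d) :
    chartMetric (modelM d) (sys.metric μ ψ) x₀ (chartCurve (modelM d) x x₀ l)
        (derivWithin (derivWithin (chartCurve (modelM d) x x₀) (Icc l₀ l₁)) (Icc l₀ l₁) l) w
      + christoffel (modelM d) (sys.metric μ ψ) x₀ (chartCurve (modelM d) x x₀ l)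
        (derivWithin (chartCurve (modelM d) x x₀) (Icc l₀ l₁) l)
        (derivWithin (chartCurve (modelM d) x x₀) (Icc l₀ l₁) l) w =
    k ^ 2 / ψ (x l).1 (x l).2.1 * sys.chartEL q (Icc t₀ t₁) x₀.2.1 (x l).1
      (w.2.1 - w.1 • derivWithin (chartCurve (𝓡 d) q x₀.2.1) (Icc t₀ t₁) (x l).1) := by
  have hs' := (mem_extChartAt_modelM_source x₀ (x l)).1 hs
  have ht := h.maps l hlJ
  have hsq : q (x l).1 ∈ (extChartAt (𝓡 d) x₀.2.1).source := h.proj l hlJ ▸ hs'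
  have hcx := contDiffWithinAt_chartCurve (h.contMDiffOn_x l hlJ) hs
  have hcq := contDiffWithinAt_chartCurve (h.contMDiffOn_q _ ht) hsq
  have hu := uniqueDiffOn_Icc hl
  have hu' := uniqueDiffOn_Icc h01
  rw [geodesicExpr_chart hT hψ x₀ (hTt ht) ((extChartAt (𝓡 d) x₀.2.1).map_source hs')]
  have hev : ∀ᶠ l' in 𝓝[Icc l₀ l₁] l, l' ∈ Icc l₀ l₁ ∧
      x l' ∈ (extChartAt (modelM d) x₀).source :=
    eventually_mem_nhdsWithin.and
      (eventually_mem_source (h.contMDiffOn_x.continuousOn l hlJ) hs)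
  have key := geodesicExpr_eq (recip μ) (hT.prod (isOpen_extChartAt_target x₀.2.1))
    (sys.contDiffOn_locA x₀.2.1)
    (sys.contDiffOn_locB x₀.2.1) (contDiffOn_locF sys.contMDiffOn_U x₀.2.1)
    (contDiffOn_locF hψ x₀.2.1) sys.locA_symm (fun p hp => (hψ_pos _ hp.1 _).ne')
    (x := chartCurve (modelM d) x x₀) (J' := Icc t₀ t₁)
    (c := chartCurve (𝓡 d) q x₀.2.1) (k := k) hlJ (hu l hlJ)
    (hcx.differentiableWithinAt two_ne_zero).hasDerivWithinAt
    (hasDerivWithinAt_derivWithin hcx hu hlJ) h.maps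
    (hcq.differentiableWithinAt two_ne_zero).hasDerivWithinAt
    (hasDerivWithinAt_derivWithin hcq hu' ht) (by
      filter_upwards [hev] with l' ⟨hl', hs2⟩
      have hs2' := (mem_extChartAt_modelM_source x₀ (x l')).1 hs2
      have hsq2 : q (x l').1 ∈ (extChartAt (𝓡 d) x₀.2.1).source := h.proj l' hl' ▸ hs2'
      have e : extChartAt (𝓡 d) x₀.2.1 (x l').2.1 = chartCurve (𝓡 d) q x₀.2.1 (x l').1 := by
        rw [h.proj l' hl']; rfl
      refine ⟨e, ⟨hTt (h.maps l' hl'), (extChartAt (𝓡 d) x₀.2.1).map_source hs2'⟩, ?_⟩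
      rw [h.derivWithin_chartCurve hl x₀ hl' hs2',
        sys.liftRate_chart μ ψ h01 h.contMDiffOn_q (h.maps l' hl') hsq2]
      simp only [chartCurve, extChartAt_modelM, h.proj l' hl']) w
  refine key.trans ?_
  have e : ((chartCurve (modelM d) x x₀ l).1, (chartCurve (modelM d) x x₀ l).2.1) =
      ((x l).1, chartCurve (𝓡 d) q x₀.2.1 (x l).1) := by
    simp only [chartCurve, extChartAt_modelM, h.proj l hlJ]
  rw [e]
  congr 2
  exact (locF_eq _ hsq).trans (by rw [h.proj l hlJ])

end IsReparamLift

end ClassicalSystem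

end Eisenhart

end

noncomputable section

namespace Eisenhart

/-! ### Geodesics and stationary points -/

variable {d : ℕ} {S : Type*} [TopologicalSpace S]
  [ChartedSpace (EuclideanSpace ℝ (Fin d)) S] [IsManifold (𝓡 d) 2 S] {T : Set ℝ}

theorem velocity_modelM {x : ℝ → ℝ × S × ℝ} {J : Set ℝ} {l : ℝ} (hJ : UniqueDiffWithinAt ℝ J l)
    (hl : l ∈ J) (hx : MDifferentiableWithinAt 𝓘(ℝ, ℝ) (modelM d) x J l) {x₀ : ℝ × S × ℝ}
    (hs : (x l).2.1 ∈ (extChartAt (𝓡 d) x₀.2.1).source) :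
    velocity (modelM d) x J l = (((derivWithin (chartCurve (modelM d) x x₀) J l).1,
      symmDeriv (𝓡 d) x₀.2.1 (extChartAt (𝓡 d) x₀.2.1 (x l).2.1)
        (derivWithin (chartCurve (modelM d) x x₀) J l).2.1,
      (derivWithin (chartCurve (modelM d) x x₀) J l).2.2) : modelE d) := by
  have : IsManifold (𝓡 d) 1 S := .of_le (n := 2) (by norm_num)
  rw [velocity_eq hJ hl hx ((mem_extChartAt_modelM_source x₀ (x l)).2 hs),
    symmDeriv_modelM x₀ ((extChartAt (𝓡 d) x₀.2.1).map_source hs)]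
  rfl

/-- Presents n as the image of the coordinate vector (0, 0, 1), the form required by `metric_chart`.
-/
theorem n_eq (m : ℝ × S × ℝ) : n (d := d) m = (((0 : ℝ),
    symmDeriv (𝓡 d) m.2.1 (extChartAt (𝓡 d) m.2.1 m.2.1) 0, (1 : ℝ)) : modelE d) := by
  rw [map_zero]; rfl

namespace ClassicalSystem

variable {sys : ClassicalSystem d S T} {μ : ℝ≥0∞} {ψ : ℝ → S → ℝ}

theorem metric_velocity {x : ℝ → ℝ × S × ℝ} {J : Set ℝ} {l : ℝ} (hJ : UniqueDiffWithinAt ℝ J l)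
    (hl : l ∈ J) (hx : MDifferentiableWithinAt 𝓘(ℝ, ℝ) (modelM d) x J l) {x₀ : ℝ × S × ℝ}
    (hs : (x l).2.1 ∈ (extChartAt (𝓡 d) x₀.2.1).source) :
    sys.metric μ ψ (x l) (velocity (modelM d) x J l) (velocity (modelM d) x J l) =
      sys.locMetric μ ψ x₀.2.1 (chartCurve (modelM d) x x₀ l)
        (derivWithin (chartCurve (modelM d) x x₀) J l)
        (derivWithin (chartCurve (modelM d) x x₀) J l) := by
  rw [velocity_modelM hJ hl hx hs]
  exact sys.metric_chart μ ψ hs _ _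

theorem metric_n_velocity {x : ℝ → ℝ × S × ℝ} {J : Set ℝ} {l : ℝ}
    (hJ : UniqueDiffWithinAt ℝ J l)
    (hl : l ∈ J) (hx : MDifferentiableWithinAt 𝓘(ℝ, ℝ) (modelM d) x J l) :
    sys.metric μ ψ (x l) (n (d := d) (x l)) (velocity (modelM d) x J l) =
      sys.locMetric μ ψ (x l).2.1 (chartCurve (modelM d) x (x l) l) (0, 0, 1)
        (derivWithin (chartCurve (modelM d) x (x l)) J l) := by
  rw [velocity_modelM hJ hl hx (mem_extChartAt_source (x l).2.1), n_eq]
  exact sys.metric_chart μ ψ (mem_extChartAt_source (x l).2.1) (0, 0, 1) _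

namespace IsReparamLift

variable {x : ℝ → ℝ × S × ℝ} {l₀ l₁ t₀ t₁ k : ℝ} {q : ℝ → S} {Y : ℝ → ℝ}

/-- The kinetic, magnetic and potential terms of the rate cancel those of the metric, and only the
mass term survives. Thus μ decides between timelike and lightlike, and the sign of k decides the
time orientation. -/
theorem metric_velocity (h : sys.IsReparamLift μ ψ x l₀ l₁ q t₀ t₁ Y k)
    (hTt : Icc t₀ t₁ ⊆ T) (hψ_pos : ∀ t ∈ T, ∀ q : S, 0 < ψ t q) (hl : l₀ < l₁) (h01 : t₀ < t₁)
    {l : ℝ} (hlJ : l ∈ Icc l₀ l₁) :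
    sys.metric μ ψ (x l) (velocity (modelM d) x (Icc l₀ l₁) l)
        (velocity (modelM d) x (Icc l₀ l₁) l) = -(k * recip μ) ^ 2 ∧
      sys.metric μ ψ (x l) (n (d := d) (x l)) (velocity (modelM d) x (Icc l₀ l₁) l) = -k := by
  have hx := (h.contMDiffOn_x l hlJ).mdifferentiableWithinAt two_ne_zero
  have hu := uniqueDiffOn_Icc hl l hlJ
  have ht := h.maps l hlJ
  have hs : (x l).2.1 ∈ (extChartAt (𝓡 d) (x l).2.1).source := mem_extChartAt_source _
  have hsq : q (x l).1 ∈ (extChartAt (𝓡 d) (x l).2.1).source := by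
    rw [← h.proj l hlJ]; exact hs
  have hP : locF ψ (x l).2.1 ((x l).1, extChartAt (𝓡 d) (x l).2.1 (x l).2.1) ≠ 0 :=
    (hψ_pos _ (hTt ht) _).ne'
  have e : extChartAt (𝓡 d) (x l).2.1 (x l).2.1 = chartCurve (𝓡 d) q (x l).2.1 (x l).1 := by
    rw [chartCurve, ← h.proj l hlJ]
  rw [ClassicalSystem.metric_velocity hu hlJ hx hs, ClassicalSystem.metric_n_velocity hu hlJ hx,
    h.derivWithin_chartCurve hl (x l) hlJ hs, sys.liftRate_chart μ ψ h01 h.contMDiffOn_q ht hsq]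
  simp only [locMetric, coordMetric_apply, chartCurve, extChartAt_modelM] at e ⊢
  rw [e] at hP ⊢
  generalize ((x l).1, extChartAt (𝓡 d) (x l).2.1 (q (x l).1)) = p at *
  constructor
  · simp
    field_simp
    ring
  · simp
    field_simp

theorem isGeodesicOn (h : sys.IsReparamLift μ ψ x l₀ l₁ q t₀ t₁ Y k) (hT : IsOpen T)
    (hTt : Icc t₀ t₁ ⊆ T)
    (hψ : ContMDiffOn (𝓘(ℝ, ℝ).prod (𝓡 d)) 𝓘(ℝ, ℝ) 1 (fun p : ℝ × S => ψ p.1 p.2) (T ×ˢ univ))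
    (hψ_pos : ∀ t ∈ T, ∀ q : S, 0 < ψ t q) (hl : l₀ < l₁) (h01 : t₀ < t₁)
    (hEL : sys.IsEL q (Icc t₀ t₁)) : sys.IsGeodesic μ ψ x l₀ l₁ := by
  refine ⟨fun l hlJ => hTt (h.maps l hlJ), h.contMDiffOn_x, fun x₀ l hlJ hs w => ?_⟩
  rw [h.geodesicExpr hT hTt hψ hψ_pos hl h01 x₀ hlJ hs w, hEL x₀.2.1 _ (h.maps l hlJ), mul_zero]
  rw [← h.proj l hlJ]
  exact (mem_extChartAt_modelM_source x₀ (x l)).1 hs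

theorem isEL (h : sys.IsReparamLift μ ψ x l₀ l₁ q t₀ t₁ Y k) (hT : IsOpen T)
    (hTt : Icc t₀ t₁ ⊆ T)
    (hψ : ContMDiffOn (𝓘(ℝ, ℝ).prod (𝓡 d)) 𝓘(ℝ, ℝ) 1 (fun p : ℝ × S => ψ p.1 p.2) (T ×ˢ univ))
    (hψ_pos : ∀ t ∈ T, ∀ q : S, 0 < ψ t q) (hl : l₀ < l₁) (h01 : t₀ < t₁) (hk : k ≠ 0)
    (hsurj : (fun l => (x l).1) '' Icc l₀ l₁ = Icc t₀ t₁)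
    (hx : sys.IsGeodesic μ ψ x l₀ l₁) : sys.IsEL q (Icc t₀ t₁) := by
  intro q₀ t ht hs w
  obtain ⟨l, hlJ, rfl⟩ := hsurj ▸ ht
  have hs' : x l ∈ (extChartAt (modelM d) ((0 : ℝ), q₀, (0 : ℝ))).source := by
    rw [mem_extChartAt_modelM_source, h.proj l hlJ]
    exact hs
  -- Purely spatial test vectors suffice, since w_q - w_t q̇ is then an arbitrary w.
  have key := h.geodesicExpr hT hTt hψ hψ_pos hl h01 (0, q₀, 0) hlJ hs' (0, w, 0)
  rw [hx.2.2 (0, q₀, 0) l hlJ hs' (0, w, 0)] at key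
  have hne : k ^ 2 / ψ (x l).1 (x l).2.1 ≠ 0 :=
    div_ne_zero (pow_ne_zero 2 hk) (hψ_pos _ (hTt ht) _).ne'
  have := (mul_eq_zero.1 key.symm).resolve_left hne
  simpa using this

end IsReparamLift

/-- Along a geodesic, `ψ dt/ds` is constant. -/
theorem IsGeodesic.exists_deriv_time (hT : IsOpen T)
    (hψ : ContMDiffOn (𝓘(ℝ, ℝ).prod (𝓡 d)) 𝓘(ℝ, ℝ) 1 (fun p : ℝ × S => ψ p.1 p.2) (T ×ˢ univ))
    (hψ_pos : ∀ t ∈ T, ∀ q : S, 0 < ψ t q) {x : ℝ → ℝ × S × ℝ} {l₀ l₁ : ℝ} (hl : l₀ < l₁)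
    (hx : sys.IsGeodesic μ ψ x l₀ l₁) :
    ∃ k : ℝ, ∀ l ∈ Icc l₀ l₁,
      HasDerivWithinAt (fun l => (x l).1) (k / ψ (x l).1 (x l).2.1) (Icc l₀ l₁) l := by
  obtain ⟨hxT, hx2, hgeo⟩ := hx
  have hu := uniqueDiffOn_Icc hl
  set θ : ℝ → ℝ := fun l => (x l).1 with hθ
  have hθd : ∀ l ∈ Icc l₀ l₁, DifferentiableWithinAt ℝ θ (Icc l₀ l₁) l := fun l hlJ =>
    ((contDiffWithinAt_chartCurve (hx2 l hlJ) (mem_extChartAt_source (x l))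
      ).differentiableWithinAt two_ne_zero).fst
  set f : ℝ → ℝ := fun l => ψ (x l).1 (x l).2.1 * derivWithin θ (Icc l₀ l₁) l with hf
  have hfd : ∀ l ∈ Icc l₀ l₁, HasDerivWithinAt f 0 (Icc l₀ l₁) l := by
    intro l hlJ
    have hs : x l ∈ (extChartAt (modelM d) (x l)).source := mem_extChartAt_source _
    have hs' := (mem_extChartAt_modelM_source (x l) (x l)).1 hs
    have hcx := contDiffWithinAt_chartCurve (hx2 l hlJ) hs
    have hΩ : IsOpen (T ×ˢ (extChartAt (𝓡 d) (x l).2.1).target) :=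
      hT.prod (isOpen_extChartAt_target (x l).2.1)
    have hm := (extChartAt (𝓡 d) (x l).2.1).map_source hs'
    -- The test vector is -n, because g(x', -n) = ψ dt/ds.
    have h1 := hasDerivWithinAt_coordMetric (recip μ) hΩ (sys.contDiffOn_locA (x l).2.1)
      (sys.contDiffOn_locB (x l).2.1) (contDiffOn_locF sys.contMDiffOn_U (x l).2.1)
      (contDiffOn_locF hψ (x l).2.1) (x := chartCurve (modelM d) x (x l))
      (hcx.differentiableWithinAt two_ne_zero).hasDerivWithinAt
      (hasDerivWithinAt_derivWithin hcx hu hlJ) ⟨hxT l hlJ, hm⟩ (0, 0, -1)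
    have h2 := hgeo (x l) l hlJ hs (0, 0, -1)
    rw [geodesicExpr_chart hT hψ (x l) (hxT l hlJ) hm, locMetric] at h2
    -- The coefficients of the metric do not depend on y, so the geodesic equation along -n states
    -- that ψ dt/ds has derivative zero.
    have h3 : fderiv ℝ (sys.locMetric μ ψ (x l).2.1) (chartCurve (modelM d) x (x l) l) (0, 0, -1)
        (derivWithin (chartCurve (modelM d) x (x l)) (Icc l₀ l₁) l)
        (derivWithin (chartCurve (modelM d) x (x l)) (Icc l₀ l₁) l) = 0 := by
      have h0 : ((0 : ℝ), (0 : EuclideanSpace ℝ (Fin d))) = 0 := rfl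
      refine (fderiv_coordMetric (recip μ) hΩ (sys.contDiffOn_locA (x l).2.1)
        (sys.contDiffOn_locB (x l).2.1) (contDiffOn_locF sys.contMDiffOn_U (x l).2.1)
        (contDiffOn_locF hψ (x l).2.1) ⟨hxT l hlJ, hm⟩ _ _ _).trans ?_
      simp [h0]
    rw [h3, mul_zero, sub_zero] at h2
    refine (h1.congr_of_eventuallyEq_of_mem ?_ hlJ).congr_deriv h2
    filter_upwards [eventually_mem_source (hx2.continuousOn l hlJ) hs, eventually_mem_nhdsWithin]
      with l' hs2 hl'
    have hs2' := (mem_extChartAt_modelM_source (x l) (x l')).1 hs2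
    have e : derivWithin θ (Icc l₀ l₁) l' =
        (derivWithin (chartCurve (modelM d) x (x l)) (Icc l₀ l₁) l').1 :=
      HasDerivWithinAt.derivWithin ((dt d).hasFDerivAt.comp_hasDerivWithinAt l'
        ((contDiffWithinAt_chartCurve (hx2 l' hl') hs2).differentiableWithinAt
          two_ne_zero).hasDerivWithinAt) (hu l' hl')
    rw [coordMetric_apply, hf]
    simp only [e, chartCurve, extChartAt_modelM, locF_eq _ hs2']
    simp
  have hconst := constant_of_derivWithin_zero (fun l hlJ => (hfd l hlJ).differentiableWithinAt)
    fun l hlJ => (hfd l (Ico_subset_Icc_self hlJ)).derivWithin (hu l (Ico_subset_Icc_self hlJ))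
  refine ⟨f l₀, fun l hlJ => (hθd l hlJ).hasDerivWithinAt.congr_deriv ?_⟩
  rw [eq_div_iff (hψ_pos _ (hxT l hlJ) _).ne', ← hconst l hlJ, mul_comm]

end ClassicalSystem

end Eisenhart

end

noncomputable section

namespace Eisenhart

/-! ### The correspondence -/

theorem hasDerivWithinAt_integral {f : ℝ → ℝ} {a b t : ℝ} (hf : ContinuousOn f (Icc a b))
    (ht : t ∈ Icc a b) :
    HasDerivWithinAt (fun u => ∫ s in a..u, f s) (f t) (Icc a b) t := by
  have := Fact.mk ht
  exact intervalIntegral.integral_hasDerivWithinAt_right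
    ((hf.mono (Icc_subset_Icc_right ht.2)).intervalIntegrable_of_Icc ht.1)
    (hf.stronglyMeasurableAtFilter_nhdsWithin measurableSet_Icc t) (hf t ht)

variable {d : ℕ} {S : Type*} [TopologicalSpace S]
  [ChartedSpace (EuclideanSpace ℝ (Fin d)) S] [IsManifold (𝓡 d) 2 S] {T : Set ℝ}

/-- A locally constant function on a connected interval is constant. No structure on X is needed,
which suits points of S seen in varying charts. -/
theorem eq_of_eventually_eq {X : Type*} {z : ℝ → X} {a b : ℝ}
    (hz : ∀ l ∈ Icc a b, ∀ᶠ l' in 𝓝[Icc a b] l, z l' = z l) {l l' : ℝ} (hl : l ∈ Icc a b)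
    (hl' : l' ∈ Icc a b) : z l = z l' := by
  have : PreconnectedSpace (Icc a b) := isPreconnected_iff_preconnectedSpace.1 isPreconnected_Icc
  have h : IsLocallyConstant (fun l : Icc a b => z l) := by
    rw [IsLocallyConstant.iff_eventually_eq]
    intro l
    exact (eventually_nhds_subtype_iff (Icc a b) l (fun l' => z l' = z l)).2 (hz l l.2)
  exact h.apply_eq_of_preconnectedSpace ⟨l, hl⟩ ⟨l', hl'⟩

/-- Mean value inequality on the convex set cut out of the interval by a small ball. The derivative
is required only near l, which is as far as a chart expression is controlled. -/
theorem eventually_eq_of_hasDerivWithinAt_zero {F : Type*} [NormedAddCommGroup F]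
    [NormedSpace ℝ F] {c : ℝ → F} {a b l : ℝ} (hl : l ∈ Icc a b)
    (hc : ∀ᶠ l' in 𝓝[Icc a b] l, HasDerivWithinAt c 0 (Icc a b) l') :
    ∀ᶠ l' in 𝓝[Icc a b] l, c l' = c l := by
  obtain ⟨δ, hδ, hball⟩ := Metric.mem_nhdsWithin_iff.1 hc
  filter_upwards [inter_mem_nhdsWithin (Icc a b) (Metric.ball_mem_nhds l hδ)] with l' hl'
  have hconv : Convex ℝ (Metric.ball l δ ∩ Icc a b) := (convex_ball l δ).inter (convex_Icc a b)
  have hd : ∀ s ∈ Metric.ball l δ ∩ Icc a b,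
      HasDerivWithinAt c 0 (Metric.ball l δ ∩ Icc a b) s := fun s hs =>
    HasDerivWithinAt.mono (hball hs) inter_subset_right
  have hle := hconv.norm_image_sub_le_of_norm_hasDerivWithin_le (C := 0) hd (fun s _ => by simp)
    ⟨Metric.mem_ball_self hδ, hl⟩ ⟨hl'.2, hl'.1⟩
  rw [zero_mul, norm_le_zero_iff, sub_eq_zero] at hle
  exact hle

theorem symmDeriv_injective {q₀ : S} {z : EuclideanSpace ℝ (Fin d)}
    (hz : z ∈ (extChartAt (𝓡 d) q₀).target) : Function.Injective (symmDeriv (𝓡 d) q₀ z) := by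
  have : IsManifold (𝓡 d) 1 S := .of_le (n := 2) (by norm_num)
  have h := isInvertible_mfderivWithin_extChartAt_symm (I := 𝓡 d) hz
  rw [ModelWithCorners.Boundaryless.range_eq_univ, mfderivWithin_univ] at h
  exact h.injective

theorem contDiffOn_comp_curve {ψ : ℝ → S → ℝ}
    (hψ : ContMDiffOn (𝓘(ℝ, ℝ).prod (𝓡 d)) 𝓘(ℝ, ℝ) 1 (fun p : ℝ × S => ψ p.1 p.2) (T ×ˢ univ))
    {θ : ℝ → ℝ} {q : ℝ → S} {J : Set ℝ} (hθ : ContMDiffOn 𝓘(ℝ, ℝ) 𝓘(ℝ, ℝ) 2 θ J)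
    (hq : ContMDiffOn 𝓘(ℝ, ℝ) (𝓡 d) 2 q J) (hT : MapsTo θ J T) :
    ContDiffOn ℝ 1 (fun t => ψ (θ t) (q t)) J := by
  rw [← contMDiffOn_iff_contDiffOn]
  exact hψ.comp (f := fun t => (θ t, q t)) ((hθ.prodMk hq).of_le (by norm_num))
    (fun t ht => ⟨hT ht, mem_univ _⟩)

theorem parameter_properties {c : ℝ} (hc : 0 < c) {ψ : ℝ → S → ℝ} {q : ℝ → S} {t₀ t₁ : ℝ}
    (h01 : t₀ < t₁) (hψq : ContinuousOn (fun t => ψ t (q t)) (Icc t₀ t₁))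
    (hpos : ∀ t ∈ Icc t₀ t₁, 0 < ψ t (q t)) :
    (∀ t ∈ Icc t₀ t₁,
      HasDerivWithinAt (parameter c ψ q t₀) (c * ψ t (q t)) (Icc t₀ t₁) t) ∧
      parameter c ψ q t₀ '' Icc t₀ t₁ = Icc 0 (parameter c ψ q t₀ t₁) ∧
      0 < parameter c ψ q t₀ t₁ := by
  have hd : ∀ t ∈ Icc t₀ t₁,
      HasDerivWithinAt (parameter c ψ q t₀) (c * ψ t (q t)) (Icc t₀ t₁) t := fun t ht =>
    hasDerivWithinAt_integral (continuousOn_const.mul hψq) ht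
  have hcont : ContinuousOn (parameter c ψ q t₀) (Icc t₀ t₁) := fun t ht =>
    (hd t ht).continuousWithinAt
  have h0 : parameter c ψ q t₀ t₀ = 0 := by simp [parameter]
  have hmono : StrictMonoOn (parameter c ψ q t₀) (Icc t₀ t₁) := by
    refine strictMonoOn_of_deriv_pos (convex_Icc _ _) hcont fun t ht => ?_
    rw [interior_Icc] at ht
    have ht' := Ioo_subset_Icc_self ht
    rw [((hd t ht').hasDerivAt (Icc_mem_nhds ht.1 ht.2)).deriv]
    exact mul_pos hc (hpos t ht')
  refine ⟨hd, ?_, ?_⟩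
  · have h1 := hcont.image_Icc_of_monotoneOn h01.le hmono.monotoneOn
    rwa [h0] at h1
  · have h1 := hmono (left_mem_Icc.2 h01.le) (right_mem_Icc.2 h01.le) h01
    rwa [h0] at h1

namespace ClassicalSystem

variable {sys : ClassicalSystem d S T} {μ : ℝ≥0∞} {ψ : ℝ → S → ℝ}

/-- The lifts of a stationary point are geodesics. -/
theorem IsStationary.exists_isGeodesic (hT : IsOpen T)
    (hψ : ContMDiffOn (𝓘(ℝ, ℝ).prod (𝓡 d)) 𝓘(ℝ, ℝ) 1 (fun p : ℝ × S => ψ p.1 p.2) (T ×ˢ univ))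
    (hψ_pos : ∀ t ∈ T, ∀ q : S, 0 < ψ t q) {q : ℝ → S} {t₀ t₁ : ℝ} (hTt : Icc t₀ t₁ ⊆ T)
    (h01 : t₀ < t₁) (hst : sys.IsStationary q t₀ t₁) {c : ℝ} (hc : 0 < c) (y₀ : ℝ) :
    ∃ x : ℝ → ℝ × S × ℝ,
      (∀ t ∈ Icc t₀ t₁, x (parameter c ψ q t₀ t) = sys.lift μ ψ q t₀ t₁ y₀ t) ∧
      0 < parameter c ψ q t₀ t₁ ∧
      ProjectsTo x 0 (parameter c ψ q t₀ t₁) q t₀ t₁ ∧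
      sys.IsGeodesic μ ψ x 0 (parameter c ψ q t₀ t₁) ∧
      ∀ l ∈ Icc 0 (parameter c ψ q t₀ t₁),
        sys.metric μ ψ (x l) (velocity (modelM d) x (Icc 0 (parameter c ψ q t₀ t₁)) l)
          (velocity (modelM d) x (Icc 0 (parameter c ψ q t₀ t₁)) l) = -(c⁻¹ * recip μ) ^ 2 ∧
        sys.metric μ ψ (x l) (n (d := d) (x l))
          (velocity (modelM d) x (Icc 0 (parameter c ψ q t₀ t₁)) l) = -c⁻¹ := by
  have hEL := IsStationary.isEL sys hT hTt h01 hst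
  have hq := hst.1
  have hψq : ContDiffOn ℝ 1 (fun t => ψ t (q t)) (Icc t₀ t₁) :=
    contDiffOn_comp_curve hψ contMDiffOn_id hq hTt
  obtain ⟨hd, himg, hpos⟩ := parameter_properties hc h01 hψq.continuousOn
    fun t ht => hψ_pos t (hTt ht) _
  have hne : ∀ t ∈ Icc t₀ t₁, c * ψ t (q t) ≠ 0 := fun t ht =>
    (mul_pos hc (hψ_pos t (hTt ht) _)).ne'
  obtain ⟨-, σ, hσ1, hσ2⟩ := exists_inverse hd hne
  rw [himg] at hσ2
  set Λ := parameter c ψ q t₀ t₁ with hΛ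
  have hσm : MapsTo σ (Icc 0 Λ) (Icc t₀ t₁) := fun l hl => (hσ2 l hl).1
  have hσC : ContDiffOn ℝ 2 σ (Icc 0 Λ) :=
    contDiffOn_two_of_hasDerivWithinAt_inv (f := fun t => c * ψ t (q t)) (uniqueDiffOn_Icc hpos)
      (fun l hl => (hσ2 l hl).2.2) hσm (contDiffOn_const.mul hψq) hne
  have hrate := sys.contDiffOn_liftRate μ ψ hT hψ hTt h01 hq
  set Y : ℝ → ℝ := fun t => y₀ + ∫ s in t₀..t, sys.liftRate μ ψ q t₀ t₁ s with hY
  have hYd : ∀ t ∈ Icc t₀ t₁, HasDerivWithinAt Y (sys.liftRate μ ψ q t₀ t₁ t) (Icc t₀ t₁) t :=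
    fun t ht => (hasDerivWithinAt_integral hrate.continuousOn ht).const_add y₀
  -- The height is a primitive of the C¹ rate.
  have hYC : ContDiffOn ℝ 2 Y (Icc t₀ t₁) := by
    have := contDiffOn_succ_of_hasDerivWithinAt (n := 1) (uniqueDiffOn_Icc h01) hYd hrate
    norm_num at this
    exact this
  have hlift : ∀ t, sys.lift μ ψ q t₀ t₁ y₀ t = (t, q t, Y t) := fun t => rfl
  -- The parameter satisfies dl = c ψ dt, so ψ dt/dl = c⁻¹ is the constant k.
  have hL : sys.IsReparamLift μ ψ (fun l => sys.lift μ ψ q t₀ t₁ y₀ (σ l)) 0 Λ q t₀ t₁ Y c⁻¹ := by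
    refine ⟨?_, hq, hσm, fun l _ => rfl, fun l _ => rfl, fun l hl => ?_, hYd⟩
    · exact hσC.contMDiffOn.prodMk ((hq.comp hσC.contMDiffOn hσm).prodMk
        (hYC.comp hσC hσm).contMDiffOn)
    · refine (hσ2 l hl).2.2.congr_deriv ?_
      rw [mul_inv, div_eq_mul_inv]
      rfl
  refine ⟨_, fun t ht => ?_, hpos, ⟨?_, fun l _ => rfl⟩,
    hL.isGeodesicOn hT hTt hψ hψ_pos hpos h01 hEL,
    fun l hl => hL.metric_velocity hTt hψ_pos hpos h01 hl⟩
  · simp only [hσ1 t ht]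
  · refine Subset.antisymm (image_subset_iff.2 hσm) fun t ht => ?_
    exact ⟨parameter c ψ q t₀ t, himg ▸ mem_image_of_mem _ ht, hσ1 t ht⟩

/-- A geodesic not everywhere orthogonal to `∂/∂y` can be parametrized by `t`. -/
theorem IsGeodesic.exists_section
    (hψ : ContMDiffOn (𝓘(ℝ, ℝ).prod (𝓡 d)) 𝓘(ℝ, ℝ) 1 (fun p : ℝ × S => ψ p.1 p.2) (T ×ˢ univ))
    (hψ_pos : ∀ t ∈ T, ∀ q : S, 0 < ψ t q) {x : ℝ → ℝ × S × ℝ} {l₀ l₁ t₀ t₁ k : ℝ}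
    (hx : sys.IsGeodesic μ ψ x l₀ l₁) (h01 : t₀ < t₁)
    (hsurj : (fun l => (x l).1) '' Icc l₀ l₁ = Icc t₀ t₁) (hk : k ≠ 0)
    (hθ : ∀ l ∈ Icc l₀ l₁,
      HasDerivWithinAt (fun l => (x l).1) (k / ψ (x l).1 (x l).2.1) (Icc l₀ l₁) l) :
    ∃ σ : ℝ → ℝ, (∀ l ∈ Icc l₀ l₁, σ (x l).1 = l) ∧ MapsTo σ (Icc t₀ t₁) (Icc l₀ l₁) ∧
      (∀ t ∈ Icc t₀ t₁, (x (σ t)).1 = t) ∧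
      (∀ t ∈ Icc t₀ t₁, HasDerivWithinAt σ (ψ t (x (σ t)).2.1 / k) (Icc t₀ t₁) t) ∧
      ContMDiffOn 𝓘(ℝ, ℝ) (modelM d) 2 (fun t => x (σ t)) (Icc t₀ t₁) := by
  obtain ⟨hxT, hx2, -⟩ := hx
  have hpos : ∀ l ∈ Icc l₀ l₁, ψ (x l).1 (x l).2.1 ≠ 0 := fun l hl => (hψ_pos _ (hxT l hl) _).ne'
  have hne : ∀ l ∈ Icc l₀ l₁, k / ψ (x l).1 (x l).2.1 ≠ 0 := fun l hl => div_ne_zero hk (hpos l hl)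
  obtain ⟨-, σ, hσ1, hσ2⟩ := exists_inverse hθ hne
  rw [hsurj] at hσ2
  have hσm : MapsTo σ (Icc t₀ t₁) (Icc l₀ l₁) := fun t ht => (hσ2 t ht).1
  have hψx : ContDiffOn ℝ 1 (fun l => ψ (x l).1 (x l).2.1) (Icc l₀ l₁) :=
    contDiffOn_comp_curve hψ (contMDiff_fst.comp_contMDiffOn hx2)
      (contMDiff_fst.comp_contMDiffOn (contMDiff_snd.comp_contMDiffOn hx2)) hxT
  have hσC : ContDiffOn ℝ 2 σ (Icc t₀ t₁) :=
    contDiffOn_two_of_hasDerivWithinAt_inv (f := fun l => k / ψ (x l).1 (x l).2.1)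
      (uniqueDiffOn_Icc h01) (fun t ht => (hσ2 t ht).2.2) hσm
      (contDiffOn_const.div hψx hpos) hne
  refine ⟨σ, hσ1, hσm, fun t ht => (hσ2 t ht).2.1, fun t ht => ?_,
    hx2.comp hσC.contMDiffOn hσm⟩
  have h := (hσ2 t ht).2.2
  rw [inv_div, (hσ2 t ht).2.1] at h
  exact h

/-- A geodesic that is a lift of its own projection projects to a stationary point. -/
theorem IsGeodesic.isStationary_of_lift (hT : IsOpen T)
    (hψ : ContMDiffOn (𝓘(ℝ, ℝ).prod (𝓡 d)) 𝓘(ℝ, ℝ) 1 (fun p : ℝ × S => ψ p.1 p.2) (T ×ˢ univ))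
    (hψ_pos : ∀ t ∈ T, ∀ q : S, 0 < ψ t q) {x : ℝ → ℝ × S × ℝ} {l₀ l₁ : ℝ} (hl : l₀ < l₁)
    (hx : sys.IsGeodesic μ ψ x l₀ l₁) {q : ℝ → S} {t₀ t₁ y₀ : ℝ} (h01 : t₀ < t₁)
    (hproj : ProjectsTo x l₀ l₁ q t₀ t₁)
    (hlift : ∀ l ∈ Icc l₀ l₁, x l = sys.lift μ ψ q t₀ t₁ y₀ (x l).1) :
    sys.IsStationary q t₀ t₁ := by
  obtain ⟨hsurj, hxq⟩ := hproj
  have hmaps : ∀ l ∈ Icc l₀ l₁, (x l).1 ∈ Icc t₀ t₁ := fun l hl => hsurj ▸ mem_image_of_mem _ hl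
  have hTt : Icc t₀ t₁ ⊆ T := by
    rw [← hsurj]
    rintro _ ⟨l, hl, rfl⟩
    exact hx.1 l hl
  obtain ⟨k, hθ⟩ := IsGeodesic.exists_deriv_time hT hψ hψ_pos hl hx
  -- For k = 0 the time would be constant, whereas its range is [t₀, t₁] with t₀ < t₁.
  have hk : k ≠ 0 := by
    rintro rfl
    simp only [zero_div] at hθ
    have hconst := constant_of_derivWithin_zero
      (fun l hl => (hθ l hl).differentiableWithinAt) fun l hl' =>
        (hθ l (Ico_subset_Icc_self hl')).derivWithin
          (uniqueDiffOn_Icc hl l (Ico_subset_Icc_self hl'))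
    obtain ⟨a, ha, ha'⟩ := hsurj ▸ left_mem_Icc.2 h01.le
    obtain ⟨b, hb, hb'⟩ := hsurj ▸ right_mem_Icc.2 h01.le
    have ha2 := hconst a ha
    have hb2 := hconst b hb
    simp only at ha' hb' ha2 hb2
    linarith
  obtain ⟨σ, -, hσm, hσ2, -, hσC⟩ := hx.exists_section hψ hψ_pos h01 hsurj hk hθ
  -- No regularity of q is assumed; it is inherited from the geodesic reparametrized by t.
  have hq : ContMDiffOn 𝓘(ℝ, ℝ) (𝓡 d) 2 q (Icc t₀ t₁) := by
    refine (contMDiff_fst.comp_contMDiffOn (contMDiff_snd.comp_contMDiffOn hσC)).congr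
      fun t ht => ?_
    have := hxq (σ t) (hσm ht)
    rw [hσ2 t ht] at this
    exact this.symm
  have hrate := sys.contDiffOn_liftRate μ ψ hT hψ hTt h01 hq
  have hL : sys.IsReparamLift μ ψ x l₀ l₁ q t₀ t₁
      (fun t => y₀ + ∫ s in t₀..t, sys.liftRate μ ψ q t₀ t₁ s) k :=
    ⟨hx.2.1, hq, hmaps, hxq, fun l hl => congrArg (fun p : ℝ × S × ℝ => p.2.2) (hlift l hl), hθ,
      fun t ht => (hasDerivWithinAt_integral hrate.continuousOn ht).const_add y₀⟩
  exact IsEL.isStationary sys hT hTt h01 hq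
    (hL.isEL hT hTt hψ hψ_pos hl h01 hk hsurj hx)

end ClassicalSystem

end Eisenhart

end

noncomputable section

namespace Eisenhart

/-! ### Lightlike geodesics -/

variable {d : ℕ} {S : Type*} [TopologicalSpace S]
  [ChartedSpace (EuclideanSpace ℝ (Fin d)) S] [IsManifold (𝓡 d) 2 S] {T : Set ℝ}

theorem recip_top : recip ∞ = 0 := by simp [recip]

namespace ClassicalSystem

variable {sys : ClassicalSystem d S T} {ψ : ℝ → S → ℝ}

/-- A null curve at constant time is contained in a flow line of `∂/∂y`. -/
theorem inFlowLine_of_null (hψ_pos : ∀ t ∈ T, ∀ q : S, 0 < ψ t q) {μ : ℝ≥0∞}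
    {x : ℝ → ℝ × S × ℝ} {l₀ l₁ : ℝ} (hl : l₀ < l₁) (hxT : ∀ l ∈ Icc l₀ l₁, (x l).1 ∈ T)
    (hx2 : ContMDiffOn 𝓘(ℝ, ℝ) (modelM d) 2 x (Icc l₀ l₁))
    (hnull : ∀ l ∈ Icc l₀ l₁, sys.metric μ ψ (x l) (velocity (modelM d) x (Icc l₀ l₁) l)
      (velocity (modelM d) x (Icc l₀ l₁) l) = 0)
    (hθ : ∀ l ∈ Icc l₀ l₁, HasDerivWithinAt (fun l => (x l).1) 0 (Icc l₀ l₁) l) :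
    InFlowLine x l₀ l₁ := by
  have hu := uniqueDiffOn_Icc hl
  have hl₀ : l₀ ∈ Icc l₀ l₁ := left_mem_Icc.2 hl.le
  have hconst := constant_of_derivWithin_zero
    (fun l hl => (hθ l hl).differentiableWithinAt) fun l hl' =>
      (hθ l (Ico_subset_Icc_self hl')).derivWithin (hu l (Ico_subset_Icc_self hl'))
  refine ⟨(x l₀).1, (x l₀).2.1, fun l hlJ => ⟨hconst l hlJ, ?_⟩⟩
  refine eq_of_eventually_eq (z := fun l => (x l).2.1) (fun l hlJ => ?_) hlJ hl₀
  have hs : x l ∈ (extChartAt (modelM d) (x l)).source := mem_extChartAt_source _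
  have hev : ∀ᶠ l' in 𝓝[Icc l₀ l₁] l, (x l').2.1 ∈ (extChartAt (𝓡 d) (x l).2.1).source := by
    filter_upwards [eventually_mem_source (hx2.continuousOn l hlJ) hs] with l' h
      using (mem_extChartAt_modelM_source (x l) (x l')).1 h
  have hev2 := eventually_eq_of_hasDerivWithinAt_zero
    (c := fun l' => extChartAt (𝓡 d) (x l).2.1 (x l').2.1) hlJ ?_
  · filter_upwards [hev, hev2] with l' h1 h2
    exact (extChartAt (𝓡 d) (x l).2.1).injOn h1 (mem_extChartAt_source _) h2
  filter_upwards [hev, eventually_mem_nhdsWithin] with l' hs' hl'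
  have hd := ((contDiffWithinAt_chartCurve (hx2 l' hl')
    ((mem_extChartAt_modelM_source (x l) (x l')).2 hs')).differentiableWithinAt
      two_ne_zero).hasDerivWithinAt
  have h1 : (derivWithin (chartCurve (modelM d) x (x l)) (Icc l₀ l₁) l').1 = 0 :=
    (hu l' hl').eq_deriv _ ((dt d).hasFDerivAt.comp_hasDerivWithinAt l' hd) (hθ l' hl')
  have h2 := hnull l' hl'
  -- For dt = 0 the form reduces to ψ a(q', q') with no trace of y'; positivity of a then makes the
  -- spatial velocity vanish.
  rw [ClassicalSystem.metric_velocity (hu l' hl') hl'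
    ((hx2 l' hl').mdifferentiableWithinAt two_ne_zero) hs', locMetric, coordMetric_apply, h1] at h2
  simp only [chartCurve, extChartAt_modelM, zero_mul, mul_zero, sub_zero] at h2
  have hP : locF ψ (x l).2.1 ((x l').1, extChartAt (𝓡 d) (x l).2.1 (x l').2.1) ≠ 0 := by
    rw [locF_eq _ hs']
    exact (hψ_pos _ (hxT l' hl') _).ne'
  have h3 := (mul_eq_zero.1 h2).resolve_left hP
  rw [sys.locA_chart _ hs'] at h3
  have h4 : symmDeriv (𝓡 d) (x l).2.1 (extChartAt (𝓡 d) (x l).2.1 (x l').2.1)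
      (derivWithin (chartCurve (modelM d) x (x l)) (Icc l₀ l₁) l').2.1 = 0 := by
    by_contra hne
    exact (sys.a_pos _ (hxT l' hl') _ _ hne).ne' h3
  rw [← map_zero (symmDeriv (𝓡 d) (x l).2.1 (extChartAt (𝓡 d) (x l).2.1 (x l').2.1))] at h4
  have h5 := symmDeriv_injective ((extChartAt (𝓡 d) (x l).2.1).map_source hs') h4
  exact ((dq d).hasFDerivAt.comp_hasDerivWithinAt l' hd).congr_deriv h5

/-- A lightlike geodesic not contained in a flow line of `∂/∂y` projects to a stationary point. -/
theorem IsGeodesic.exists_isStationary (hT : IsOpen T)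
    (hψ : ContMDiffOn (𝓘(ℝ, ℝ).prod (𝓡 d)) 𝓘(ℝ, ℝ) 1 (fun p : ℝ × S => ψ p.1 p.2) (T ×ˢ univ))
    (hψ_pos : ∀ t ∈ T, ∀ q : S, 0 < ψ t q) {x : ℝ → ℝ × S × ℝ} {l₀ l₁ : ℝ} (hl : l₀ < l₁)
    (hx : sys.IsGeodesic ∞ ψ x l₀ l₁)
    (hnull : ∀ l ∈ Icc l₀ l₁, sys.metric ∞ ψ (x l) (velocity (modelM d) x (Icc l₀ l₁) l)
      (velocity (modelM d) x (Icc l₀ l₁) l) = 0)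
    (hflow : ¬ InFlowLine x l₀ l₁) :
    ∃ (q : ℝ → S) (t₀ t₁ : ℝ), t₀ < t₁ ∧ ProjectsTo x l₀ l₁ q t₀ t₁ ∧
      sys.IsStationary q t₀ t₁ := by
  obtain ⟨k, hθ⟩ := IsGeodesic.exists_deriv_time hT hψ hψ_pos hl hx
  -- This is the only use of the assumption that the geodesic is not along n. The sign of k remains
  -- free, so either time orientation is allowed.
  have hk : k ≠ 0 := by
    rintro rfl
    simp only [zero_div] at hθ
    exact hflow (inFlowLine_of_null hψ_pos hl hx.1 hx.2.1 hnull hθ)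
  have hpos : ∀ l ∈ Icc l₀ l₁, ψ (x l).1 (x l).2.1 ≠ 0 := fun l hlJ =>
    (hψ_pos _ (hx.1 l hlJ) _).ne'
  obtain ⟨hinj, -⟩ := exists_inverse hθ fun l hlJ => div_ne_zero hk (hpos l hlJ)
  have hθc : ContinuousOn (fun l => (x l).1) (Icc l₀ l₁) := fun l hlJ =>
    (hθ l hlJ).continuousWithinAt
  have hsurj := hθc.image_Icc hl.le
  set t₀ := sInf ((fun l => (x l).1) '' Icc l₀ l₁)
  set t₁ := sSup ((fun l => (x l).1) '' Icc l₀ l₁)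
  have hmaps : ∀ l ∈ Icc l₀ l₁, (x l).1 ∈ Icc t₀ t₁ := fun l hlJ =>
    hsurj ▸ mem_image_of_mem _ hlJ
  have h01 : t₀ < t₁ := by
    have ha := hmaps l₀ (left_mem_Icc.2 hl.le)
    have hb := hmaps l₁ (right_mem_Icc.2 hl.le)
    refine lt_of_le_of_ne (ha.1.trans ha.2) fun h => hl.ne (hinj (left_mem_Icc.2 hl.le)
      (right_mem_Icc.2 hl.le) ?_)
    simp only
    linarith [ha.1, ha.2, hb.1, hb.2]
  have hTt : Icc t₀ t₁ ⊆ T := by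
    rw [← hsurj]
    rintro _ ⟨l, hl, rfl⟩
    exact hx.1 l hl
  obtain ⟨σ, hσ1, hσm, hσ2, hσd, hσC⟩ := hx.exists_section hψ hψ_pos h01 hsurj hk hθ
  have hq : ContMDiffOn 𝓘(ℝ, ℝ) (𝓡 d) 2 (fun t => (x (σ t)).2.1) (Icc t₀ t₁) :=
    contMDiff_fst.comp_contMDiffOn (contMDiff_snd.comp_contMDiffOn hσC)
  have hproj : ∀ l ∈ Icc l₀ l₁, (x l).2.1 = (x (σ (x l).1)).2.1 := fun l hlJ => by
    rw [hσ1 l hlJ]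
  -- The height as a function of t plays the role of Y; that it grows at the rate of the lift is
  -- deduced from nullness.
  have hL : sys.IsReparamLift ∞ ψ x l₀ l₁ (fun t => (x (σ t)).2.1) t₀ t₁
      (fun t => (x (σ t)).2.2) k := by
    refine ⟨hx.2.1, hq, hmaps, hproj, fun l hlJ => by rw [hσ1 l hlJ], hθ, fun t ht => ?_⟩
    have hlJ := hσm ht
    have hs : (x (σ t)).2.1 ∈ (extChartAt (𝓡 d) (x (σ t)).2.1).source := mem_extChartAt_source _
    have hu := uniqueDiffOn_Icc hl _ hlJ
    have hd := ((contDiffWithinAt_chartCurve (hx.2.1 _ hlJ)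
      (mem_extChartAt_source (x (σ t)))).differentiableWithinAt two_ne_zero).hasDerivWithinAt
    set v := derivWithin (chartCurve (modelM d) x (x (σ t))) (Icc l₀ l₁) (σ t) with hv
    have hv1 : v.1 = k / ψ t (x (σ t)).2.1 := by
      have h := hu.eq_deriv _ ((dt d).hasFDerivAt.comp_hasDerivWithinAt _ hd) (hθ _ hlJ)
      rw [hσ2 t ht] at h
      exact h
    have hdc := hd.scomp t (hσd t ht) hσm
    have hc : derivWithin (chartCurve (𝓡 d) (fun t => (x (σ t)).2.1) (x (σ t)).2.1)
        (Icc t₀ t₁) t = (ψ t (x (σ t)).2.1 / k) • v.2.1 :=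
      HasDerivWithinAt.derivWithin ((dq d).hasFDerivAt.comp_hasDerivWithinAt t hdc)
        (uniqueDiffOn_Icc h01 t ht)
    have hP : ψ t (x (σ t)).2.1 ≠ 0 := (hψ_pos _ (hTt ht) _).ne'
    -- After division by ψ (dt/ds)², nullness with 1/μ = 0 reads a(q̇, q̇) - 2 (ẏ - b(q̇)) - 2U = 0,
    -- that is ẏ = ½ a(q̇, q̇) + b(q̇) - U.
    have h2 := hnull _ hlJ
    rw [ClassicalSystem.metric_velocity hu hlJ
      ((hx.2.1 _ hlJ).mdifferentiableWithinAt two_ne_zero) hs, locMetric, coordMetric_apply,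
      ← hv, hv1] at h2
    simp only [chartCurve, extChartAt_modelM, recip_top, hσ2 t ht, locF_eq t hs] at h2
    refine ((dy d).hasFDerivAt.comp_hasDerivWithinAt t hdc).congr_deriv ?_
    rw [sys.liftRate_chart ∞ ψ h01 hq ht hs, hc]
    simp only [chartCurve, recip_top, locF_eq t hs, map_smul, smul_eq_mul,
      smul_apply]
    have h3 := (mul_eq_zero.1 h2).resolve_left hP
    have h4 : dy d v = v.2.2 := rfl
    rw [h4]
    field_simp at h3 ⊢
    linarith
  exact ⟨_, t₀, t₁, h01, ⟨hsurj, hproj⟩,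
    IsEL.isStationary sys hT hTt h01 hq (hL.isEL hT hTt hψ hψ_pos hl h01 hk hsurj hx)⟩

end ClassicalSystem

end Eisenhart

end

/-! ### The correspondence between geodesics and stationary points -/

theorem mainTheorem2 (d : ℕ) (S : Type*) [TopologicalSpace S] [T2Space S]
    [ChartedSpace (EuclideanSpace ℝ (Fin d)) S] [IsManifold (𝓡 d) 2 S]
    (T : Set ℝ) (hT : IsOpen T) (hTc : IsPreconnected T)
    (sys : Eisenhart.ClassicalSystem d S T)
    (ψ : ℝ → S → ℝ)
    (hψ : ContMDiffOn (𝓘(ℝ, ℝ).prod (𝓡 d)) 𝓘(ℝ, ℝ) 1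
      (fun p : ℝ × S => ψ p.1 p.2) (T ×ˢ univ))
    (hψ_pos : ∀ t ∈ T, ∀ q : S, 0 < ψ t q) :
    (∀ μ : ℝ≥0∞, 0 < μ →
      -- the Eisenhart metric is Lorentzian
      (∀ m : ℝ × S × ℝ, m.1 ∈ T → Eisenhart.IsLorentzian (sys.metric μ ψ m)) ∧
      -- the lifts of a stationary point are causal geodesics
      (∀ (q : ℝ → S) (t₀ t₁ : ℝ), t₀ ∈ T → t₁ ∈ T → t₀ < t₁ → sys.IsStationary q t₀ t₁ →
        ∀ y₀ : ℝ,
          (μ ≠ ∞ →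
            ∃ x : ℝ → ℝ × S × ℝ,
              (∀ t ∈ Icc t₀ t₁, x (Eisenhart.parameter (Eisenhart.recip μ) ψ q t₀ t) =
                sys.lift μ ψ q t₀ t₁ y₀ t) ∧
              Eisenhart.ProjectsTo x 0 (Eisenhart.parameter (Eisenhart.recip μ) ψ q t₀ t₁) q t₀ t₁ ∧
              sys.IsGeodesic μ ψ x 0 (Eisenhart.parameter (Eisenhart.recip μ) ψ q t₀ t₁) ∧
              ∀ l ∈ Icc 0 (Eisenhart.parameter (Eisenhart.recip μ) ψ q t₀ t₁),
                Eisenhart.IsFutureCausal (sys.metric μ ψ (x l)) (Eisenhart.n (d := d) (x l))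
                  (Eisenhart.velocity (Eisenhart.modelM d) x
                  (Icc 0 (Eisenhart.parameter (Eisenhart.recip μ) ψ q t₀ t₁)) l) ∧
                Eisenhart.IsTimelike (sys.metric μ ψ (x l))
                  (Eisenhart.velocity (Eisenhart.modelM d) x
                  (Icc 0 (Eisenhart.parameter (Eisenhart.recip μ) ψ q t₀ t₁)) l) ∧
                sys.metric μ ψ (x l)
                  (Eisenhart.velocity (Eisenhart.modelM d) x
                  (Icc 0 (Eisenhart.parameter (Eisenhart.recip μ) ψ q t₀ t₁)) l)
                  (Eisenhart.velocity (Eisenhart.modelM d) x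
                  (Icc 0 (Eisenhart.parameter (Eisenhart.recip μ) ψ q t₀ t₁)) l) = -1) ∧
          (μ = ∞ →
            ∃ x : ℝ → ℝ × S × ℝ,
              (∀ t ∈ Icc t₀ t₁, x (Eisenhart.parameter 1 ψ q t₀ t) =
                sys.lift μ ψ q t₀ t₁ y₀ t) ∧
              Eisenhart.ProjectsTo x 0 (Eisenhart.parameter 1 ψ q t₀ t₁) q t₀ t₁ ∧
              sys.IsGeodesic μ ψ x 0 (Eisenhart.parameter 1 ψ q t₀ t₁) ∧
              ∀ l ∈ Icc 0 (Eisenhart.parameter 1 ψ q t₀ t₁),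
                Eisenhart.IsFutureCausal (sys.metric μ ψ (x l)) (Eisenhart.n (d := d) (x l))
                  (Eisenhart.velocity (Eisenhart.modelM d) x
                  (Icc 0 (Eisenhart.parameter 1 ψ q t₀ t₁)) l) ∧
                Eisenhart.IsLightlike (sys.metric μ ψ (x l))
                  (Eisenhart.velocity (Eisenhart.modelM d) x
                  (Icc 0 (Eisenhart.parameter 1 ψ q t₀ t₁)) l))) ∧
      -- a geodesic which is the lift of its own projection projects to a stationary point
      (∀ (x : ℝ → ℝ × S × ℝ) (l₀ l₁ : ℝ), l₀ < l₁ → sys.IsGeodesic μ ψ x l₀ l₁ →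
        (∀ l ∈ Icc l₀ l₁, Eisenhart.IsFutureCausal (sys.metric μ ψ (x l))
          (Eisenhart.n (d := d) (x l))
          (Eisenhart.velocity (Eisenhart.modelM d) x (Icc l₀ l₁) l)) →
        ∀ (q : ℝ → S) (t₀ t₁ y₀ : ℝ), t₀ < t₁ →
          Eisenhart.ProjectsTo x l₀ l₁ q t₀ t₁ →
          (∀ l ∈ Icc l₀ l₁, x l = sys.lift μ ψ q t₀ t₁ y₀ (x l).1) →
          sys.IsStationary q t₀ t₁)) ∧
    -- every lightlike geodesic not along `∂/∂y` projects to a stationary point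
    (∀ (x : ℝ → ℝ × S × ℝ) (l₀ l₁ : ℝ), l₀ < l₁ → sys.IsGeodesic ∞ ψ x l₀ l₁ →
      (∀ l ∈ Icc l₀ l₁, Eisenhart.IsLightlike (sys.metric ∞ ψ (x l))
        (Eisenhart.velocity (Eisenhart.modelM d) x (Icc l₀ l₁) l)) →
      ¬ Eisenhart.InFlowLine x l₀ l₁ →
      ∃ (q : ℝ → S) (t₀ t₁ : ℝ), t₀ < t₁ ∧ Eisenhart.ProjectsTo x l₀ l₁ q t₀ t₁ ∧
        sys.IsStationary q t₀ t₁) ∧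
    -- every stationary point is the projection of such a lightlike geodesic
    (∀ (q : ℝ → S) (t₀ t₁ : ℝ), t₀ ∈ T → t₁ ∈ T → t₀ < t₁ → sys.IsStationary q t₀ t₁ →
      ∃ (x : ℝ → ℝ × S × ℝ) (l₀ l₁ : ℝ), l₀ < l₁ ∧ sys.IsGeodesic ∞ ψ x l₀ l₁ ∧
        (∀ l ∈ Icc l₀ l₁,
          Eisenhart.IsFutureCausal (sys.metric ∞ ψ (x l)) (Eisenhart.n (d := d) (x l))
            (Eisenhart.velocity (Eisenhart.modelM d) x (Icc l₀ l₁) l) ∧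
          Eisenhart.IsLightlike (sys.metric ∞ ψ (x l))
            (Eisenhart.velocity (Eisenhart.modelM d) x (Icc l₀ l₁) l)) ∧
        ¬ Eisenhart.InFlowLine x l₀ l₁ ∧ Eisenhart.ProjectsTo x l₀ l₁ q t₀ t₁) := by
  have hTt : ∀ {t₀ t₁ : ℝ}, t₀ ∈ T → t₁ ∈ T → Icc t₀ t₁ ⊆ T := fun h0 h1 => hTc.Icc_subset h0 h1
  -- A negative product with n already excludes the zero vector and gives future direction; vectors
  -- along n never arise for lifts.
  have causal : ∀ {m : ℝ × S × ℝ} {μ : ℝ≥0∞} (v : TangentSpace (Eisenhart.modelM d) m),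
      sys.metric μ ψ m v v ≤ 0 → sys.metric μ ψ m (Eisenhart.n (d := d) m) v < 0 →
      Eisenhart.IsFutureCausal (sys.metric μ ψ m) (Eisenhart.n (d := d) m) v := by
    intro m μ v h1 h2
    refine ⟨?_, h1, Or.inl h2⟩
    rintro rfl
    rw [map_zero] at h2
    exact h2.false
  have lightlike : ∀ {q : ℝ → S} {t₀ t₁ : ℝ}, t₀ ∈ T → t₁ ∈ T → t₀ < t₁ →
      sys.IsStationary q t₀ t₁ → ∀ y₀ : ℝ,
      ∃ x : ℝ → ℝ × S × ℝ,
        (∀ t ∈ Icc t₀ t₁, x (Eisenhart.parameter 1 ψ q t₀ t) = sys.lift ∞ ψ q t₀ t₁ y₀ t) ∧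
        0 < Eisenhart.parameter 1 ψ q t₀ t₁ ∧
        Eisenhart.ProjectsTo x 0 (Eisenhart.parameter 1 ψ q t₀ t₁) q t₀ t₁ ∧
        sys.IsGeodesic ∞ ψ x 0 (Eisenhart.parameter 1 ψ q t₀ t₁) ∧
        ∀ l ∈ Icc 0 (Eisenhart.parameter 1 ψ q t₀ t₁),
          Eisenhart.IsFutureCausal (sys.metric ∞ ψ (x l)) (Eisenhart.n (d := d) (x l))
            (Eisenhart.velocity (Eisenhart.modelM d) x
            (Icc 0 (Eisenhart.parameter 1 ψ q t₀ t₁)) l) ∧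
          Eisenhart.IsLightlike (sys.metric ∞ ψ (x l))
            (Eisenhart.velocity (Eisenhart.modelM d) x
            (Icc 0 (Eisenhart.parameter 1 ψ q t₀ t₁)) l) := by
    intro q t₀ t₁ h0 h1 h01 hst y₀
    obtain ⟨x, hx, hpos, hproj, hgeo, hv⟩ :=
      hst.exists_isGeodesic (μ := ∞) hT hψ hψ_pos (hTt h0 h1) h01 one_pos y₀
    refine ⟨x, hx, hpos, hproj, hgeo, fun l hl => ?_⟩
    obtain ⟨hvv, hnv⟩ := hv l hl
    rw [Eisenhart.recip_top, mul_zero, zero_pow two_ne_zero, neg_zero] at hvv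
    rw [inv_one] at hnv
    have hc := causal _ hvv.le (hnv.trans_lt (by norm_num))
    exact ⟨hc, hc.1, hvv⟩
  refine ⟨fun μ hμ => ⟨fun m hm => sys.isLorentzian_metric hψ_pos hm, ?_, ?_⟩, ?_, ?_⟩
  · intro q t₀ t₁ h0 h1 h01 hst y₀
    refine ⟨fun hμ' => ?_, ?_⟩
    · have hc : 0 < Eisenhart.recip μ :=
        ENNReal.toReal_pos (ENNReal.inv_ne_zero.2 hμ') (ENNReal.inv_ne_top.2 hμ.ne')
      obtain ⟨x, hx, hpos, hproj, hgeo, hv⟩ :=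
        hst.exists_isGeodesic (μ := μ) hT hψ hψ_pos (hTt h0 h1) h01 hc y₀
      refine ⟨x, hx, hproj, hgeo, fun l hl => ?_⟩
      obtain ⟨hvv, hnv⟩ := hv l hl
      rw [inv_mul_cancel₀ hc.ne', one_pow] at hvv
      have hlt := hvv.trans_lt neg_one_lt_zero
      exact ⟨causal _ hlt.le (hnv.trans_lt (neg_lt_zero.2 (inv_pos.2 hc))), hlt, hvv⟩
    · rintro rfl
      obtain ⟨x, hx, -, hproj, hgeo, hv⟩ := lightlike h0 h1 h01 hst y₀
      exact ⟨x, hx, hproj, hgeo, hv⟩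
  · intro x l₀ l₁ hl hx _ q t₀ t₁ y₀ h01 hproj hlift
    exact hx.isStationary_of_lift hT hψ hψ_pos hl h01 hproj hlift
  · intro x l₀ l₁ hl hx hlight hflow
    exact hx.exists_isStationary hT hψ hψ_pos hl (fun l hlJ => (hlight l hlJ).2) hflow
  · intro q t₀ t₁ h0 h1 h01 hst
    obtain ⟨x, -, hpos, hproj, hgeo, hv⟩ := lightlike h0 h1 h01 hst 0
    refine ⟨x, 0, _, hpos, hgeo, hv, ?_, hproj⟩
    -- On a flow line t is constant, but the projection covers the nondegenerate interval [t₀, t₁].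
    rintro ⟨t, _, h⟩
    have hall : ∀ s ∈ Icc t₀ t₁, s = t := by
      intro s hs
      obtain ⟨l, hl, rfl⟩ := hproj.1 ▸ hs
      exact (h l hl).1
    exact h01.ne ((hall t₀ (left_mem_Icc.2 h01.le)).trans
      (hall t₁ (right_mem_Icc.2 h01.le)).symm)
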